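/- Let $(\mu_t)_{t\in\mathbb R}$ be an arbitrary family of probability measures on $\mathbb R$, let $\lambda$ be Lebesgue measure on $[0,1]$, and use the following notation. * $G_\mu(q)=\inf\{x: \mu(]-\infty,x])\ge q\}$ is the quantile function of $\mu$; $\mathfrak Q(\mu,\nu)$ is the law of $(G_\mu,G_\nu)$ under $\lambda$ (the quantile coupling), and $\mathfrak Q$ is the law on $\mathbb R^{\mathbb R}$ of the process $(G_{\mu_t})_{t\in\mathbb R}$ under $\lambda$ (the quantile measure). * If $P$, $Q$ are transport plans with disintegration kernels $k_P,k_Q$ (the second marginal of $P$ being the first marginal of $Q$), the product $P.Q$ is the transport plan with the first marginal of $P$ and kernel $k_P k_Q$; the catenation $P\circ Q$ is the law of a triple $(X,Y,Z)$ with $(X,Y)\sim P$, $(Y,Z)\sim Q$, and $X$, $Z$ independent given $Y$. * For probability measures on $\mathbb R^2$, $P\preceq_{\rm lo}Q$ means $P(]-\infty,x]\times]-\infty,y])\ge Q(]-\infty,x]\times]-\infty,y])$ for all $x,y$; the supremum for this order (smallest upper bound) is denoted by $\mathrm{losup}$. * For a finite set $R=\{r_1<\dots<r_m\}\subset\mathbb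 R$, $\mathfrak Q_{[R]}$ ($\mathfrak Q$ made Markov at the points of $R$) is the law on $\mathbb R^{\mathbb R}$ whose finite marginals inside each of $]-\infty,r_1],[r_1,r_2],\dots,[r_m,+\infty[$ are those of $\mathfrak Q$, catenated at the points of $R$ (past and future are independent given the value at each $r\in R$). * $\mathfrak{MQ}$, the Markov-quantile measure, is the Markov law on $\mathbb R^{\mathbb R}$ whose marginal at $(s,t)$ is, for all $s<t$, $\mathrm{losup}\{\mathfrak Q(\mu_s,\mu_{r_1}).\mathfrak Q(\mu_{r_1},\mu_{r_2}).\cdots.\mathfrak Q(\mu_{r_m},\mu_t): \{r_1<\dots<r_m\}\subset\,]s,t[\}$. * $L_{\{r\}}=\mathfrak Q(\lambda,\mu_r).\mathfrak Q(\mu_r,\lambda)$, $L_{\{r_1<\dots<r_m\}}=L_{\{r_1\}}.\cdots.L_{\{r_m\}}$, $L_\emptyset$ is the identity transport of $\lambda$, and $L_R=\mathrm{losup}\{L_{R'}:R'\subset R\text{ finite}\}$ for any $R\subset\mathbb R$. * $t$ is an atomic time if $\mu_t$ has an atom. An interval $I$ is an essential atomic interval if there is an interval $J\supset I$ such that $J\setminus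 I$ is disconnected and $L_J\ne L_{J\setminus I}$; $t$ is an essential atomic time if $\{t\}$ is an essential atomic interval. * Weak convergence on $\mathbb R^{\mathbb R}$ is weak convergence of all finite-dimensional marginals. A countable set $R\subset\mathbb R$ is called admissible if, for every nested sequence of finite sets $R_n$ with $\bigcup_nR_n=R$, $\mathfrak Q_{[R_n]}$ converges weakly to $\mathfrak{MQ}$. All the suprema $L_R$ and the measures $\mathfrak Q_{[R]}$ ($R$ finite) and $\mathfrak{MQ}$ exist and are unique, and the following holds. **Theorem B.** There is a nested sequence $(R_n)_n$ of finite subsets of $\mathbb R$ such that $\mathfrak Q_{[R_n]}$ converges weakly to $\mathfrak{MQ}$. More precisely: (a) There is a countable set $R\subset\mathbb R$ with $L_{R\cap[s,t]}=L_{[s,t]}$ for all $s<t$, and also $L_{R\cap]s,t[}=L_{]s,t[}$ for all $s<t$. (b) Every countable $R\subset\mathbb R$ such that $L_{R\cap[s,t]}=L_{[s,t]}$ for all $s<t$, or such that $L_{R\cap]s,t[}=L_{]s,t[}$ for all $s<t$, is admissible. (c) Conversely, let $(R_n)_n$ be a nested sequence of finite sets with $\mathfrak Q_{[R_n]}\to\mathfrak{MQ}$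 weakly, and $R=\bigcup_nR_n$. Then: (i) $R$ is admissible, and so is every countable $R''\supset R$; (ii) if $E$ is the set of the non-atomic times of $R$, then $R\setminus E$ is admissible; moreover, for every finite set $E'$ of non-essential atomic times there is an admissible set $R'$ with $R'\cap E'=\emptyset$; (iii) $R$ meets every essential atomic interval of $(\mu_t)_t$; in particular it contains all essential atomic times. The essential atomic times of $(\mu_t)_t$ are at most countably many. -/

import Mathlib

open MeasureTheory ProbabilityTheory Set Filter
open scoped Topology

namespace MarkovQuantile

noncomputable section

/-! ### Transport plans: composition and catenation -/

/-- Composition `P.Q = Joint(P¹, k_P.k_Q)` of two transport plans on the real line. -/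
def comp (P Q : ProbabilityMeasure (ℝ × ℝ)) : ProbabilityMeasure (ℝ × ℝ) :=
  ⟨(P : Measure (ℝ × ℝ)).fst ⊗ₘ
      ((Q : Measure (ℝ × ℝ)).condKernel ∘ₖ (P : Measure (ℝ × ℝ)).condKernel),
    inferInstance⟩

/-- Catenation `P ∘ Q` of `P` (on `α × β`) and `Q` (on `β × γ`): the law on `α × β × γ` obtained
from `P` by drawing the third variable with the disintegration kernel of `Q`, i.e.
`(P ∘ Q)(A × B × C) = ∫_{A × B} k_Q(y, C) dP(x, y)`. -/
def catenate {α β γ : Type*} [MeasurableSpace α] [MeasurableSpace β] [MeasurableSpace γ]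
    [StandardBorelSpace γ] [Nonempty γ]
    (P : ProbabilityMeasure (α × β)) (Q : ProbabilityMeasure (β × γ)) :
    ProbabilityMeasure (α × β × γ) :=
  ⟨((P : Measure (α × β)) ⊗ₘ
      ((Q : Measure (β × γ)).condKernel.comap Prod.snd measurable_snd)).map
        MeasurableEquiv.prodAssoc,
    Measure.isProbabilityMeasure_map MeasurableEquiv.prodAssoc.measurable.aemeasurable⟩

/-! ### Lower orthant order -/

/-- `P ≼ Q` in the lower orthant order: `F_P ≥ F_Q`. -/
def LoLE (P Q : ProbabilityMeasure (ℝ × ℝ)) : Prop :=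
  ∀ x y : ℝ, (Q : Measure (ℝ × ℝ)) (Iic x ×ˢ Iic y) ≤ (P : Measure (ℝ × ℝ)) (Iic x ×ˢ Iic y)

/-- `P` is the lower orthant supremum (the smallest upper bound) of `𝒮`. -/
def IsLoSup (𝒮 : Set (ProbabilityMeasure (ℝ × ℝ))) (P : ProbabilityMeasure (ℝ × ℝ)) : Prop :=
  (∀ A ∈ 𝒮, LoLE A P) ∧ ∀ Q, (∀ A ∈ 𝒮, LoLE A Q) → LoLE P Q

/-! ### Laws of processes indexed by the real line -/

/-- The two-dimensional marginal `P^{s,t}`. -/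
def marg₂ (P : ProbabilityMeasure (ℝ → ℝ)) (s t : ℝ) : ProbabilityMeasure (ℝ × ℝ) :=
  P.map (f := fun x => (x s, x t)) (by fun_prop)

/-- The marginal of `P` on a finite set `S` of times. -/
def margFin (P : ProbabilityMeasure (ℝ → ℝ)) (S : Finset ℝ) : ProbabilityMeasure (S → ℝ) :=
  P.map (f := S.restrict) (by fun_prop)

/-- Weak convergence on `ℝ^ℝ`: weak convergence of all finite-dimensional marginals. -/
def WeakTendsto (P : ℕ → ProbabilityMeasure (ℝ → ℝ)) (Q : ProbabilityMeasure (ℝ → ℝ)) : Prop :=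
  ∀ S : Finset ℝ, Tendsto (fun n => margFin (P n) S) atTop (𝓝 (margFin Q S))

/-- `P` is Markov at the instant `r`: past and future are independent conditionally on the value
at time `r`. In terms of finite marginals: `P^{S, r, T} = P^{S, r} ∘ P^{r, T}` for all finite sets
`S` of times before `r` and `T` of times after `r`. -/
def MarkovAt (P : ProbabilityMeasure (ℝ → ℝ)) (r : ℝ) : Prop :=
  ∀ S T : Finset ℝ, (∀ s ∈ S, s < r) → (∀ t ∈ T, r < t) →
    P.map (f := fun x => (S.restrict x, x r, T.restrict x)) (by fun_prop) =
      catenate (P.map (f := fun x => (S.restrict x, x r)) (by fun_prop))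
        (P.map (f := fun x => (x r, T.restrict x)) (by fun_prop))

/-- `P` is (the law of) a Markov process. -/
def IsMarkov (P : ProbabilityMeasure (ℝ → ℝ)) : Prop := ∀ r, MarkovAt P r

/-- `P` is the law `M` made Markov at the points of the finite set `R = {r₁ < ⋯ < rₘ}`: the finite
marginals of `P` are those of `M` on each of `]-∞, r₁], [r₁, r₂], …, [rₘ, +∞[`, and these are
catenated at the points of `R`. (A finite set `S` lies in one of those intervals if and only if no
point of `R` lies strictly between two points of `S`.) -/
def IsMadeMarkov (M : ProbabilityMeasure (ℝ → ℝ)) (R : Finset ℝ)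
    (P : ProbabilityMeasure (ℝ → ℝ)) : Prop :=
  (∀ S : Finset ℝ, (∀ r ∈ R, (∀ s ∈ S, s ≤ r) ∨ (∀ s ∈ S, r ≤ s)) → margFin P S = margFin M S) ∧
    ∀ r ∈ R, MarkovAt P r

/-- The measure `M_{[R]}`, i.e. `M` made Markov at the points of the finite set `R`. -/
def madeMarkov (M : ProbabilityMeasure (ℝ → ℝ)) (R : Finset ℝ) : ProbabilityMeasure (ℝ → ℝ) :=
  Classical.epsilon (IsMadeMarkov M R)

/-! ### Quantile coupling and quantile process -/

/-- Lebesgue measure on `[0, 1]`, as a probability measure on the real line. -/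
def lam : ProbabilityMeasure ℝ :=
  ⟨volume.restrict (Icc 0 1), ⟨by simp⟩⟩

/-- The quantile function `G_μ(q) = inf {x : F_μ(x) ≥ q}`; it is meaningful for `0 < q < 1`,
i.e. `lam`-almost everywhere. -/
def quantile (μ : ProbabilityMeasure ℝ) (q : ℝ) : ℝ := sInf {x : ℝ | q ≤ cdf (μ : Measure ℝ) x}

theorem quantile_monotoneOn (μ : ProbabilityMeasure ℝ) : MonotoneOn (quantile μ) (Ioo 0 1) := by
  intro p hp q hq hpq
  refine csInf_le_csInf ?_ ?_ (fun x hx => hpq.trans hx)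
  · obtain ⟨a, ha⟩ := ((tendsto_cdf_atBot (μ : Measure ℝ)).eventually (gt_mem_nhds hp.1)).exists
    exact ⟨a, fun x hx => le_of_not_gt fun h =>
      absurd (hx.trans (monotone_cdf (μ : Measure ℝ) h.le)) (not_le.mpr ha)⟩
  · obtain ⟨b, hb⟩ := ((tendsto_cdf_atTop (μ : Measure ℝ)).eventually (lt_mem_nhds hq.2)).exists
    exact ⟨b, hb.le⟩

theorem measurable_quantile (μ : ProbabilityMeasure ℝ) : Measurable (quantile μ) := by
  have h : quantile μ = fun q => if q ∈ Ioo (0 : ℝ) 1 then quantile μ q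
      else if q = 1 then quantile μ 1 else 0 := by
    funext q
    by_cases hq : q ∈ Ioo (0 : ℝ) 1
    · simp [hq]
    · by_cases h1 : q = 1
      · simp [h1]
      · simp only [hq, h1, if_false]
        rcases le_or_gt q 0 with h0 | h0
        · have : {x : ℝ | q ≤ cdf (μ : Measure ℝ) x} = univ :=
            eq_univ_of_forall fun x => h0.trans (cdf_nonneg _ x)
          simp [quantile, this]
        · have hq1 : 1 < q := lt_of_le_of_ne
            (not_lt.mp fun h => hq ⟨h0, h⟩) (Ne.symm h1)
          have : {x : ℝ | q ≤ cdf (μ : Measure ℝ) x} = ∅ :=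
            eq_empty_of_forall_notMem fun x hx =>
              absurd (le_trans hx (cdf_le_one _ x)) (not_le.mpr hq1)
          simp [quantile, this]
  refine measurable_of_restrict_of_restrict_compl (s := Ioo (0 : ℝ) 1) measurableSet_Ioo ?_ ?_
  · exact Monotone.measurable fun a b hab => quantile_monotoneOn μ a.2 b.2 hab
  · have : (Ioo (0 : ℝ) 1)ᶜ.domRestrict (quantile μ) =
        fun q : ((Ioo (0 : ℝ) 1)ᶜ : Set ℝ) => if (q : ℝ) = 1 then quantile μ 1 else 0 := by
      funext q
      rw [Set.domRestrict_apply, congrFun h q.1]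
      exact if_neg q.2
    rw [this]
    exact Measurable.ite (measurable_subtype_coe (measurableSet_singleton 1))
      measurable_const measurable_const

/-- The quantile (comonotone) coupling `𝔔(μ, ν)`: the law of `(G_μ, G_ν)` on `([0, 1], λ)`. -/
def quantileCoupling (μ ν : ProbabilityMeasure ℝ) : ProbabilityMeasure (ℝ × ℝ) :=
  lam.map (f := fun q => (quantile μ q, quantile ν q))
    ((measurable_quantile μ).prodMk (measurable_quantile ν)).aemeasurable

/-- The quantile measure `𝔔` of the family `(μ_t)`: the law of the process `(G_{μ_t})_t` on
`([0, 1], λ)`. -/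
def quantileProcess (μ : ℝ → ProbabilityMeasure ℝ) : ProbabilityMeasure (ℝ → ℝ) :=
  lam.map (f := fun q t => quantile (μ t) q)
    (measurable_pi_lambda _ fun t => measurable_quantile (μ t)).aemeasurable

/-! ### The Markov-quantile measure -/

/-- The product `𝔔(μ_s, μ_{r₁}) . 𝔔(μ_{r₁}, μ_{r₂}) . ⋯ . 𝔔(μ_{rₘ}, μ_t)` of quantile couplings
along the list `[r₁, …, rₘ]`. -/
def quantileChain (μ : ℝ → ProbabilityMeasure ℝ) (t : ℝ) : ℝ → List ℝ → ProbabilityMeasure (ℝ × ℝ)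
  | s, [] => quantileCoupling (μ s) (μ t)
  | s, r :: l => comp (quantileCoupling (μ s) (μ r)) (quantileChain μ t r l)

/-- `P` is the Markov-quantile measure of `(μ_t)`: it is Markov, and for all `s < t` its marginal
`P^{s,t}` is the lower orthant supremum of the products
`𝔔(μ_s, μ_{r₁}) . ⋯ . 𝔔(μ_{rₘ}, μ_t)` over the finite sets `{r₁ < ⋯ < rₘ} ⊆ ]s, t[`. -/
def IsMarkovQuantile (μ : ℝ → ProbabilityMeasure ℝ) (P : ProbabilityMeasure (ℝ → ℝ)) : Prop :=
  IsMarkov P ∧ ∀ s t : ℝ, s < t →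
    IsLoSup {C | ∃ R : Finset ℝ, (R : Set ℝ) ⊆ Ioo s t ∧ C = quantileChain μ t s R.sort}
      (marg₂ P s t)

/-- The Markov-quantile measure `𝔐𝔔` of `(μ_t)`. -/
def markovQuantile (μ : ℝ → ProbabilityMeasure ℝ) : ProbabilityMeasure (ℝ → ℝ) :=
  Classical.epsilon (IsMarkovQuantile μ)

/-! ### Transport plans on the space of quantile levels -/

/-- `L_{r} = 𝔔(λ, μ_r) . 𝔔(μ_r, λ)`: it is the identity transport of `λ` outside of the intervals
`]F_r(x⁻), F_r(x)[`, `x` an atom of `μ_r`, and makes uniform the mass in each of them. -/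
def levelStep (ν : ProbabilityMeasure ℝ) : ProbabilityMeasure (ℝ × ℝ) :=
  comp (quantileCoupling lam ν) (quantileCoupling ν lam)

/-- The product `L_{r₁} . L_{r₂} . ⋯ . L_{rₘ}` along a list; the identity transport of `λ` for the
empty list. -/
def levelChain (μ : ℝ → ProbabilityMeasure ℝ) : List ℝ → ProbabilityMeasure (ℝ × ℝ)
  | [] => lam.map (f := fun q => (q, q)) (by fun_prop)
  | r :: l => comp (levelStep (μ r)) (levelChain μ l)

/-- The set of all `L_{R'}`, for `R'` a finite subset of `R`. -/
def levelFamily (μ : ℝ → ProbabilityMeasure ℝ) (R : Set ℝ) : Set (ProbabilityMeasure (ℝ × ℝ)) :=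
  {C | ∃ R' : Finset ℝ, (R' : Set ℝ) ⊆ R ∧ C = levelChain μ R'.sort}

/-- The transport plan `L_R` for an arbitrary set `R` of times: the lower orthant supremum of
the plans `L_{R'}`, `R'` a finite subset of `R`. -/
def level (μ : ℝ → ProbabilityMeasure ℝ) (R : Set ℝ) : ProbabilityMeasure (ℝ × ℝ) :=
  Classical.epsilon (IsLoSup (levelFamily μ R))

/-! ### Atomic times, essential atomic intervals, admissible sets -/

/-- `t` is an atomic time of `(μ_t)`: the measure `μ_t` has an atom. -/
def IsAtomicTime (μ : ℝ → ProbabilityMeasure ℝ) (t : ℝ) : Prop :=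
  ∃ x : ℝ, (μ t : Measure ℝ) {x} ≠ 0

/-- `I` is an essential atomic interval of `(μ_t)`. -/
def IsEssentialInterval (μ : ℝ → ProbabilityMeasure ℝ) (I : Set ℝ) : Prop :=
  I.OrdConnected ∧ ∃ J : Set ℝ, J.OrdConnected ∧ I ⊆ J ∧ ¬ IsPreconnected (J \ I) ∧
    level μ J ≠ level μ (J \ I)

/-- `t` is an essential atomic time of `(μ_t)`. -/
def IsEssentialTime (μ : ℝ → ProbabilityMeasure ℝ) (t : ℝ) : Prop :=
  IsEssentialInterval μ {t}

/-- The convergence statement for a nested sequence `Rₙ` of finite sets of times: `𝔔_{[Rₙ]}`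
converges weakly to `𝔐𝔔`. -/
def Converges (μ : ℝ → ProbabilityMeasure ℝ) (Rn : ℕ → Finset ℝ) : Prop :=
  WeakTendsto (fun n => madeMarkov (quantileProcess μ) (Rn n)) (markovQuantile μ)

/-- A countable set `R` of times is admissible if `𝔔_{[Rₙ]}` converges weakly to `𝔐𝔔` for every
nested sequence of finite sets `Rₙ` with union `R`. -/
def Admissible (μ : ℝ → ProbabilityMeasure ℝ) (R : Set ℝ) : Prop :=
  R.Countable ∧ ∀ Rn : ℕ → Finset ℝ, Monotone Rn → (⋃ n, (Rn n : Set ℝ)) = R → Converges μ Rn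

end

end MarkovQuantile

namespace MarkovQuantile

noncomputable section

/-! ### Levels, resampling kernels and test functions. -/

section

/-! ### Quantile functions -/

-- All objects are transported to the space of levels: a value of `μ t` is `quantile (μ t) q`, with
-- `q` distributed according to `Λ`. Making the quantile process Markov at `r` means resampling the
-- level inside the fibre of `quantile (μ r)`. On functions this is the conditional expectation
-- `proj (μ r)`, which is symmetric and preserves functions that decrease almost everywhere. The
-- probability that a made-Markov process lies below given thresholds is therefore a `form`: an
-- integral in which decreasing observations (indicators of half-lines) alternate with projections.
--
-- Chebyshev's inequality in each fibre shows that an additional projection can only lower such an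
-- integral (`form_anti`). Along the finite subsets of any `R` the forms thus converge to their
-- infimum `limForm`. By compactness the limits are the lower orthant probabilities of an actual law
-- (`exists_limit_law`, `exists_isLimitLaw`); no mass is lost on boundaries because `Λ` has no
-- atoms. This law is Markov at every point of `R` (`IsLimitLaw.markovAt`). A finite `R` gives
-- `madeMarkov`, all of `ℝ` gives `markovQuantile`, and the forms without observations give the
-- plans `level` (`level_real`). Hence convergence to the Markov-quantile measure is the equality of
-- the limit forms of `R` and of `ℝ` (`converges_iff`). It depends only on the union of the sequence
-- and passes to supersets; non-atomic times do not count, since the projection is then the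
-- identity.
--
-- The heart of (b) is that the plans `level` see no observation between their two ends, whereas
-- finite marginals do. Let a time `r` be added to `R`, and isolate it from the other observation
-- times by an interval. Equality of the plans on that interval says that projecting at `r` costs
-- arbitrarily little when nothing is observed at `r`. The cost with a weight `g` at `r` is no
-- larger, because Chebyshev's inequality also holds with the weight `1 - g`
-- (`integral_weight_sub_proj_le`). So `R` can absorb any finite set of times
-- (`IsOpenDense.limForm_eq`).
--
-- For (a), plans are determined by rational thresholds, and rational intervals suffice for open
-- intervals; closed intervals require the endpoints at which a monotone function jumps, and these
-- are countably many. For (c)(iii), the two-time marginals at `s < t` determine the plan of `[s,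
-- t]` once `s` and `t` are adjoined (`levelLE_of_limForm_pair_eq`). If `R` missed an essential
-- interval `I ⊆ J`, choosing `s` and `t` in `J \ I` on the two sides of `I` would show that `I` is
-- superfluous in `J`. A countable set as in (a) therefore contains all essential times.

notation "Λ" => ((lam : ProbabilityMeasure ℝ) : Measure ℝ)

theorem lam_eq : Λ = volume.restrict (Icc 0 1) := rfl

theorem ae_lam_mem_Ioo : ∀ᵐ q ∂Λ, q ∈ Ioo (0 : ℝ) 1 := by
  rw [lam_eq, ← restrict_Ioo_eq_restrict_Icc]
  exact ae_restrict_mem measurableSet_Ioo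

instance : NullSingletonClass Λ := by
  rw [lam_eq]; infer_instance

theorem bddBelow_cdf_ge (ν : ProbabilityMeasure ℝ) {q : ℝ} (hq : 0 < q) :
    BddBelow {x : ℝ | q ≤ cdf (ν : Measure ℝ) x} := by
  obtain ⟨a, ha⟩ := ((tendsto_cdf_atBot (ν : Measure ℝ)).eventually (gt_mem_nhds hq)).exists
  exact ⟨a, fun x hx => le_of_not_gt fun h =>
    absurd (hx.trans (monotone_cdf (ν : Measure ℝ) h.le)) (not_le.mpr ha)⟩

/-- The Galois connection between the quantile function and the distribution function. -/
theorem quantile_le_iff (ν : ProbabilityMeasure ℝ) {q : ℝ} (hq : q ∈ Ioo (0 : ℝ) 1) (x : ℝ) :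
    quantile ν q ≤ x ↔ q ≤ cdf (ν : Measure ℝ) x := by
  constructor
  · intro h
    have hne : {x : ℝ | q ≤ cdf (ν : Measure ℝ) x}.Nonempty := by
      obtain ⟨b, hb⟩ :=
        ((tendsto_cdf_atTop (ν : Measure ℝ)).eventually (lt_mem_nhds hq.2)).exists
      exact ⟨b, hb.le⟩
    have key : ∀ y, x < y → q ≤ cdf (ν : Measure ℝ) y := by
      intro y hy
      obtain ⟨z, hz, hzy⟩ := exists_lt_of_csInf_lt hne (lt_of_le_of_lt h hy)
      exact le_trans hz (monotone_cdf _ hzy.le)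
    have hcont : Tendsto (cdf (ν : Measure ℝ)) (𝓝[>] x) (𝓝 (cdf (ν : Measure ℝ) x)) :=
      ((cdf (ν : Measure ℝ)).right_continuous x).mono_left (nhdsWithin_mono _ Ioi_subset_Ici_self)
    refine ge_of_tendsto hcont ?_
    filter_upwards [self_mem_nhdsWithin] with y hy using key y hy
  · intro h
    exact csInf_le (bddBelow_cdf_ge ν hq.1) h

theorem lam_Iic {p : ℝ} (h1 : p ≤ 1) : Λ (Iic p) = ENNReal.ofReal p := by
  rw [lam_eq, Measure.restrict_apply measurableSet_Iic]
  have : Iic p ∩ Icc (0 : ℝ) 1 = Icc 0 p := by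
    ext x; simp only [mem_inter_iff, mem_Iic, mem_Icc]
    exact ⟨fun h => ⟨h.2.1, h.1⟩, fun h => ⟨h.2, h.1, h.2.trans h1⟩⟩
  rw [this, Real.volume_Icc, sub_zero]

theorem ae_quantile_le_iff (ν : ProbabilityMeasure ℝ) (x : ℝ) :
    ∀ᵐ q ∂Λ, (quantile ν q ≤ x ↔ q ≤ cdf (ν : Measure ℝ) x) := by
  filter_upwards [ae_lam_mem_Ioo] with q hq using quantile_le_iff ν hq x

theorem map_quantile (ν : ProbabilityMeasure ℝ) : Measure.map (quantile ν) Λ = (ν : Measure ℝ) := by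
  have : IsProbabilityMeasure (Measure.map (quantile ν) Λ) :=
    Measure.isProbabilityMeasure_map (measurable_quantile ν).aemeasurable
  refine Measure.ext_of_Iic _ _ fun x => ?_
  rw [Measure.map_apply (measurable_quantile ν) measurableSet_Iic, ← ofReal_cdf,
    ← lam_Iic (cdf_le_one _ x)]
  refine measure_congr ?_
  filter_upwards [ae_quantile_le_iff ν x] with q hq
  exact propext hq

theorem quantile_lam {q : ℝ} (hq : q ∈ Ioo (0 : ℝ) 1) : quantile lam q = q := by
  have h : ∀ x, quantile lam q ≤ x ↔ q ≤ x := by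
    intro x
    rw [quantile_le_iff lam hq, cdf_eq_real]
    rcases le_total 1 x with h1 | h1
    · have : Λ (Iic x) = 1 := by
        refine le_antisymm prob_le_one ?_
        calc (1 : ENNReal) = Λ (Iic 1) := by rw [lam_Iic le_rfl]; simp
          _ ≤ _ := measure_mono (Iic_subset_Iic.2 h1)
      simp only [Measure.real, this, ENNReal.toReal_one]
      exact ⟨fun _ => hq.2.le.trans h1, fun _ => hq.2.le⟩
    · rcases le_total 0 x with h0 | h0
      · rw [Measure.real, lam_Iic h1, ENNReal.toReal_ofReal h0]
      · have : Λ (Iic x) = 0 := by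
          refine le_antisymm ?_ (zero_le)
          calc Λ (Iic x) ≤ Λ (Iic 0) := measure_mono (Iic_subset_Iic.2 h0)
            _ = 0 := by rw [lam_Iic zero_le_one]; simp
        simp only [Measure.real, this, ENNReal.toReal_zero]
        exact ⟨fun h => absurd hq.1 (not_lt.2 h), fun h => h.trans h0⟩
  exact le_antisymm ((h q).2 le_rfl) ((h _).1 le_rfl)

theorem ae_quantile_lam : ∀ᵐ q ∂Λ, quantile lam q = q := by
  filter_upwards [ae_lam_mem_Ioo] with q hq using quantile_lam hq

/-! ### Disintegration of the Lebesgue measure along a quantile function -/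

/-- The conditional law of the level given the value of the quantile function. -/
def levelKernel (ν : ProbabilityMeasure ℝ) : Kernel ℝ ℝ :=
  (quantileCoupling ν lam : Measure (ℝ × ℝ)).condKernel

instance (ν : ProbabilityMeasure ℝ) : IsMarkovKernel (levelKernel ν) := by
  unfold levelKernel; infer_instance

theorem quantileCoupling_toMeasure (μ ν : ProbabilityMeasure ℝ) :
    (quantileCoupling μ ν : Measure (ℝ × ℝ)) = Measure.map (fun q => (quantile μ q, quantile ν q)) Λ :=
  rfl

theorem quantileCoupling_fst (μ ν : ProbabilityMeasure ℝ) :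
    (quantileCoupling μ ν : Measure (ℝ × ℝ)).fst = (μ : Measure ℝ) := by
  rw [quantileCoupling_toMeasure, Measure.fst_map_prodMk (measurable_quantile ν), map_quantile]

theorem measurable_quantile_prodMk (ν : ProbabilityMeasure ℝ) :
    Measurable fun q => (quantile ν q, q) :=
  (measurable_quantile ν).prodMk measurable_id

/-- As `quantile lam` is almost everywhere the identity, the conditional kernel of `quantileCoupling
ν lam` disintegrates `Λ` along the fibres of `quantile ν`. -/
theorem map_quantile_id (ν : ProbabilityMeasure ℝ) :
    (ν : Measure ℝ) ⊗ₘ levelKernel ν = Measure.map (fun q => (quantile ν q, q)) Λ := by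
  have h := (quantileCoupling ν lam : Measure (ℝ × ℝ)).disintegrate
    (quantileCoupling ν lam : Measure (ℝ × ℝ)).condKernel
  rw [quantileCoupling_fst] at h
  rw [levelKernel, h, quantileCoupling_toMeasure]
  refine Measure.map_congr ?_
  filter_upwards [ae_quantile_lam] with q hq
  rw [hq]

/-- The kernel of `levelStep ν`: resample the level inside of the fibre of `quantile ν`. -/
def fibreKernel (ν : ProbabilityMeasure ℝ) : Kernel ℝ ℝ :=
  (levelKernel ν).comap (quantile ν) (measurable_quantile ν)

instance (ν : ProbabilityMeasure ℝ) : IsMarkovKernel (fibreKernel ν) := by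
  unfold fibreKernel; infer_instance

theorem fibreKernel_apply (ν : ProbabilityMeasure ℝ) (q : ℝ) :
    fibreKernel ν q = levelKernel ν (quantile ν q) := rfl

theorem ae_of_ae_quantile (ν : ProbabilityMeasure ℝ) {p : ℝ → Prop}
    (h : ∀ᵐ x ∂(ν : Measure ℝ), p x) : ∀ᵐ q ∂Λ, p (quantile ν q) := by
  rw [← map_quantile ν] at h
  exact ae_of_ae_map (measurable_quantile ν).aemeasurable h

/-- Resampling in the fibres preserves `Λ`, so a null set of levels is charged from almost no
starting level. -/
theorem ae_fibreKernel_of_ae (ν : ProbabilityMeasure ℝ) {p : ℝ → Prop} (h : ∀ᵐ q ∂Λ, p q) :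
    ∀ᵐ q ∂Λ, ∀ᵐ q' ∂(fibreKernel ν q), p q' := by
  refine ae_of_ae_quantile ν (p := fun x => ∀ᵐ q' ∂(levelKernel ν x), p q') ?_
  refine Measure.ae_ae_of_ae_compProd (p := fun z : ℝ × ℝ => p z.2) ?_
  rw [map_quantile_id]
  -- The property `p` need not be measurable; its exceptional set is enlarged to a measurable null
  -- set.
  have hs := measurableSet_toMeasurable Λ {q | ¬ p q}
  have h0 : Λ (toMeasurable Λ {q | ¬ p q}) = 0 := by rw [measure_toMeasurable]; exact h
  have : ∀ᵐ z ∂(Measure.map (fun q => (quantile ν q, q)) Λ), z.2 ∉ toMeasurable Λ {q | ¬ p q} := by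
    exact (ae_map_iff (measurable_quantile_prodMk ν).aemeasurable (measurable_snd hs.compl)).2
      (measure_eq_zero_iff_ae_notMem.1 h0)
  filter_upwards [this] with z hz
  by_contra hc
  exact hz (subset_toMeasurable _ _ hc)

/-- The disintegrated measure lives on the graph of `quantile ν`, so the kernel really stays in the
fibre of its starting level. -/
theorem ae_fibreKernel_quantile_eq (ν : ProbabilityMeasure ℝ) :
    ∀ᵐ q ∂Λ, ∀ᵐ q' ∂(fibreKernel ν q), quantile ν q' = quantile ν q := by
  refine ae_of_ae_quantile ν (p := fun x => ∀ᵐ q' ∂(levelKernel ν x), quantile ν q' = x) ?_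
  refine Measure.ae_ae_of_ae_compProd (p := fun z : ℝ × ℝ => quantile ν z.2 = z.1) ?_
  rw [map_quantile_id]
  exact (ae_map_iff (measurable_quantile_prodMk ν).aemeasurable
    (measurableSet_eq_fun ((measurable_quantile ν).comp measurable_snd) measurable_fst)).2
    (Eventually.of_forall fun _ => rfl)

/-! ### Functions with values in the unit interval -/

/-- Measurable functions with values in `[0, 1]`. -/
structure IsUnitValued {α : Type*} [MeasurableSpace α] (b : α → ℝ) : Prop where
  meas : Measurable b
  nonneg : ∀ x, 0 ≤ b x
  le_one : ∀ x, b x ≤ 1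

namespace IsUnitValued

variable {α β : Type*} [MeasurableSpace α] [MeasurableSpace β] {a b : α → ℝ}

theorem integrable (h : IsUnitValued b) (m : Measure α) [IsFiniteMeasure m] : Integrable b m :=
  Integrable.of_bound h.meas.aestronglyMeasurable 1
    (Eventually.of_forall fun x => by
      rw [Real.norm_eq_abs, abs_of_nonneg (h.nonneg x)]; exact h.le_one x)

theorem mul (ha : IsUnitValued a) (hb : IsUnitValued b) : IsUnitValued fun x => a x * b x where
  meas := ha.meas.mul hb.meas
  nonneg x := mul_nonneg (ha.nonneg x) (hb.nonneg x)
  le_one x := mul_le_one₀ (ha.le_one x) (hb.nonneg x) (hb.le_one x)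

theorem one : IsUnitValued fun _ : α => (1 : ℝ) :=
  ⟨measurable_const, fun _ => zero_le_one, fun _ => le_rfl⟩

theorem one_sub (hb : IsUnitValued b) : IsUnitValued fun x => 1 - b x where
  meas := measurable_const.sub hb.meas
  nonneg x := by linarith [hb.le_one x]
  le_one x := by linarith [hb.nonneg x]

theorem comp (hb : IsUnitValued b) {g : β → α} (hg : Measurable g) :
    IsUnitValued fun x => b (g x) :=
  ⟨hb.meas.comp hg, fun _ => hb.nonneg _, fun _ => hb.le_one _⟩

theorem prod {ι : Type*} (S : Finset ι) {h : ι → α → ℝ} (hh : ∀ i ∈ S, IsUnitValued (h i)) :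
    IsUnitValued fun x => ∏ i ∈ S, h i x where
  meas := Finset.measurable_fun_prod _ fun i hi => (hh i hi).meas
  nonneg x := Finset.prod_nonneg fun i hi => (hh i hi).nonneg x
  le_one x := Finset.prod_le_one (fun i hi => (hh i hi).nonneg x) fun i hi => (hh i hi).le_one x

theorem indicator {s : Set α} (hs : MeasurableSet s) :
    IsUnitValued (s.indicator fun _ => (1 : ℝ)) where
  meas := measurable_const.indicator hs
  nonneg := indicator_nonneg fun _ _ => zero_le_one
  le_one := indicator_le_self' fun _ _ => zero_le_one

theorem integral_nonneg (hb : IsUnitValued b) (m : Measure α) : 0 ≤ ∫ x, b x ∂m :=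
  MeasureTheory.integral_nonneg hb.nonneg

theorem integral_le_one (hb : IsUnitValued b) (m : Measure α) [IsProbabilityMeasure m] :
    ∫ x, b x ∂m ≤ 1 := by
  calc ∫ x, b x ∂m ≤ ∫ _, (1 : ℝ) ∂m :=
        integral_mono (hb.integrable m) (integrable_const 1) hb.le_one
    _ = 1 := by simp

theorem kernel_integral (hb : IsUnitValued b) (κ : Kernel β α) [IsMarkovKernel κ] :
    IsUnitValued fun x => ∫ y, b y ∂(κ x) where
  meas := (hb.meas.stronglyMeasurable.integral_kernel (κ := κ)).measurable
  nonneg _ := hb.integral_nonneg _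
  le_one _ := hb.integral_le_one _

end IsUnitValued

end

/-! ### Conditional expectations given a quantile function, and Chebyshev's inequality. -/

section

/-! ### Conditional expectation given a quantile function -/

/-- A version of the conditional expectation under `lam` of `b` given `quantile ν`. -/
def proj (ν : ProbabilityMeasure ℝ) (b : ℝ → ℝ) (q : ℝ) : ℝ := ∫ q', b q' ∂(fibreKernel ν q)

theorem IsUnitValued.proj {b : ℝ → ℝ} (hb : IsUnitValued b) (ν : ProbabilityMeasure ℝ) :
    IsUnitValued (proj ν b) :=
  hb.kernel_integral _

theorem proj_congr_ae (ν : ProbabilityMeasure ℝ) {a b : ℝ → ℝ} (h : ∀ᵐ q ∂Λ, a q = b q) :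
    ∀ᵐ q ∂Λ, proj ν a q = proj ν b q := by
  filter_upwards [ae_fibreKernel_of_ae ν h] with q hq using integral_congr_ae hq

/-- Disintegration of `Λ` over the values of the quantile function; the integral identities for
`proj` come from special choices of `f`. -/
theorem integral_quantile_prodMk (ν : ProbabilityMeasure ℝ) {f : ℝ × ℝ → ℝ}
    (hf : IsUnitValued f) :
    ∫ q, f (quantile ν q, q) ∂Λ = ∫ q, ∫ q', f (quantile ν q, q') ∂(fibreKernel ν q) ∂Λ := by
  calc ∫ q, f (quantile ν q, q) ∂Λ
      = ∫ z, f z ∂(Measure.map (fun q => (quantile ν q, q)) Λ) :=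
        (integral_map (measurable_quantile_prodMk ν).aemeasurable
          hf.meas.aestronglyMeasurable).symm
    _ = ∫ x, ∫ q', f (x, q') ∂(levelKernel ν x) ∂(ν : Measure ℝ) := by
        rw [← map_quantile_id, Measure.integral_compProd (hf.integrable _)]
    _ = ∫ x, ∫ q', f (x, q') ∂(levelKernel ν x) ∂(Measure.map (quantile ν) Λ) := by
        rw [map_quantile]
    _ = _ := by
        rw [integral_map (measurable_quantile ν).aemeasurable]
        · rfl
        · exact (hf.meas.stronglyMeasurable.integral_kernel_prod_right'
            (κ := levelKernel ν)).aestronglyMeasurable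

/-- A function of the quantile function times a projected function. -/
theorem integral_mul_proj_mul (ν : ProbabilityMeasure ℝ) {g a b : ℝ → ℝ} (hg : IsUnitValued g)
    (ha : IsUnitValued a) (hb : IsUnitValued b) :
    ∫ q, g (quantile ν q) * (proj ν a q * b q) ∂Λ =
      ∫ q, g (quantile ν q) * (proj ν a q * proj ν b q) ∂Λ := by
  have h := integral_quantile_prodMk ν
    (f := fun z => g z.1 * ((∫ q', a q' ∂(levelKernel ν z.1)) * b z.2))
    ((hg.comp measurable_fst).mul
      (((ha.kernel_integral (levelKernel ν)).comp measurable_fst).mul (hb.comp measurable_snd)))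
  simp only [integral_const_mul] at h
  exact h

theorem integral_comp_quantile_mul_proj (ν : ProbabilityMeasure ℝ) {g b : ℝ → ℝ}
    (hg : IsUnitValued g) (hb : IsUnitValued b) :
    ∫ q, g (quantile ν q) * proj ν b q ∂Λ = ∫ q, g (quantile ν q) * b q ∂Λ := by
  have h := integral_quantile_prodMk ν (f := fun z => g z.1 * b z.2)
    ((hg.comp measurable_fst).mul (hb.comp measurable_snd))
  simp only [integral_const_mul] at h
  exact h.symm

theorem integral_proj (ν : ProbabilityMeasure ℝ) {b : ℝ → ℝ} (hb : IsUnitValued b) :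
    ∫ q, proj ν b q ∂Λ = ∫ q, b q ∂Λ := by
  simpa using integral_comp_quantile_mul_proj ν IsUnitValued.one hb

/-- Both sides equal the integral of the product of the two projections. This symmetry lets a
projection be moved from one factor to the other. -/
theorem integral_mul_proj (ν : ProbabilityMeasure ℝ) {a b : ℝ → ℝ} (ha : IsUnitValued a)
    (hb : IsUnitValued b) : ∫ q, a q * proj ν b q ∂Λ = ∫ q, proj ν a q * b q ∂Λ := by
  have h1 := integral_mul_proj_mul ν IsUnitValued.one ha hb
  have h2 := integral_mul_proj_mul ν IsUnitValued.one hb ha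
  simp only [one_mul] at h1 h2
  rw [h1]
  simp only [mul_comm (a _), mul_comm (proj ν a _), h2]

/-- A function of the quantile is constant on each fibre and can be taken out of the fibre integral.
-/
theorem proj_comp_quantile_mul (ν : ProbabilityMeasure ℝ) (g b : ℝ → ℝ) :
    ∀ᵐ q ∂Λ, proj ν (fun q => g (quantile ν q) * b q) q = g (quantile ν q) * proj ν b q := by
  filter_upwards [ae_fibreKernel_quantile_eq ν] with q hq
  rw [proj, proj, ← integral_const_mul]
  refine integral_congr_ae ?_
  filter_upwards [hq] with q' hq'
  rw [hq']

theorem proj_one (ν : ProbabilityMeasure ℝ) : proj ν (fun _ => 1) = fun _ => 1 := by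
  funext q; simp [proj]

theorem proj_comp_quantile (ν : ProbabilityMeasure ℝ) (g : ℝ → ℝ) :
    ∀ᵐ q ∂Λ, proj ν (fun q => g (quantile ν q)) q = g (quantile ν q) := by
  simpa [proj_one] using proj_comp_quantile_mul ν g (fun _ => 1)

/-! ### Decreasing functions -/

/-- Measurable functions with values in `[0, 1]` that decrease on a set of full measure. -/
structure IsDecreasing (b : ℝ → ℝ) : Prop extends IsUnitValued b where
  anti : ∃ s : Set ℝ, (∀ᵐ q ∂Λ, q ∈ s) ∧ AntitoneOn b s

namespace IsDecreasing

variable {a b : ℝ → ℝ}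

theorem one : IsDecreasing fun _ => 1 :=
  { IsUnitValued.one with anti := ⟨univ, by simp, fun _ _ _ _ _ => le_rfl⟩ }

theorem mul (ha : IsDecreasing a) (hb : IsDecreasing b) :
    IsDecreasing fun q => a q * b q where
  toIsUnitValued := ha.toIsUnitValued.mul hb.toIsUnitValued
  anti := by
    obtain ⟨s, hs, has⟩ := ha.anti
    obtain ⟨t, ht, hbt⟩ := hb.anti
    refine ⟨s ∩ t, by filter_upwards [hs, ht] with q h1 h2 using ⟨h1, h2⟩, ?_⟩
    intro x hx y hy hxy
    exact mul_le_mul (has hx.1 hy.1 hxy) (hbt hx.2 hy.2 hxy) (hb.nonneg y) (ha.nonneg x)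

theorem prod {ι : Type*} (S : Finset ι) {h : ι → ℝ → ℝ} (hh : ∀ i ∈ S, IsDecreasing (h i)) :
    IsDecreasing fun q => ∏ i ∈ S, h i q := by
  classical
  induction S using Finset.induction_on with
  | empty => simpa using one
  | insert i S hi ih =>
    simp only [Finset.prod_insert hi]
    exact (hh i (Finset.mem_insert_self i S)).mul
      (ih fun j hj => hh j (Finset.mem_insert_of_mem hj))

theorem indicator_Iic (u : ℝ) : IsDecreasing ((Iic u).indicator fun _ => (1 : ℝ)) where
  toIsUnitValued := IsUnitValued.indicator measurableSet_Iic
  anti := by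
    refine ⟨univ, by simp, fun x _ y _ hxy => ?_⟩
    by_cases hy : y ∈ Iic u
    · have hx : x ∈ Iic u := hxy.trans hy
      simp [hx, hy]
    · rw [indicator_of_notMem hy]
      exact indicator_nonneg (fun _ _ => zero_le_one) x

theorem comp_quantile {g : ℝ → ℝ} (hg : Antitone g) (h0 : ∀ x, 0 ≤ g x) (h1 : ∀ x, g x ≤ 1)
    (ν : ProbabilityMeasure ℝ) : IsDecreasing fun q => g (quantile ν q) where
  meas := hg.measurable.comp (measurable_quantile ν)
  nonneg _ := h0 _
  le_one _ := h1 _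
  anti := ⟨Ioo 0 1, ae_lam_mem_Ioo,
    fun _ hx _ hy hxy => hg (quantile_monotoneOn ν hx hy hxy)⟩

/-- Fibres are ordered like the values of the quantile function: two levels either share their
fibre, or every level of one fibre precedes every level of the other. Averages of a decreasing
function over the fibres are then ordered too. -/
theorem proj (hb : IsDecreasing b) (ν : ProbabilityMeasure ℝ) : IsDecreasing (proj ν b) where
  toIsUnitValued := hb.toIsUnitValued.proj ν
  anti := by
    obtain ⟨s, hs, has⟩ := hb.anti
    -- The good levels are those whose kernel is carried by the set where `b` decreases, by the open
    -- unit interval and by the fibre itself; almost every level is good.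
    refine ⟨{q | ∀ᵐ q' ∂(fibreKernel ν q), (q' ∈ s ∧ q' ∈ Ioo (0 : ℝ) 1) ∧
      quantile ν q' = quantile ν q} ∩ Ioo 0 1, ?_, ?_⟩
    · filter_upwards [ae_fibreKernel_of_ae ν (hs.and ae_lam_mem_Ioo),
        ae_fibreKernel_quantile_eq ν, ae_lam_mem_Ioo] with q h1 h2 h3
      exact ⟨h1.and h2, h3⟩
    · rintro x ⟨hx, hx1⟩ y ⟨hy, hy1⟩ hxy
      rcases (quantile_monotoneOn ν hx1 hy1 hxy).eq_or_lt with h | h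
      · rw [MarkovQuantile.proj, MarkovQuantile.proj, fibreKernel_apply, fibreKernel_apply, h]
      · have key : ∀ᵐ q ∂(fibreKernel ν x), ∀ᵐ q' ∂(fibreKernel ν y), b q' ≤ b q := by
          filter_upwards [hx] with q hq
          filter_upwards [hy] with q' hq'
          refine has hq.1.1 hq'.1.1 ?_
          by_contra hlt
          have := quantile_monotoneOn ν hq'.1.2 hq.1.2 (not_le.1 hlt).le
          rw [hq'.2, hq.2] at this
          exact absurd h (not_lt.2 this)
        have key2 : ∀ᵐ q ∂(fibreKernel ν x), MarkovQuantile.proj ν b y ≤ b q := by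
          filter_upwards [key] with q hq
          calc MarkovQuantile.proj ν b y ≤ ∫ _, b q ∂(fibreKernel ν y) :=
                integral_mono_ae (hb.integrable _) (integrable_const _) hq
            _ = b q := by simp
        calc MarkovQuantile.proj ν b y = ∫ _, MarkovQuantile.proj ν b y ∂(fibreKernel ν x) := by
              simp
          _ ≤ MarkovQuantile.proj ν b x :=
              integral_mono_ae (integrable_const _) (hb.integrable _) key2

end IsDecreasing

/-- Chebyshev's integral inequality. -/
theorem integral_mul_integral_le_of_antitoneOn {m : Measure ℝ} [IsProbabilityMeasure m]
    {a b : ℝ → ℝ} (ha : IsUnitValued a) (hb : IsUnitValued b) {s : Set ℝ} (hs : ∀ᵐ q ∂m, q ∈ s)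
    (has : AntitoneOn a s) (hbs : AntitoneOn b s) :
    (∫ q, a q ∂m) * ∫ q, b q ∂m ≤ ∫ q, a q * b q ∂m := by
  set A := ∫ q, a q ∂m with hA
  set B := ∫ q, b q ∂m with hB
  set C := ∫ q, a q * b q ∂m with hC
  have hai := ha.integrable m
  have hbi := hb.integrable m
  have habi := (ha.mul hb).integrable m
  -- The product `(a q - a q') * (b q - b q')` is nonnegative. Integrating it in `q` gives this
  -- inequality, and integrating once more in `q'` gives twice the claim.
  have h1 : ∀ᵐ q' ∂m, 0 ≤ C - a q' * B - b q' * A + a q' * b q' := by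
    filter_upwards [hs] with q' hq'
    have hnn : 0 ≤ ∫ q, (a q * b q - a q' * b q - b q' * a q + a q' * b q') ∂m := by
      refine integral_nonneg_of_ae ?_
      filter_upwards [hs] with q hq
      have : 0 ≤ (a q - a q') * (b q - b q') := by
        rcases le_total q q' with h | h
        · exact mul_nonneg (sub_nonneg.2 (has hq hq' h)) (sub_nonneg.2 (hbs hq hq' h))
        · exact mul_nonneg_of_nonpos_of_nonpos (sub_nonpos.2 (has hq' hq h))
            (sub_nonpos.2 (hbs hq' hq h))
      simp only [Pi.zero_apply]
      linarith
    have i1 : Integrable (fun q => a q * b q - a q' * b q) m := habi.sub (hbi.const_mul _)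
    have i2 : Integrable (fun q => a q * b q - a q' * b q - b q' * a q) m :=
      i1.sub (hai.const_mul _)
    rw [integral_add i2 (integrable_const _), integral_sub i1 (hai.const_mul _),
      integral_sub habi (hbi.const_mul _), integral_const_mul, integral_const_mul] at hnn
    simpa using hnn
  have h2 : 0 ≤ ∫ q', (C - a q' * B - b q' * A + a q' * b q') ∂m := integral_nonneg_of_ae h1
  have i1 : Integrable (fun q => C - a q * B) m := (integrable_const _).sub (hai.mul_const _)
  have i2 : Integrable (fun q => C - a q * B - b q * A) m := i1.sub (hbi.mul_const _)
  rw [integral_add i2 habi, integral_sub i1 (hbi.mul_const _),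
    integral_sub (integrable_const _) (hai.mul_const _), integral_mul_const,
    integral_mul_const] at h2
  simp only [integral_const, probReal_univ, smul_eq_mul, one_mul] at h2
  rw [← hA, ← hB, ← hC] at h2
  nlinarith

/-- Chebyshev's inequality applied to the resampling kernel of almost every level. -/
theorem proj_mul_proj_le (ν : ProbabilityMeasure ℝ) {a b : ℝ → ℝ} (ha : IsDecreasing a)
    (hb : IsDecreasing b) :
    ∀ᵐ q ∂Λ, proj ν a q * proj ν b q ≤ proj ν (fun q => a q * b q) q := by
  obtain ⟨s, hs, has⟩ := ha.anti
  obtain ⟨t, ht, hbt⟩ := hb.anti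
  filter_upwards [ae_fibreKernel_of_ae ν (hs.and ht)] with q hq
  exact integral_mul_integral_le_of_antitoneOn (s := s ∩ t) ha.toIsUnitValued hb.toIsUnitValued hq
    (has.mono inter_subset_left) (hbt.mono inter_subset_right)

/-- Projecting decreases the weighted scalar product of two decreasing functions. -/
theorem integral_weight_mul_proj_le (ν : ProbabilityMeasure ℝ) {g a b : ℝ → ℝ}
    (hg : IsUnitValued g) (ha : IsDecreasing a) (hb : IsDecreasing b) :
    ∫ q, g (quantile ν q) * (a q * proj ν b q) ∂Λ ≤ ∫ q, g (quantile ν q) * (a q * b q) ∂Λ := by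
  have hg' := hg.comp (measurable_quantile ν)
  calc ∫ q, g (quantile ν q) * (a q * proj ν b q) ∂Λ
      = ∫ q, g (quantile ν q) * (proj ν a q * proj ν b q) ∂Λ := by
        have := integral_mul_proj_mul ν hg hb.toIsUnitValued ha.toIsUnitValued
        simpa only [mul_comm (proj ν b _)] using this
    _ ≤ ∫ q, g (quantile ν q) * proj ν (fun q => a q * b q) q ∂Λ := by
        refine integral_mono_ae ((hg'.mul ((ha.proj ν).toIsUnitValued.mul
          (hb.proj ν).toIsUnitValued)).integrable _)
          ((hg'.mul ((ha.mul hb).proj ν).toIsUnitValued).integrable _) ?_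
        filter_upwards [proj_mul_proj_le ν ha hb] with q hq
        exact mul_le_mul_of_nonneg_left hq (hg.nonneg _)
    _ = _ := integral_comp_quantile_mul_proj ν hg (ha.mul hb).toIsUnitValued

theorem integral_mul_proj_le (ν : ProbabilityMeasure ℝ) {a b : ℝ → ℝ} (ha : IsDecreasing a)
    (hb : IsDecreasing b) : ∫ q, a q * proj ν b q ∂Λ ≤ ∫ q, a q * b q ∂Λ := by
  simpa using integral_weight_mul_proj_le ν IsUnitValued.one ha hb

/-- The loss under projection is not larger with a weight `g (quantile ν)` than without. -/
theorem integral_weight_sub_proj_le (ν : ProbabilityMeasure ℝ) {g a b : ℝ → ℝ}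
    (hg : IsUnitValued g) (ha : IsDecreasing a) (hb : IsDecreasing b) :
    ∫ q, a q * (g (quantile ν q) * b q) ∂Λ - ∫ q, a q * proj ν (fun q => g (quantile ν q) * b q) q ∂Λ
      ≤ ∫ q, a q * b q ∂Λ - ∫ q, a q * proj ν b q ∂Λ := by
  have hg' := hg.comp (measurable_quantile ν)
  -- The loss without weight minus the loss with weight `g` is the loss with the complementary
  -- weight `1 - g`, which is nonnegative.
  have h := integral_weight_mul_proj_le ν hg.one_sub ha hb
  have hab := ha.toIsUnitValued.mul hb.toIsUnitValued
  have hapb := ha.toIsUnitValued.mul (hb.proj ν).toIsUnitValued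
  have e1 : ∫ q, (1 - g (quantile ν q)) * (a q * proj ν b q) ∂Λ
      = ∫ q, a q * proj ν b q ∂Λ - ∫ q, g (quantile ν q) * (a q * proj ν b q) ∂Λ := by
    rw [← integral_sub (hapb.integrable _) ((hg'.mul hapb).integrable _)]
    congr 1; funext q; ring
  have e2 : ∫ q, (1 - g (quantile ν q)) * (a q * b q) ∂Λ
      = ∫ q, a q * b q ∂Λ - ∫ q, g (quantile ν q) * (a q * b q) ∂Λ := by
    rw [← integral_sub (hab.integrable _) ((hg'.mul hab).integrable _)]
    congr 1; funext q; ring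
  have e3 : ∫ q, a q * proj ν (fun q => g (quantile ν q) * b q) q ∂Λ
      = ∫ q, g (quantile ν q) * (a q * proj ν b q) ∂Λ := by
    refine integral_congr_ae ?_
    filter_upwards [proj_comp_quantile_mul ν g b] with q hq
    rw [hq]; ring
  have e4 : ∫ q, a q * (g (quantile ν q) * b q) ∂Λ = ∫ q, g (quantile ν q) * (a q * b q) ∂Λ := by
    congr 1; funext q; ring
  rw [e1, e2] at h
  rw [e3, e4]
  linarith

/-- At a time without atoms the projection is the identity. -/
theorem proj_eq_self_of_noAtoms (ν : ProbabilityMeasure ℝ)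
    (hν : ∀ x : ℝ, (ν : Measure ℝ) {x} = 0) (b : ℝ → ℝ) : ∀ᵐ q ∂Λ, proj ν b q = b q := by
  -- Without atoms the quantile function is injective: it would send an interval of constancy, which
  -- has positive mass, to a single point. The fibres are then single levels.
  have hinj : ∀ x ∈ Ioo (0 : ℝ) 1, ∀ y ∈ Ioo (0 : ℝ) 1, x < y → quantile ν x ≠ quantile ν y := by
    intro x hx y hy hxy h
    have hsub : Ioo x y ⊆ quantile ν ⁻¹' {quantile ν x} := by
      intro z hz
      have hz1 : z ∈ Ioo (0 : ℝ) 1 := ⟨hx.1.trans hz.1, hz.2.trans hy.2⟩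
      refine le_antisymm ?_ (quantile_monotoneOn ν hx hz1 hz.1.le)
      rw [h]
      exact quantile_monotoneOn ν hz1 hy hz.2.le
    have h0 : Λ (Ioo x y) = 0 := by
      refine measure_mono_null hsub ?_
      rw [← Measure.map_apply (measurable_quantile ν) (measurableSet_singleton _), map_quantile]
      exact hν _
    have hIcc : Ioo x y ⊆ Icc 0 1 :=
      fun z hz => ⟨(hx.1.trans hz.1).le, (hz.2.trans hy.2).le⟩
    rw [lam_eq, Measure.restrict_apply measurableSet_Ioo, inter_eq_left.2 hIcc,
      Real.volume_Ioo] at h0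
    exact absurd (ENNReal.ofReal_eq_zero.1 h0) (not_le.2 (sub_pos.2 hxy))
  filter_upwards [ae_lam_mem_Ioo, ae_fibreKernel_of_ae ν ae_lam_mem_Ioo,
    ae_fibreKernel_quantile_eq ν] with q hq h1 h2
  calc proj ν b q = ∫ _, b q ∂(fibreKernel ν q) := by
        refine integral_congr_ae ?_
        filter_upwards [h1, h2] with q' h3 h4
        rcases lt_trichotomy q' q with h | h | h
        · exact absurd h4 (hinj _ h3 _ hq h)
        · rw [h]
        · exact absurd h4.symm (hinj _ hq _ h3 h)
    _ = b q := by simp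

end

/-! ### Resampling at finitely many times. -/

section

/-! ### Alternating observations and projections -/

/-- The conditional expectation, given the initial level, of the product of the observations
`h t`, `t ∈ S`, and of the terminal value `x`, for the process of levels that is resampled in its
fibre at each time of the list. -/
def run (μ : ℝ → ProbabilityMeasure ℝ) (h : ℝ → ℝ → ℝ) (x : ℝ → ℝ) :
    List ℝ → Finset ℝ → ℝ → ℝ
  | [], S => fun q => (∏ t ∈ S, h t q) * x q
  -- An observation at the very time `r` is placed after the projection at `r`. For a function of
  -- `quantile (μ r)` the order does not matter, since it commutes with `proj (μ r)`.
  | r :: l, S => fun q => (∏ t ∈ S with t < r, h t q) *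
      proj (μ r) (run μ h x l (S.filter (r ≤ ·))) q

variable {μ : ℝ → ProbabilityMeasure ℝ} {h : ℝ → ℝ → ℝ} {a x : ℝ → ℝ}

/-- Multiplication by decreasing observations and projections both preserve decreasing functions, so
Chebyshev's inequality remains available at every stage of the recursion. -/
theorem IsDecreasing.run (hh : ∀ t, IsDecreasing (h t)) (hx : IsDecreasing x) (l : List ℝ)
    (S : Finset ℝ) : IsDecreasing (run μ h x l S) := by
  induction l generalizing S with
  | nil => exact (IsDecreasing.prod S fun t _ => hh t).mul hx
  | cons r l ih => exact (IsDecreasing.prod _ fun t _ => hh t).mul ((ih _).proj _)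

theorem IsUnitValued.run (hh : ∀ t, IsUnitValued (h t)) (hx : IsUnitValued x) (l : List ℝ)
    (S : Finset ℝ) : IsUnitValued (run μ h x l S) := by
  induction l generalizing S with
  | nil => exact (IsUnitValued.prod S fun t _ => hh t).mul hx
  | cons r l ih => exact (IsUnitValued.prod _ fun t _ => hh t).mul ((ih _).proj _)

theorem run_congr_ae {h' : ℝ → ℝ → ℝ} {x' : ℝ → ℝ} (l : List ℝ) (S : Finset ℝ)
    (hh : ∀ t ∈ S, ∀ᵐ q ∂Λ, h t q = h' t q) (hx : ∀ᵐ q ∂Λ, x q = x' q) :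
    ∀ᵐ q ∂Λ, run μ h x l S q = run μ h' x' l S q := by
  induction l generalizing S with
  | nil =>
    have : ∀ᵐ q ∂Λ, ∀ t ∈ S, h t q = h' t q := (ae_ball_iff S.countable_toSet).2 hh
    filter_upwards [this, hx] with q h1 h2
    simp only [run, h2, Finset.prod_congr rfl h1]
  | cons r l ih =>
    have : ∀ᵐ q ∂Λ, ∀ t ∈ S, h t q = h' t q := (ae_ball_iff S.countable_toSet).2 hh
    filter_upwards [this, proj_congr_ae (μ r) (ih (S.filter (r ≤ ·))
      fun t ht => hh t (Finset.mem_filter.1 ht).1)] with q h1 h2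
    simp only [run, h2]
    rw [Finset.prod_congr rfl fun t ht => h1 t (Finset.mem_filter.1 ht).1]

theorem run_union_of_lt (S₁ S₂ : Finset ℝ) (l : List ℝ) (hd : Disjoint S₁ S₂)
    (h₁ : ∀ r ∈ l, ∀ t ∈ S₁, t < r) (q : ℝ) :
    run μ h x l (S₁ ∪ S₂) q = (∏ t ∈ S₁, h t q) * run μ h x l S₂ q := by
  cases l with
  | nil => simp only [run, Finset.prod_union hd, mul_assoc]
  | cons r l =>
    have e1 : (S₁ ∪ S₂).filter (· < r) = S₁ ∪ S₂.filter (· < r) := by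
      rw [Finset.filter_union, Finset.filter_true_of_mem fun t ht => h₁ r (by simp) t ht]
    have e2 : (S₁ ∪ S₂).filter (r ≤ ·) = S₂.filter (r ≤ ·) := by
      rw [Finset.filter_union, Finset.filter_false_of_mem
        fun t ht => not_le.2 (h₁ r (by simp) t ht), Finset.empty_union]
    simp only [run, e1, e2]
    rw [Finset.prod_union (Finset.disjoint_of_subset_right (Finset.filter_subset _ _) hd),
      mul_assoc]

/-- The later times act on the earlier ones only through the terminal value. This allows a form to
be cut at an intermediate time. -/
theorem run_append (S₁ S₂ : Finset ℝ) (l₁ l₂ : List ℝ) (hd : Disjoint S₁ S₂)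
    (h₁ : ∀ r ∈ l₂, ∀ t ∈ S₁, t < r) (h₂ : ∀ r ∈ l₁, ∀ t ∈ S₂, r ≤ t) :
    run μ h x (l₁ ++ l₂) (S₁ ∪ S₂) = run μ h (run μ h x l₂ S₂) l₁ S₁ := by
  induction l₁ generalizing S₁ with
  | nil =>
    funext q
    exact run_union_of_lt S₁ S₂ l₂ hd h₁ q
  | cons r l ih =>
    have e1 : (S₁ ∪ S₂).filter (· < r) = S₁.filter (· < r) := by
      rw [Finset.filter_union, Finset.filter_false_of_mem (s := S₂)
        fun t ht => not_lt.2 (h₂ r (by simp) t ht), Finset.union_empty]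
    have e2 : (S₁ ∪ S₂).filter (r ≤ ·) = S₁.filter (r ≤ ·) ∪ S₂ := by
      rw [Finset.filter_union, Finset.filter_true_of_mem (s := S₂)
        fun t ht => h₂ r (by simp) t ht]
    funext q
    simp only [List.cons_append, run, e1, e2]
    rw [ih _ (Finset.disjoint_of_subset_left (Finset.filter_subset _ _) hd)
      (fun r' hr' t ht => h₁ r' hr' t (Finset.mem_filter.1 ht).1)
      (fun r' hr' => h₂ r' (by simp [hr']))]

/-- Alternating observations and projections have an adjoint. -/
theorem exists_adjoint_run (hh : ∀ t, IsDecreasing (h t)) (ha : IsDecreasing a) (l : List ℝ)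
    (S : Finset ℝ) : ∃ w, IsDecreasing w ∧ ∀ x, IsUnitValued x →
      ∫ q, a q * run μ h x l S q ∂Λ = ∫ q, w q * x q ∂Λ := by
  induction l generalizing S a with
  | nil =>
    refine ⟨_, ha.mul (IsDecreasing.prod S fun t _ => hh t), fun x _ => ?_⟩
    simp only [run, mul_assoc]
  | cons r l ih =>
    have hp := ha.mul (IsDecreasing.prod (S.filter (· < r)) fun t _ => hh t)
    obtain ⟨w, hw, hw'⟩ := ih (hp.proj (μ r)) (S.filter (r ≤ ·))
    refine ⟨w, hw, fun x hx => ?_⟩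
    -- By symmetry the outermost projection passes to the left factor, where it is absorbed into the
    -- function given to the induction hypothesis.
    rw [← hw' x hx, ← integral_mul_proj (μ r) hp.toIsUnitValued
      (IsUnitValued.run (fun t => (hh t).toIsUnitValued) hx _ _)]
    simp only [run, mul_assoc]

/-- The projections before `r` are moved by symmetry to the left factor, those after `r` remain in
the right factor, and both factors stay decreasing; the hypothesis on a single projection then
applies. The relation is kept abstract to serve both for `≤` and for the equality at a non-atomic
time. -/
theorem rel_run_orderedInsert (rel : ℝ → ℝ → Prop) {r : ℝ}
    (hr : ∀ a b, IsDecreasing a → IsDecreasing b →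
      rel (∫ q, a q * proj (μ r) b q ∂Λ) (∫ q, a q * b q ∂Λ))
    (hh : ∀ t, IsDecreasing (h t)) (hx : IsDecreasing x) (ha : IsDecreasing a) (l : List ℝ)
    (hl : l.Pairwise (· ≤ ·)) (S : Finset ℝ) :
    rel (∫ q, a q * run μ h x (l.orderedInsert (· ≤ ·) r) S q ∂Λ)
      (∫ q, a q * run μ h x l S q ∂Λ) := by
  -- Here `r` comes before all times of the list, so the observations made before `r` can be joined
  -- to `a` on both sides.
  have key : ∀ (l : List ℝ) (S : Finset ℝ) (a : ℝ → ℝ), IsDecreasing a → (∀ r' ∈ l, r ≤ r') →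
      rel (∫ q, a q * run μ h x (r :: l) S q ∂Λ) (∫ q, a q * run μ h x l S q ∂Λ) := by
    intro l S a ha hl
    have hd : Disjoint (S.filter (· < r)) (S.filter (r ≤ ·)) :=
      Finset.disjoint_filter.2 fun t _ h1 h2 => absurd h1 (not_lt.2 h2)
    have e : run μ h x l S = fun q => (∏ t ∈ S with t < r, h t q) *
        run μ h x l (S.filter (r ≤ ·)) q := by
      funext q
      rw [← run_union_of_lt _ _ l hd
        (fun r' hr' t ht => (Finset.mem_filter.1 ht).2.trans_le (hl r' hr'))]
      congr 1
      ext t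
      simp only [Finset.mem_union, Finset.mem_filter]
      have := lt_or_ge t r
      tauto
    rw [e]
    simp only [run, ← mul_assoc]
    exact hr _ _ (ha.mul (IsDecreasing.prod _ fun t _ => hh t)) (IsDecreasing.run hh hx _ _)
  induction l generalizing S a with
  | nil => exact key [] S a ha (by simp)
  | cons r' l ih =>
    rw [List.orderedInsert_cons]
    split_ifs with hrr
    · exact key _ S a ha fun r'' hr'' => by
        rcases List.mem_cons.1 hr'' with h1 | h1
        · rwa [h1]
        · exact hrr.trans ((List.pairwise_cons.1 hl).1 _ h1)
    · have hp := ha.mul (IsDecreasing.prod (S.filter (· < r')) fun t _ => hh t)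
      have h1 := ih (hp.proj (μ r')) (List.pairwise_cons.1 hl).2 (S.filter (r' ≤ ·))
      rw [← integral_mul_proj (μ r') hp.toIsUnitValued (IsDecreasing.run hh hx _ _).toIsUnitValued,
        ← integral_mul_proj (μ r') hp.toIsUnitValued
          (IsDecreasing.run hh hx _ _).toIsUnitValued] at h1
      simpa only [run, mul_assoc] using h1

theorem sort_insert_eq_orderedInsert {r : ℝ} {F : Finset ℝ} (hr : r ∉ F) :
    (insert r F).sort = F.sort.orderedInsert (· ≤ ·) r := by
  refine List.Perm.eq_of_pairwise' (r := (· ≤ ·)) ?_ ?_ ?_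
  · exact Finset.pairwise_sort _ _
  · exact (Finset.pairwise_sort F (· ≤ ·)).orderedInsert r _ 
  · refine (List.perm_ext_iff_of_nodup (Finset.sort_nodup _ _) ?_).2 ?_
    · exact (List.perm_orderedInsert _ r _).nodup_iff.2 (by simp [hr, Finset.sort_nodup])
    · intro t; simp [List.mem_orderedInsert]

theorem sort_union_of_lt {F₁ F₂ : Finset ℝ} (hlt : ∀ r ∈ F₁, ∀ s ∈ F₂, r < s) :
    (F₁ ∪ F₂).sort = F₁.sort ++ F₂.sort := by
  refine List.Perm.eq_of_pairwise' (r := (· ≤ ·)) ?_ ?_ ?_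
  · exact Finset.pairwise_sort _ _
  · refine List.pairwise_append.2 ⟨Finset.pairwise_sort _ _, Finset.pairwise_sort _ _, ?_⟩
    intro r hr s hs
    exact (hlt r (by simpa using hr) s (by simpa using hs)).le
  · refine (List.perm_ext_iff_of_nodup (Finset.sort_nodup _ _) ?_).2 ?_
    · refine List.nodup_append.2 ⟨Finset.sort_nodup _ _, Finset.sort_nodup _ _, ?_⟩
      intro r hr s hs
      exact (hlt r (by simpa using hr) s (by simpa using hs)).ne
    · intro t; simp

end

/-! ### Monotone limits over sets of projection times. -/

section

/-! ### Expectations of observations, for finite and for arbitrary sets of projection times -/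

/-- The expectation of `a(Z) * ∏ t ∈ S, h t (Z t) * x(Z')` where `Z` is the process of levels
resampled at the times of `F`, started at `Z` and ended at `Z'`. -/
def form (μ : ℝ → ProbabilityMeasure ℝ) (S : Finset ℝ) (h : ℝ → ℝ → ℝ) (a x : ℝ → ℝ)
    (F : Finset ℝ) : ℝ :=
  ∫ q, a q * run μ h x F.sort S q ∂Λ

open scoped Classical in
/-- The points of the finite set `F` that lie in `R`. -/
def restr (R : Set ℝ) (F : Finset ℝ) : Finset ℝ := F.filter (· ∈ R)

@[simp] theorem mem_restr {R : Set ℝ} {F : Finset ℝ} {t : ℝ} : t ∈ restr R F ↔ t ∈ F ∧ t ∈ R := by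
  simp [restr]

theorem restr_mono (R : Set ℝ) : Monotone (restr R) := fun _ _ hFG _ ht =>
  mem_restr.2 ⟨hFG (mem_restr.1 ht).1, (mem_restr.1 ht).2⟩

theorem restr_subset (R : Set ℝ) (F : Finset ℝ) : (restr R F : Set ℝ) ⊆ R := fun _ ht =>
  (mem_restr.1 ht).2

theorem restr_eq_self {R : Set ℝ} {F : Finset ℝ} (hF : (F : Set ℝ) ⊆ R) : restr R F = F := by
  ext t
  exact ⟨fun ht => (mem_restr.1 ht).1, fun ht => mem_restr.2 ⟨ht, hF ht⟩⟩

/-- The infimum of `form` over the finite subsets of `R`. -/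
def limForm (μ : ℝ → ProbabilityMeasure ℝ) (S : Finset ℝ) (h : ℝ → ℝ → ℝ) (a x : ℝ → ℝ)
    (R : Set ℝ) : ℝ :=
  ⨅ F : Finset ℝ, form μ S h a x (restr R F)

variable {μ : ℝ → ProbabilityMeasure ℝ} {h : ℝ → ℝ → ℝ} {a x : ℝ → ℝ} {S : Finset ℝ}

theorem form_nonneg (hh : ∀ t, IsUnitValued (h t)) (ha : IsUnitValued a) (hx : IsUnitValued x)
    (S F : Finset ℝ) : 0 ≤ form μ S h a x F :=
  (ha.mul (IsUnitValued.run hh hx _ _)).integral_nonneg _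

theorem form_congr_ae {h' : ℝ → ℝ → ℝ} {a' x' : ℝ → ℝ} (hh : ∀ t ∈ S, ∀ᵐ q ∂Λ, h t q = h' t q)
    (ha : ∀ᵐ q ∂Λ, a q = a' q) (hx : ∀ᵐ q ∂Λ, x q = x' q) (F : Finset ℝ) :
    form μ S h a x F = form μ S h' a' x' F := by
  refine integral_congr_ae ?_
  filter_upwards [run_congr_ae (μ := μ) F.sort S hh hx, ha] with q h1 h2
  rw [h1, h2]

theorem limForm_congr_ae {h' : ℝ → ℝ → ℝ} {a' x' : ℝ → ℝ} (hh : ∀ t ∈ S, ∀ᵐ q ∂Λ, h t q = h' t q)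
    (ha : ∀ᵐ q ∂Λ, a q = a' q) (hx : ∀ᵐ q ∂Λ, x q = x' q) (R : Set ℝ) :
    limForm μ S h a x R = limForm μ S h' a' x' R := by
  simp only [limForm, form_congr_ae hh ha hx]

theorem form_insert_le (hh : ∀ t, IsDecreasing (h t)) (ha : IsDecreasing a) (hx : IsDecreasing x)
    (S F : Finset ℝ) (r : ℝ) : form μ S h a x (insert r F) ≤ form μ S h a x F := by
  by_cases hr : r ∈ F
  · rw [Finset.insert_eq_of_mem hr]
  · rw [form, sort_insert_eq_orderedInsert hr]
    exact rel_run_orderedInsert (· ≤ ·) (fun a b ha hb => integral_mul_proj_le (μ r) ha hb)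
      hh hx ha _ (Finset.pairwise_sort _ _) S

theorem form_insert_of_not_isAtomicTime (hh : ∀ t, IsDecreasing (h t)) (ha : IsDecreasing a)
    (hx : IsDecreasing x) (S F : Finset ℝ) {r : ℝ} (hr : ¬ IsAtomicTime μ r) :
    form μ S h a x (insert r F) = form μ S h a x F := by
  by_cases hrF : r ∈ F
  · rw [Finset.insert_eq_of_mem hrF]
  · rw [form, sort_insert_eq_orderedInsert hrF]
    refine rel_run_orderedInsert (· = ·) (fun a b _ _ => ?_)
      hh hx ha _ (Finset.pairwise_sort _ _) S
    refine integral_congr_ae ?_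
    filter_upwards [proj_eq_self_of_noAtoms (μ r)
      (fun y => by_contra fun hy => hr ⟨y, hy⟩) b] with q hq
    rw [hq]

/-- By Chebyshev's inequality each additional projection decorrelates decreasing functions and
lowers the integral. All limits over projection times rest on this monotonicity. -/
theorem form_anti (hh : ∀ t, IsDecreasing (h t)) (ha : IsDecreasing a) (hx : IsDecreasing x)
    (S : Finset ℝ) : Antitone (form μ S h a x) := by
  intro F G hFG
  obtain ⟨D, rfl⟩ : ∃ D, G = D ∪ F := ⟨G, (Finset.union_eq_left.2 hFG).symm⟩
  clear hFG
  induction D using Finset.induction_on with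
  | empty => simp
  | insert r D _ ih =>
    rw [Finset.insert_union]
    exact (form_insert_le hh ha hx S _ r).trans ih

theorem bddBelow_form (hh : ∀ t, IsUnitValued (h t)) (ha : IsUnitValued a) (hx : IsUnitValued x)
    (S : Finset ℝ) (R : Set ℝ) : BddBelow (range fun F => form μ S h a x (restr R F)) :=
  ⟨0, by rintro _ ⟨F, rfl⟩; exact form_nonneg hh ha hx _ _⟩

theorem limForm_le (hh : ∀ t, IsUnitValued (h t)) (ha : IsUnitValued a) (hx : IsUnitValued x)
    (S : Finset ℝ) {R : Set ℝ} {F : Finset ℝ} (hF : (F : Set ℝ) ⊆ R) :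
    limForm μ S h a x R ≤ form μ S h a x F := by
  have := ciInf_le (bddBelow_form (μ := μ) hh ha hx S R) F
  rwa [restr_eq_self hF] at this

theorem le_limForm {R : Set ℝ} {c : ℝ}
    (hc : ∀ F : Finset ℝ, (F : Set ℝ) ⊆ R → c ≤ form μ S h a x F) : c ≤ limForm μ S h a x R :=
  le_ciInf fun F => hc _ (restr_subset R F)

theorem exists_form_lt (S : Finset ℝ) (R : Set ℝ) {c : ℝ} (hc : limForm μ S h a x R < c) :
    ∃ F : Finset ℝ, (F : Set ℝ) ⊆ R ∧ form μ S h a x F < c := by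
  obtain ⟨F, hF⟩ := exists_lt_of_ciInf_lt hc
  exact ⟨_, restr_subset R F, hF⟩

theorem limForm_anti (hh : ∀ t, IsUnitValued (h t)) (ha : IsUnitValued a) (hx : IsUnitValued x)
    (S : Finset ℝ) : Antitone (limForm μ S h a x) := fun _ _ hRR =>
  le_limForm fun _ hF => limForm_le hh ha hx S (hF.trans hRR)

/-- An antitone bounded net converges to its infimum. Indexing by all finite sets and restricting
them to `R` provides the same filter for every `R`, so that limits for different `R` can be
compared. -/
theorem tendsto_form (hh : ∀ t, IsDecreasing (h t)) (ha : IsDecreasing a) (hx : IsDecreasing x)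
    (S : Finset ℝ) (R : Set ℝ) :
    Tendsto (fun F => form μ S h a x (restr R F)) atTop (𝓝 (limForm μ S h a x R)) :=
  tendsto_atTop_ciInf ((form_anti hh ha hx S).comp_monotone (restr_mono R))
    (bddBelow_form (fun t => (hh t).toIsUnitValued) ha.toIsUnitValued hx.toIsUnitValued S R)

theorem limForm_coe (hh : ∀ t, IsDecreasing (h t)) (ha : IsDecreasing a) (hx : IsDecreasing x)
    (S F : Finset ℝ) : limForm μ S h a x F = form μ S h a x F :=
  le_antisymm (limForm_le (fun t => (hh t).toIsUnitValued) ha.toIsUnitValued hx.toIsUnitValued S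
    Subset.rfl) (le_limForm fun _ hG => form_anti hh ha hx S (Finset.coe_subset.1 hG))

theorem limForm_diff_of_not_isAtomicTime (hh : ∀ t, IsDecreasing (h t)) (ha : IsDecreasing a)
    (hx : IsDecreasing x) (S : Finset ℝ) (R E : Set ℝ) (hE : ∀ t ∈ E, ¬ IsAtomicTime μ t) :
    limForm μ S h a x (R \ E) = limForm μ S h a x R := by
  refine le_antisymm (le_limForm fun F hF => ?_) (limForm_anti (fun t => (hh t).toIsUnitValued)
    ha.toIsUnitValued hx.toIsUnitValued S sdiff_subset)
  have key : ∀ D : Finset ℝ, (D : Set ℝ) ⊆ E → ∀ G, form μ S h a x (D ∪ G) = form μ S h a x G := by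
    intro D
    induction D using Finset.induction_on with
    | empty => simp
    | insert r D _ ih =>
      intro hD G
      rw [Finset.insert_union, form_insert_of_not_isAtomicTime hh ha hx S _
        (hE r (hD (by simp))), ih fun t ht => hD (by simpa using Or.inr ht)]
  have hu : F = restr E F ∪ restr Eᶜ F := by
    ext t; simp only [Finset.mem_union, mem_restr, mem_compl_iff]; tauto
  rw [hu, key _ (restr_subset E F)]
  refine limForm_le (fun t => (hh t).toIsUnitValued) ha.toIsUnitValued hx.toIsUnitValued S ?_
  intro t ht
  have := mem_restr.1 ht
  exact ⟨hF this.1, this.2⟩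

/-! ### Splitting at a time -/

/-- Past projections and observations stay in the form, and the future becomes its terminal
function. -/
theorem form_union {S₁ S₂ F₁ F₂ : Finset ℝ} (hlt : ∀ r ∈ F₁, ∀ s ∈ F₂, r < s)
    (hd : Disjoint S₁ S₂) (h₁ : ∀ r ∈ F₂, ∀ t ∈ S₁, t < r) (h₂ : ∀ r ∈ F₁, ∀ t ∈ S₂, r ≤ t) :
    form μ (S₁ ∪ S₂) h a x (F₁ ∪ F₂) = form μ S₁ h a (run μ h x F₂.sort S₂) F₁ := by
  rw [form, form, sort_union_of_lt hlt, run_append S₁ S₂ _ _ hd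
    (fun r hr => h₁ r (by simpa using hr)) (fun r hr => h₂ r (by simpa using hr))]

theorem exists_adjoint_form (hh : ∀ t, IsDecreasing (h t)) (ha : IsDecreasing a)
    (S F : Finset ℝ) : ∃ w, IsDecreasing w ∧ ∀ x, IsUnitValued x →
      form μ S h a x F = ∫ q, w q * x q ∂Λ :=
  exists_adjoint_run hh ha (F.sort (· ≤ ·)) S

theorem run_empty_congr (h' : ℝ → ℝ → ℝ) (l : List ℝ) : run μ h x l ∅ = run μ h' x l ∅ := by
  induction l with
  | nil => simp [run]
  | cons r l ih => simp only [run, Finset.filter_empty, Finset.prod_empty, ih]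

theorem form_empty_congr (h' : ℝ → ℝ → ℝ) (F : Finset ℝ) :
    form μ ∅ h a x F = form μ ∅ h' a x F := by
  rw [form, form, run_empty_congr h']

theorem form_singleton_empty (r : ℝ) : form μ ∅ h a x {r} = ∫ q, a q * proj (μ r) x q ∂Λ := by
  simp [form, run]

/-! ### The lower orthant order between level plans -/

/-- In terms of forms, the plan `L_B` is below `L_A` in the lower orthant order. -/
def LevelLE (μ : ℝ → ProbabilityMeasure ℝ) (A B : Set ℝ) : Prop :=
  ∀ a x : ℝ → ℝ, IsDecreasing a → IsDecreasing x →
    limForm μ ∅ (fun _ _ => 1) a x A ≤ limForm μ ∅ (fun _ _ => 1) a x B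

theorem LevelLE.of_superset {A B : Set ℝ} (hBA : B ⊆ A) : LevelLE μ A B := fun _ _ ha hx =>
  limForm_anti (fun _ => IsUnitValued.one) ha.toIsUnitValued hx.toIsUnitValued ∅ hBA

theorem LevelLE.trans {A B C : Set ℝ} (hAB : LevelLE μ A B) (hBC : LevelLE μ B C) :
    LevelLE μ A C := fun a x ha hx => (hAB a x ha hx).trans (hBC a x ha hx)

/-- The product of plans is monotone: with the projections of one block fixed, that block is
absorbed into a decreasing test function, directly on the right and through the adjoint on the left,
and the comparison of the other block applies to it. -/
theorem LevelLE.union {A B A' B' : Set ℝ} (hA : LevelLE μ A A') (hB : LevelLE μ B B')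
    (hlt : ∀ r ∈ A, ∀ s ∈ B, r < s) (hlt' : ∀ r ∈ A', ∀ s ∈ B', r < s) :
    LevelLE μ (A ∪ B) (A' ∪ B') := by
  intro a x ha hx
  have h1 : ∀ _ : ℝ, IsDecreasing fun _ : ℝ => (1 : ℝ) := fun _ => IsDecreasing.one
  have split : ∀ {A B : Set ℝ} {F G : Finset ℝ}, (∀ r ∈ A, ∀ s ∈ B, r < s) → (F : Set ℝ) ⊆ A →
      (G : Set ℝ) ⊆ B → form μ ∅ (fun _ _ => 1) a x (F ∪ G) =
        form μ ∅ (fun _ _ => 1) a (run μ (fun _ _ => 1) x G.sort ∅) F := by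
    intro A B F G hlt hF hG
    rw [← form_union (S₁ := ∅) (S₂ := ∅) (fun r hr s hs => hlt r (hF hr) s (hG hs)) (by simp)
      (by simp) (by simp), Finset.union_empty]
  refine le_limForm fun F hF => ?_
  have hu : F = restr A' F ∪ restr B' F := by
    ext t
    have := @hF t
    simp only [Finset.mem_union, mem_restr, mem_union, Finset.mem_coe] at this ⊢
    tauto
  rw [hu, split hlt' (restr_subset _ _) (restr_subset _ _)]
  refine le_trans ?_ ((hA _ _ ha (IsDecreasing.run h1 hx _ _)).trans (limForm_le
    (fun _ => IsUnitValued.one) ha.toIsUnitValued (IsDecreasing.run h1 hx _ _).toIsUnitValued ∅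
    (restr_subset A' F)))
  refine le_limForm fun G hG => ?_
  -- The first block is now frozen at `G` and becomes the left test function `w` for comparing the
  -- second blocks.
  obtain ⟨w, hw, hw'⟩ := exists_adjoint_form (μ := μ) h1 ha ∅ G
  have e : ∀ K : Finset ℝ, form μ ∅ (fun _ _ => 1) a (run μ (fun _ _ => 1) x K.sort ∅) G =
      form μ ∅ (fun _ _ => 1) w x K := fun K =>
    hw' _ (IsDecreasing.run h1 hx _ _).toIsUnitValued
  rw [e]
  refine le_trans ?_ ((hB _ _ hw hx).trans (limForm_le (fun _ => IsUnitValued.one)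
    hw.toIsUnitValued hx.toIsUnitValued ∅ (restr_subset B' F)))
  refine le_limForm fun K hK => ?_
  rw [← e, ← split hlt hG hK]
  exact limForm_le (fun _ => IsUnitValued.one) ha.toIsUnitValued hx.toIsUnitValued ∅
    (by simpa using union_subset_union hG hK)

/-! ### Inserting a time of projection -/

/-- Cutting at `r` turns all earlier projections into a decreasing `w` and all later ones into a
decreasing function on the right; what remains is a single projection with a weight that depends on
the value at `r`. The cost of inserting `r` with an observation there is thus controlled by the cost
without one, which the plans `level` can measure. -/
theorem form_sub_form_insert_le {g : ℝ → ℝ → ℝ} (hg : ∀ t, IsUnitValued (g t))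
    (hh : ∀ t, IsDecreasing fun q => g t (quantile (μ t) q)) (ha : IsDecreasing a)
    (hx : IsDecreasing x) {r : ℝ} {S I : Finset ℝ} (hS : S ⊆ {r}) (hI : r ∉ I) :
    form μ S (fun t q => g t (quantile (μ t) q)) a x I -
        form μ S (fun t q => g t (quantile (μ t) q)) a x (insert r I) ≤
      form μ ∅ (fun t q => g t (quantile (μ t) q)) a x I -
        form μ ∅ (fun t q => g t (quantile (μ t) q)) a x (insert r I) := by
  set h : ℝ → ℝ → ℝ := fun t q => g t (quantile (μ t) q) with hdef
  set I₁ := I.filter (· < r) with hI₁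
  set I₂ := I.filter (r < ·) with hI₂
  have hu : I = I₁ ∪ I₂ := by
    ext t
    simp only [hI₁, hI₂, Finset.mem_union, Finset.mem_filter]
    constructor
    · intro ht
      rcases lt_trichotomy t r with h1 | h1 | h1
      · exact Or.inl ⟨ht, h1⟩
      · exact absurd (h1 ▸ ht) hI
      · exact Or.inr ⟨ht, h1⟩
    · rintro (h1 | h1) <;> exact h1.1
  have l1 : ∀ t ∈ I₁, t < r := fun t ht => (Finset.mem_filter.1 ht).2
  have l2 : ∀ t ∈ I₂, r < t := fun t ht => (Finset.mem_filter.1 ht).2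
  have hu' : insert r I = I₁ ∪ ({r} ∪ I₂) := by
    rw [hu]; ext t; simp only [Finset.mem_union, Finset.mem_insert, Finset.mem_singleton]; tauto
  obtain ⟨w, hw, hw'⟩ := exists_adjoint_form (μ := μ) hh ha ∅ I₁
  have hS' : ∀ t ∈ S, t = r := fun t ht => Finset.mem_singleton.1 (hS ht)
  have run_eq : ∀ (T : Finset ℝ), T ⊆ {r} → run μ h x I₂.sort T =
      fun q => (∏ t ∈ T, h t q) * run μ h x I₂.sort ∅ q := by
    intro T hT
    funext q
    have := run_union_of_lt (μ := μ) (h := h) (x := x) T ∅ I₂.sort (by simp)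
      (fun s hs t ht => by
        rw [Finset.mem_singleton.1 (hT ht)]; exact l2 s (by simpa using hs)) q
    rwa [Finset.union_empty] at this
  have A : ∀ T : Finset ℝ, T ⊆ {r} → form μ T h a x I =
      ∫ q, w q * ((∏ t ∈ T, h t q) * run μ h x I₂.sort ∅ q) ∂Λ := by
    intro T hT
    have hT' : ∀ t ∈ T, t = r := fun t ht => Finset.mem_singleton.1 (hT ht)
    have := form_union (μ := μ) (h := h) (a := a) (x := x) (S₁ := ∅) (S₂ := T) (F₁ := I₁)
      (F₂ := I₂) (fun s hs t ht => (l1 s hs).trans (l2 t ht)) (by simp) (by simp)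
      (fun s hs t ht => by rw [hT' t ht]; exact (l1 s hs).le)
    rw [Finset.empty_union, ← hu] at this
    rw [this, hw' _ (IsDecreasing.run hh hx _ _).toIsUnitValued, run_eq T hT]
  have B : ∀ T : Finset ℝ, T ⊆ {r} → form μ T h a x (insert r I) =
      ∫ q, w q * proj (μ r) (fun q => (∏ t ∈ T, h t q) * run μ h x I₂.sort ∅ q) q ∂Λ := by
    intro T hT
    have hT' : ∀ t ∈ T, t = r := fun t ht => Finset.mem_singleton.1 (hT ht)
    have := form_union (μ := μ) (h := h) (a := a) (x := x) (S₁ := ∅) (S₂ := T) (F₁ := I₁)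
      (F₂ := {r} ∪ I₂) (fun s hs t ht => by
        rcases Finset.mem_union.1 ht with h1 | h1
        · rw [Finset.mem_singleton.1 h1]; exact l1 s hs
        · exact (l1 s hs).trans (l2 t h1)) (by simp) (by simp)
      (fun s hs t ht => by rw [hT' t ht]; exact (l1 s hs).le)
    rw [Finset.empty_union, ← hu'] at this
    rw [this, hw' _ (IsDecreasing.run hh hx _ _).toIsUnitValued]
    congr 1
    funext q
    congr 1
    have hs : ({r} ∪ I₂ : Finset ℝ).sort = r :: I₂.sort := by
      rw [sort_union_of_lt (fun s hs t ht => by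
        rw [Finset.mem_singleton.1 hs]; exact l2 t ht), Finset.sort_singleton]
      rfl
    have e1 : T.filter (· < r) = ∅ :=
      Finset.filter_false_of_mem fun t ht => by rw [hT' t ht]; exact lt_irrefl r
    have e2 : T.filter (r ≤ ·) = T :=
      Finset.filter_true_of_mem fun t ht => by rw [hT' t ht]
    rw [hs]
    simp only [run, e1, e2, Finset.prod_empty, one_mul]
    rw [run_eq T hT]
  rw [A S hS, B S hS, A ∅ (by simp), B ∅ (by simp)]
  -- At most `r` is observed, so the weight is either constant or a function of the value at `r`.
  obtain ⟨g', hg', hg'S⟩ : ∃ g', IsUnitValued g' ∧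
      ∀ q, ∏ t ∈ S, h t q = g' (quantile (μ r) q) := by
    rcases Finset.subset_singleton_iff.1 hS with rfl | rfl
    · exact ⟨fun _ => 1, IsUnitValued.one, by simp⟩
    · exact ⟨g r, hg r, by simp [hdef]⟩
  simp only [hg'S, Finset.prod_empty, one_mul]
  exact integral_weight_sub_proj_le (μ r) hg' hw (IsDecreasing.run hh hx _ _)

/-- Everything at or before `s` is absorbed into `w` by the adjoint, and everything at or after `u`
into `c`. The test functions do not depend on the projection times `I` chosen inside the interval.
-/
theorem exists_local_form (hh : ∀ t, IsDecreasing (h t)) (ha : IsDecreasing a)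
    (hx : IsDecreasing x) {s u r : ℝ} (hsu : s < u) {S O : Finset ℝ}
    (hS : ∀ t ∈ S, t ∈ Ioo s u → t = r) (hr : r ∈ Ioo s u) (hO : ∀ t ∈ O, t ∉ Ioo s u) :
    ∃ w c, IsDecreasing w ∧ IsDecreasing c ∧ ∀ I : Finset ℝ, (I : Set ℝ) ⊆ Ioo s u →
      form μ S h a x (O ∪ I) = form μ (S.filter (· = r)) h w c I := by
  obtain ⟨w, hw, hw'⟩ := exists_adjoint_form (μ := μ) hh ha (S.filter (· ≤ s)) (O.filter (· ≤ s))
  refine ⟨w, run μ h x (O.filter (u ≤ ·)).sort (S.filter (u ≤ ·)), hw,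
    IsDecreasing.run hh hx _ _, fun I hI => ?_⟩
  have hOI : O ∪ I = O.filter (· ≤ s) ∪ (I ∪ O.filter (u ≤ ·)) := by
    ext t
    have h1 := hO t
    simp only [Finset.mem_union, Finset.mem_filter]
    have h2 : t ∈ O → t ≤ s ∨ u ≤ t := fun ht => by
      by_contra hc; push Not at hc; exact h1 ht hc
    tauto
  have hSS : S = S.filter (· ≤ s) ∪ (S.filter (· = r) ∪ S.filter (u ≤ ·)) := by
    ext t
    have h1 := hS t
    simp only [Finset.mem_union, Finset.mem_filter]
    have h2 : t ∈ S → t ≤ s ∨ t = r ∨ u ≤ t := fun ht => by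
      by_contra hc; push Not at hc; exact hc.2.1 (h1 ht ⟨hc.1, hc.2.2⟩)
    tauto
  have hd : ∀ t ∈ S.filter (· = r) ∪ S.filter (u ≤ ·), s < t := by
    intro t ht
    rcases Finset.mem_union.1 ht with h1 | h1
    · rw [(Finset.mem_filter.1 h1).2]; exact hr.1
    · exact hsu.trans_le (Finset.mem_filter.1 h1).2
  have hd' : ∀ t ∈ I ∪ O.filter (u ≤ ·), s < t := by
    intro t ht
    rcases Finset.mem_union.1 ht with h1 | h1
    · exact (hI h1).1
    · exact hsu.trans_le (Finset.mem_filter.1 h1).2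
  conv_lhs => rw [hOI, hSS]
  rw [form_union
    (fun t ht t' ht' => (Finset.mem_filter.1 ht).2.trans_lt (hd' t' ht'))
    (Finset.disjoint_left.2 fun t ht ht' =>
      absurd (Finset.mem_filter.1 ht).2 (not_le.2 (hd t ht')))
    (fun t' ht' t ht => (Finset.mem_filter.1 ht).2.trans_lt (hd' t' ht'))
    (fun t ht t' ht' => ((Finset.mem_filter.1 ht).2.trans_lt (hd t' ht')).le),
    hw' _ (IsDecreasing.run hh hx _ _).toIsUnitValued]
  change form μ _ h w x _ = _
  exact form_union (fun t ht t' ht' => (hI ht).2.trans_le (Finset.mem_filter.1 ht').2)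
    (Finset.disjoint_left.2 fun t ht ht' => absurd hr.2 (not_lt.2
      ((Finset.mem_filter.1 ht').2.trans_eq (Finset.mem_filter.1 ht).2)))
    (fun t' ht' t ht => ((Finset.mem_filter.1 ht).2.trans_lt hr.2).trans_le
      (Finset.mem_filter.1 ht').2)
    (fun t ht t' ht' => ((hI ht).2.trans_le (Finset.mem_filter.1 ht').2).le)

/-- The plans of the points of `R` in each open interval coincide with those of the interval. -/
def IsOpenDense (μ : ℝ → ProbabilityMeasure ℝ) (R : Set ℝ) : Prop :=
  ∀ s t : ℝ, s < t → LevelLE μ (R ∩ Ioo s t) (Ioo s t)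

theorem IsOpenDense.mono {R R' : Set ℝ} (hR : IsOpenDense μ R) (hRR : R ⊆ R') :
    IsOpenDense μ R' := fun s t hst =>
  (LevelLE.of_superset (inter_subset_inter_left _ hRR)).trans (hR s t hst)

/-- Near `r` the points of `R` can be refined until a projection at `r` costs less than `ε` without
observation; the weighted loss inequality gives the same bound with an observation at `r`, and
refinement never raises a form. -/
theorem IsOpenDense.limForm_le_limForm_insert {R : Set ℝ} (hR : IsOpenDense μ R)
    {g : ℝ → ℝ → ℝ} (hg : ∀ t, IsUnitValued (g t))
    (hh : ∀ t, IsDecreasing fun q => g t (quantile (μ t) q)) (ha : IsDecreasing a)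
    (hx : IsDecreasing x) (S : Finset ℝ) (r : ℝ) :
    limForm μ S (fun t q => g t (quantile (μ t) q)) a x R ≤
      limForm μ S (fun t q => g t (quantile (μ t) q)) a x (insert r R) := by
  by_cases hrR : r ∈ R
  · rw [insert_eq_of_mem hrR]
  have hhu := fun t => (hh t).toIsUnitValued
  refine le_limForm fun F hF => le_of_forall_pos_le_add fun ε hε => ?_
  -- Observations are finite in number, so an interval around `r` contains no other observation
  -- time.
  obtain ⟨s, u, hr, hSsu⟩ : ∃ s u, r ∈ Ioo s u ∧ ∀ t ∈ S, t ∈ Ioo s u → t = r := by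
    have hcl : IsOpen ((S.erase r : Finset ℝ) : Set ℝ)ᶜ :=
      (Finset.finite_toSet _).isClosed.isOpen_compl
    obtain ⟨s, u, hr, hsub⟩ := mem_nhds_iff_exists_Ioo_subset.1
      (hcl.mem_nhds (show r ∈ ((S.erase r : Finset ℝ) : Set ℝ)ᶜ by simp))
    refine ⟨s, u, hr, fun t ht htsu => ?_⟩
    by_contra hc
    exact hsub htsu (by simp [ht, hc])
  have hsu := hr.1.trans hr.2
  have hO : ∀ t ∈ restr (Ioo s u)ᶜ F, t ∉ Ioo s u := fun t ht => (mem_restr.1 ht).2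
  obtain ⟨w, c, hw, hc, hwc⟩ := exists_local_form (μ := μ) hh ha hx hsu hSsu hr hO
  -- Density is applied to the localized test functions: finitely many points of `R` already bring
  -- the form without observations within `ε` of its infimum over the whole interval.
  obtain ⟨I', hI', hlt⟩ := exists_form_lt (μ := μ) (h := fun _ _ => 1) (a := w) (x := c) ∅
    (R ∩ Ioo s u) (lt_of_le_of_lt (hR s u hsu w c hw hc) (lt_add_of_pos_right _ hε))
  set I := I' ∪ restr (Ioo s u) (F.erase r) with hI
  have hIR : (I : Set ℝ) ⊆ R ∩ Ioo s u := by
    intro t ht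
    rcases Finset.mem_union.1 (Finset.mem_coe.1 ht) with h1 | h1
    · exact hI' h1
    · have h2 := mem_restr.1 h1
      have h3 := Finset.mem_erase.1 h2.1
      exact ⟨(hF h3.2).resolve_left h3.1, h2.2⟩
  have hrI : r ∉ I := fun h => hrR (hIR h).1
  have h1 : form μ ∅ (fun _ _ => 1) w c I < limForm μ ∅ (fun _ _ => 1) w c (Ioo s u) + ε :=
    (form_anti (fun _ => IsDecreasing.one) hw hc ∅ Finset.subset_union_left).trans_lt hlt
  have hins : ((insert r I : Finset ℝ) : Set ℝ) ⊆ Ioo s u := by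
    rw [Finset.coe_insert]
    exact insert_subset hr (hIR.trans inter_subset_right)
  -- After insertion of `r` the form still lies above the infimum over the interval, so without
  -- observation the insertion costs less than `ε`.
  have h2 : limForm μ ∅ (fun _ _ => 1) w c (Ioo s u) ≤ form μ ∅ (fun _ _ => 1) w c (insert r I) :=
    limForm_le (fun _ => IsUnitValued.one) hw.toIsUnitValued hc.toIsUnitValued ∅ hins
  have h3 := form_sub_form_insert_le (μ := μ) hg hh hw hc (S := S.filter (· = r))
    (fun t ht => by simpa using (Finset.mem_filter.1 ht).2) hrI
  rw [form_empty_congr (fun _ _ => 1), form_empty_congr (fun _ _ => 1) (insert r I),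
    ← hwc I (hIR.trans inter_subset_right), ← hwc _ hins] at h3
  have h4 : limForm μ S (fun t q => g t (quantile (μ t) q)) a x R ≤
      form μ S (fun t q => g t (quantile (μ t) q)) a x (restr (Ioo s u)ᶜ F ∪ I) := by
    refine limForm_le hhu ha.toIsUnitValued hx.toIsUnitValued S ?_
    intro t ht
    rcases Finset.mem_union.1 (Finset.mem_coe.1 ht) with h5 | h5
    · have h6 := mem_restr.1 h5
      refine (hF h6.1).resolve_left fun h7 => h6.2 (h7 ▸ hr)
    · exact (hIR h5).1
  have h5 : form μ S (fun t q => g t (quantile (μ t) q)) a x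
      (restr (Ioo s u)ᶜ F ∪ insert r I) ≤ form μ S (fun t q => g t (quantile (μ t) q)) a x F := by
    refine form_anti hh ha hx S fun t ht => ?_
    simp only [hI, Finset.mem_union, Finset.mem_insert, mem_restr, Finset.mem_erase,
      mem_compl_iff]
    tauto
  linarith

/-- Density survives enlargement of the set, so the points of a finite set can be adjoined to `R`
one by one without lowering the infimum. -/
theorem IsOpenDense.limForm_eq {R : Set ℝ} (hR : IsOpenDense μ R)
    {g : ℝ → ℝ → ℝ} (hg : ∀ t, IsUnitValued (g t))
    (hh : ∀ t, IsDecreasing fun q => g t (quantile (μ t) q)) (ha : IsDecreasing a)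
    (hx : IsDecreasing x) (S : Finset ℝ) :
    limForm μ S (fun t q => g t (quantile (μ t) q)) a x R =
      limForm μ S (fun t q => g t (quantile (μ t) q)) a x univ := by
  have hhu := fun t => (hh t).toIsUnitValued
  refine le_antisymm (le_limForm fun F hF => ?_)
    (limForm_anti hhu ha.toIsUnitValued hx.toIsUnitValued S (subset_univ R))
  clear hF
  have key : limForm μ S (fun t q => g t (quantile (μ t) q)) a x R ≤
      limForm μ S (fun t q => g t (quantile (μ t) q)) a x (↑F ∪ R) := by
    induction F using Finset.induction_on with
    | empty => simp
    | insert r F _ ih =>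
      refine ih.trans ?_
      rw [Finset.coe_insert, insert_union]
      exact (hR.mono subset_union_right).limForm_le_limForm_insert hg hh ha hx S r
  exact key.trans (limForm_le hhu ha.toIsUnitValued hx.toIsUnitValued S subset_union_left)

end

/-! ### From indicators of half-lines to general test functions. -/

section

/-! ### Convergence of dominated measures on the real line -/

section Dominated

variable {ι : Type*} {l : Filter ι} {ν : Measure ℝ} [IsFiniteMeasure ν] {m m' : ι → Measure ℝ}

/-- The common bound `ν` makes the error of replacing `B` by `C` uniform along the filter. -/
theorem tendsto_measureReal_sub_of_subset {α : Type*} [MeasurableSpace α] {ν : Measure α}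
    [IsFiniteMeasure ν] {m m' : ι → Measure α} (hm : ∀ i, m i ≤ ν) (hm' : ∀ i, m' i ≤ ν)
    {B : Set α}
    (h : ∀ ε > 0, ∃ C ⊆ B, MeasurableSet C ∧ ν.real (B \ C) < ε ∧
      Tendsto (fun i => (m i).real C - (m' i).real C) l (𝓝 0)) :
    Tendsto (fun i => (m i).real B - (m' i).real B) l (𝓝 0) := by
  have hf : ∀ i, IsFiniteMeasure (m i) := fun i => isFiniteMeasure_of_le ν (hm i)
  have hf' : ∀ i, IsFiniteMeasure (m' i) := fun i => isFiniteMeasure_of_le ν (hm' i)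
  rw [Metric.tendsto_nhds]
  intro ε hε
  obtain ⟨C, hCB, hC, hν, ht⟩ := h (ε / 2) (half_pos hε)
  filter_upwards [(Metric.tendsto_nhds.1 ht) (ε / 2) (half_pos hε)] with i hi
  rw [Real.dist_eq, sub_zero] at hi ⊢
  have e : (m i).real B = (m i).real C + (m i).real (B \ C) := by
    rw [measureReal_sdiff hCB hC]; ring
  have e' : (m' i).real B = (m' i).real C + (m' i).real (B \ C) := by
    rw [measureReal_sdiff hCB hC]; ring
  have l1 : (m i).real (B \ C) ≤ ν.real (B \ C) :=
    ENNReal.toReal_mono (measure_ne_top _ _) (hm i _)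
  have l2 : (m' i).real (B \ C) ≤ ν.real (B \ C) :=
    ENNReal.toReal_mono (measure_ne_top _ _) (hm' i _)
  have p1 : 0 ≤ (m i).real (B \ C) := measureReal_nonneg
  have p2 : 0 ≤ (m' i).real (B \ C) := measureReal_nonneg
  rw [abs_lt] at hi ⊢
  constructor <;> linarith [hi.1, hi.2]

/-- Convergence passes from half-lines to Borel sets by induction over the generated sigma-algebra.
Domination by one finite measure is what makes countable disjoint unions admissible. -/
theorem tendsto_measureReal_sub (hm : ∀ i, m i ≤ ν) (hm' : ∀ i, m' i ≤ ν)
    (h : ∀ x, Tendsto (fun i => (m i).real (Iic x) - (m' i).real (Iic x)) l (𝓝 0))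
    {B : Set ℝ} (hB : MeasurableSet B) :
    Tendsto (fun i => (m i).real B - (m' i).real B) l (𝓝 0) := by
  have hf : ∀ i, IsFiniteMeasure (m i) := fun i => isFiniteMeasure_of_le ν (hm i)
  have hf' : ∀ i, IsFiniteMeasure (m' i) := fun i => isFiniteMeasure_of_le ν (hm' i)
  -- Total masses are needed for complements; they are approximated by half-lines of almost full
  -- `ν`-mass.
  have huniv : Tendsto (fun i => (m i).real univ - (m' i).real univ) l (𝓝 0) := by
    refine tendsto_measureReal_sub_of_subset hm hm' fun ε hε => ?_
    have ht : Tendsto (fun n : ℕ => ν.real (univ \ Iic (n : ℝ))) atTop (𝓝 0) := by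
      have h0 : ν (⋂ n : ℕ, univ \ Iic (n : ℝ)) = 0 := by
        convert! measure_empty (μ := ν)
        refine eq_empty_of_forall_notMem fun x hx => ?_
        obtain ⟨n, hn⟩ := exists_nat_ge x
        exact (mem_iInter.1 hx n).2 hn
      have := tendsto_measure_iInter_atTop (μ := ν) (s := fun n : ℕ => univ \ Iic (n : ℝ))
        (fun n => (MeasurableSet.univ.diff measurableSet_Iic).nullMeasurableSet)
        (fun n k hnk => sdiff_subset_sdiff_right (Iic_subset_Iic.2 (by exact_mod_cast hnk)))
        ⟨0, measure_ne_top _ _⟩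
      rw [h0] at this
      exact (ENNReal.tendsto_toReal ENNReal.zero_ne_top).comp this
    obtain ⟨n, hn⟩ := (ht.eventually (gt_mem_nhds hε)).exists
    exact ⟨Iic n, subset_univ _, measurableSet_Iic, hn, h n⟩
  refine MeasurableSpace.induction_on_inter
    (C := fun B _ => Tendsto (fun i => (m i).real B - (m' i).real B) l (𝓝 0))
    (borel_eq_generateFrom_Iic ℝ ▸ (BorelSpace.measurable_eq (α := ℝ))) isPiSystem_Iic
    (by simpa using tendsto_const_nhds) ?_ ?_ ?_ B hB
  · rintro _ ⟨x, rfl⟩; exact h x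
  · intro t ht hC
    have := huniv.sub hC
    rw [sub_zero] at this
    refine this.congr fun i => ?_
    rw [measureReal_compl ht, measureReal_compl ht]; ring
  · intro f hd hfm hC
    refine tendsto_measureReal_sub_of_subset hm hm' fun ε hε => ?_
    have ht : Tendsto (fun n : ℕ => ν.real ((⋃ i, f i) \ ⋃ i ∈ Finset.range n, f i)) atTop
        (𝓝 0) := by
      have h0 : ν (⋂ n : ℕ, (⋃ i, f i) \ ⋃ i ∈ Finset.range n, f i) = 0 := by
        convert! measure_empty (μ := ν)
        refine eq_empty_of_forall_notMem fun x hx => ?_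
        obtain ⟨i, hi⟩ := mem_iUnion.1 (mem_iInter.1 hx 0).1
        exact (mem_iInter.1 hx (i + 1)).2 (mem_biUnion (by simp) hi)
      have := tendsto_measure_iInter_atTop (μ := ν)
        (s := fun n : ℕ => (⋃ i, f i) \ ⋃ i ∈ Finset.range n, f i)
        (fun n => ((MeasurableSet.iUnion hfm).diff
          (Finset.measurableSet_biUnion _ fun i _ => hfm i)).nullMeasurableSet)
        (fun n k hnk => sdiff_subset_sdiff_right
          (biUnion_subset_biUnion_left fun i hi => by
            simp only [Finset.coe_range, mem_Iio] at hi ⊢; omega))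
        ⟨0, measure_ne_top _ _⟩
      rw [h0] at this
      exact (ENNReal.tendsto_toReal ENNReal.zero_ne_top).comp this
    obtain ⟨n, hn⟩ := (ht.eventually (gt_mem_nhds hε)).exists
    refine ⟨⋃ i ∈ Finset.range n, f i, iUnion₂_subset fun i _ => subset_iUnion f i,
      Finset.measurableSet_biUnion _ fun i _ => hfm i, hn, ?_⟩
    have hsum := tendsto_finsetSum (Finset.range n) fun k _ => hC k
    rw [Finset.sum_const_zero] at hsum
    refine hsum.congr fun i => ?_
    rw [measureReal_biUnion_finset (fun a _ b _ hab => hd hab) (fun a _ => hfm a),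
      measureReal_biUnion_finset (fun a _ b _ hab => hd hab) (fun a _ => hfm a),
      Finset.sum_sub_distrib]

/-- A function with values in the unit interval is a uniform limit of averages of indicators. -/
theorem IsUnitValued.abs_sub_sum_le {α : Type*} [MeasurableSpace α] {b : α → ℝ}
    (hb : IsUnitValued b) {n : ℕ} (hn : 0 < n) (x : α) :
    |b x - ∑ k ∈ Finset.Icc 1 n, (1 / (n : ℝ)) * {y | (k : ℝ) ≤ n * b y}.indicator
      (fun _ => (1 : ℝ)) x| ≤ 1 / n := by
  have hn' : (0 : ℝ) < n := by exact_mod_cast hn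
  have hnb : 0 ≤ n * b x := mul_nonneg hn'.le (hb.nonneg x)
  have h1 : ∑ k ∈ Finset.Icc 1 n, {y | (k : ℝ) ≤ n * b y}.indicator (fun _ => (1 : ℝ)) x
      = (⌊n * b x⌋₊ : ℝ) := by
    have : ∀ k ∈ Finset.Icc 1 n, {y | (k : ℝ) ≤ n * b y}.indicator (fun _ => (1 : ℝ)) x =
        if k ≤ ⌊n * b x⌋₊ then 1 else 0 := by
      intro k _
      by_cases hk : (k : ℝ) ≤ n * b x
      · rw [if_pos (Nat.le_floor hk)]; exact indicator_of_mem (s := {y | (k : ℝ) ≤ n * b y}) hk _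
      · rw [if_neg fun hc => hk ((Nat.le_floor_iff hnb).1 hc)]
        exact indicator_of_notMem (s := {y | (k : ℝ) ≤ n * b y}) hk _
    rw [Finset.sum_congr rfl this, Finset.sum_ite, Finset.sum_const_zero, add_zero,
      Finset.sum_const, nsmul_eq_mul, mul_one]
    have hle : ⌊n * b x⌋₊ ≤ n := by
      have : n * b x ≤ n := by nlinarith [hb.le_one x]
      exact Nat.floor_le_of_le this
    have : (Finset.Icc 1 n).filter (· ≤ ⌊n * b x⌋₊) = Finset.Icc 1 ⌊n * b x⌋₊ := by
      ext k; simp only [Finset.mem_filter, Finset.mem_Icc]; omega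
    rw [this]; simp
  rw [← Finset.mul_sum, h1]
  have e : b x - 1 / n * (⌊n * b x⌋₊ : ℝ) = (1 / n) * (n * b x - ⌊n * b x⌋₊) := by
    field_simp
  have l1 := Nat.floor_le hnb
  have l2 := Nat.lt_floor_add_one (n * b x)
  rw [e, abs_mul, abs_of_nonneg (by positivity : (0 : ℝ) ≤ 1 / n),
    abs_of_nonneg (by linarith)]
  exact mul_le_of_le_one_right (by positivity) (by linarith)

theorem IsUnitValued.abs_integral_sub_sum_le {α : Type*} [MeasurableSpace α] {b : α → ℝ}
    (hb : IsUnitValued b) {n : ℕ} (hn : 0 < n) {ν m : Measure α} [IsFiniteMeasure ν]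
    (hm : m ≤ ν) :
    |∫ x, b x ∂m - ∑ k ∈ Finset.Icc 1 n, (1 / (n : ℝ)) * m.real {y | (k : ℝ) ≤ n * b y}| ≤
      1 / n * ν.real univ := by
  have hf : IsFiniteMeasure m := isFiniteMeasure_of_le ν hm
  have hms : ∀ k : ℕ, MeasurableSet {y | (k : ℝ) ≤ n * b y} := fun k =>
    measurableSet_le measurable_const (hb.meas.const_mul _)
  have hint : ∀ k ∈ Finset.Icc 1 n, Integrable (fun x => (1 / (n : ℝ)) *
      {y | (k : ℝ) ≤ n * b y}.indicator (fun _ => (1 : ℝ)) x) m := fun k _ =>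
    ((IsUnitValued.indicator (hms k)).integrable m).const_mul _
  have e : ∑ k ∈ Finset.Icc 1 n, (1 / (n : ℝ)) * m.real {y | (k : ℝ) ≤ n * b y} =
      ∫ x, ∑ k ∈ Finset.Icc 1 n, (1 / (n : ℝ)) * {y | (k : ℝ) ≤ n * b y}.indicator
        (fun _ => (1 : ℝ)) x ∂m := by
    rw [integral_finsetSum _ hint]
    refine Finset.sum_congr rfl fun k _ => ?_
    rw [integral_const_mul, integral_indicator (hms k)]
    simp
  rw [e, ← integral_sub (hb.integrable m) (integrable_finsetSum _ hint), ← Real.norm_eq_abs]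
  calc _ ≤ (1 / (n : ℝ)) * m.real univ :=
        norm_integral_le_of_norm_le_const (Eventually.of_forall fun x => hb.abs_sub_sum_le hn x)
    _ ≤ _ := mul_le_mul_of_nonneg_left (ENNReal.toReal_mono (measure_ne_top _ _) (hm _))
        (by positivity)

theorem tendsto_integral_sub (hm : ∀ i, m i ≤ ν) (hm' : ∀ i, m' i ≤ ν)
    (h : ∀ x, Tendsto (fun i => (m i).real (Iic x) - (m' i).real (Iic x)) l (𝓝 0))
    {b : ℝ → ℝ} (hb : IsUnitValued b) :
    Tendsto (fun i => ∫ x, b x ∂(m i) - ∫ x, b x ∂(m' i)) l (𝓝 0) := by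
  rw [Metric.tendsto_nhds]
  intro ε hε
  -- Replacing each of the two integrals by a sum over superlevel sets costs at most `ε / 4`,
  -- uniformly along the filter; the remaining `ε / 2` is for the difference of the sums.
  obtain ⟨n, hn0, hn⟩ : ∃ n : ℕ, 0 < n ∧ 1 / (n : ℝ) * ν.real univ < ε / 4 := by
    obtain ⟨n, hn⟩ := exists_nat_gt (ν.real univ / (ε / 4))
    have hn0 : (0 : ℝ) < n := lt_of_le_of_lt (by positivity) hn
    refine ⟨n, by exact_mod_cast hn0, ?_⟩
    rw [div_lt_iff₀ (by positivity)] at hn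
    rw [one_div, inv_mul_lt_iff₀ hn0]
    linarith
  have hms : ∀ k : ℕ, MeasurableSet {y | (k : ℝ) ≤ n * b y} := fun k =>
    measurableSet_le measurable_const (hb.meas.const_mul _)
  have hsum := tendsto_finsetSum (Finset.Icc 1 n) fun k _ =>
    (tendsto_measureReal_sub hm hm' h (hms k)).const_mul (1 / (n : ℝ))
  simp only [mul_zero, Finset.sum_const_zero] at hsum
  filter_upwards [(Metric.tendsto_nhds.1 hsum) (ε / 2) (half_pos hε)] with i hi
  rw [Real.dist_eq, sub_zero] at hi ⊢
  simp only [mul_sub, Finset.sum_sub_distrib] at hi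
  have h1 := hb.abs_integral_sub_sum_le hn0 (hm i)
  have h2 := hb.abs_integral_sub_sum_le hn0 (hm' i)
  rw [abs_le] at h1 h2
  rw [abs_lt] at hi ⊢
  constructor <;> linarith [h1.1, h1.2, h2.1, h2.2, hi.1, hi.2]

end Dominated

/-- The law of `G` weighted by `w`. -/
theorem map_withDensity_properties {Ω : Type*} [MeasurableSpace Ω] {P : Measure Ω}
    [IsFiniteMeasure P] {G : Ω → ℝ} (hG : Measurable G) {w : Ω → ℝ} (hw : IsUnitValued w) :
    (P.withDensity fun ω => ENNReal.ofReal (w ω)).map G ≤ P.map G ∧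
      (∀ b : ℝ → ℝ, IsUnitValued b →
        ∫ x, b x ∂((P.withDensity fun ω => ENNReal.ofReal (w ω)).map G) =
          ∫ ω, w ω * b (G ω) ∂P) ∧
      ∀ x, ((P.withDensity fun ω => ENNReal.ofReal (w ω)).map G).real (Iic x) =
        ∫ ω, w ω * (Iic x).indicator (fun _ => (1 : ℝ)) (G ω) ∂P := by
  have h2 : ∀ b : ℝ → ℝ, IsUnitValued b →
      ∫ x, b x ∂((P.withDensity fun ω => ENNReal.ofReal (w ω)).map G) =
        ∫ ω, w ω * b (G ω) ∂P := by
    intro b hb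
    rw [integral_map hG.aemeasurable hb.meas.aestronglyMeasurable,
      integral_withDensity_eq_integral_toReal_smul hw.meas.ennreal_ofReal
        (Eventually.of_forall fun _ => ENNReal.ofReal_lt_top)]
    refine integral_congr_ae (Eventually.of_forall fun ω => ?_)
    simp only [ENNReal.toReal_ofReal (hw.nonneg ω), smul_eq_mul]
  refine ⟨Measure.map_mono ?_ hG, h2, fun x => ?_⟩
  · calc _ ≤ P.withDensity 1 := withDensity_mono (Eventually.of_forall fun ω => by
          simpa using hw.le_one ω)
      _ = P := withDensity_one
  · rw [← h2 _ (IsUnitValued.indicator measurableSet_Iic), integral_indicator measurableSet_Iic]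
    simp

/-- Convergence of weighted integrals of functions of a random variable follows from the
convergence for the indicators of half-lines. -/
theorem tendsto_integral_weight_sub {ι Ω Ω' : Type*} {l : Filter ι} [MeasurableSpace Ω]
    [MeasurableSpace Ω'] {P : Measure Ω} {P' : Measure Ω'} [IsFiniteMeasure P] [IsFiniteMeasure P']
    {G : Ω → ℝ} {G' : Ω' → ℝ} (hG : Measurable G) (hG' : Measurable G')
    (hPP : P.map G = P'.map G') {w : ι → Ω → ℝ} {w' : ι → Ω' → ℝ} (hw : ∀ i, IsUnitValued (w i))
    (hw' : ∀ i, IsUnitValued (w' i))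
    (h : ∀ x, Tendsto (fun i => ∫ ω, w i ω * (Iic x).indicator (fun _ => (1 : ℝ)) (G ω) ∂P -
      ∫ ω, w' i ω * (Iic x).indicator (fun _ => (1 : ℝ)) (G' ω) ∂P') l (𝓝 0))
    {b : ℝ → ℝ} (hb : IsUnitValued b) :
    Tendsto (fun i => ∫ ω, w i ω * b (G ω) ∂P - ∫ ω, w' i ω * b (G' ω) ∂P') l (𝓝 0) := by
  -- The weights are at most one, so the weighted laws of `G` and `G'` are dominated by their common
  -- unweighted law.
  have := tendsto_integral_sub (l := l) (ν := P.map G)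
    (m := fun i => (P.withDensity fun ω => ENNReal.ofReal (w i ω)).map G)
    (m' := fun i => (P'.withDensity fun ω => ENNReal.ofReal (w' i ω)).map G')
    (fun i => (map_withDensity_properties hG (hw i)).1) (fun i => hPP ▸ (map_withDensity_properties hG' (hw' i)).1)
    (fun x => by simpa only [(map_withDensity_properties hG (hw _)).2.2, (map_withDensity_properties hG' (hw' _)).2.2] using h x) hb
  simpa only [(map_withDensity_properties hG (hw _)).2.1 b hb, (map_withDensity_properties hG' (hw' _)).2.1 b hb] using this

/-! ### From indicators to decreasing functions -/

variable {μ : ℝ → ProbabilityMeasure ℝ} {h : ℝ → ℝ → ℝ} {a x : ℝ → ℝ}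

/-- The run on the right serves as the weight, for `A` and for `B` along the same filter. The
composite `b ∘ G` must be decreasing for its forms to converge to the two infima. -/
theorem limForm_eq_of_indicator_left {G : ℝ → ℝ} (hG : Measurable G)
    (hGd : ∀ y, IsDecreasing fun q => (Iic y).indicator (fun _ => (1 : ℝ)) (G q))
    (hx : IsDecreasing x) {A B : Set ℝ}
    (hAB : ∀ y, limForm μ ∅ (fun _ _ => 1) (fun q => (Iic y).indicator (fun _ => (1 : ℝ)) (G q)) x A
      = limForm μ ∅ (fun _ _ => 1) (fun q => (Iic y).indicator (fun _ => (1 : ℝ)) (G q)) x B)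
    {b : ℝ → ℝ} (hb : IsUnitValued b) (hbG : IsDecreasing fun q => b (G q)) :
    limForm μ ∅ (fun _ _ => 1) (fun q => b (G q)) x A =
      limForm μ ∅ (fun _ _ => 1) (fun q => b (G q)) x B := by
  have h1 : ∀ _ : ℝ, IsDecreasing fun _ : ℝ => (1 : ℝ) := fun _ => IsDecreasing.one
  have e : ∀ (c : ℝ → ℝ) F, form μ ∅ (fun _ _ => 1) (fun q => c (G q)) x F =
      ∫ q, run μ (fun _ _ => 1) x F.sort ∅ q * c (G q) ∂Λ := fun c F => by
    simp only [form, mul_comm]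
  have key := tendsto_integral_weight_sub (l := (atTop : Filter (Finset ℝ))) (P := Λ) (P' := Λ)
    hG hG rfl (fun F => (IsDecreasing.run (μ := μ) h1 hx (restr A F).sort ∅).toIsUnitValued)
    (fun F => (IsDecreasing.run (μ := μ) h1 hx (restr B F).sort ∅).toIsUnitValued) (fun y => by
      have t := (tendsto_form (μ := μ) h1 (hGd y) hx ∅ A).sub (tendsto_form (μ := μ) h1 (hGd y) hx ∅ B)
      rw [hAB y, sub_self] at t
      simpa only [e] using t) hb
  have t := (tendsto_form (μ := μ) h1 hbG hx ∅ A).sub (tendsto_form (μ := μ) h1 hbG hx ∅ B)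
  simp only [e] at t
  exact sub_eq_zero.1 (tendsto_nhds_unique t key)

/-- The same argument for the other end, with the adjoint of the projections as the weight. -/
theorem limForm_eq_of_indicator_right {G : ℝ → ℝ} (hG : Measurable G)
    (hGd : ∀ y, IsDecreasing fun q => (Iic y).indicator (fun _ => (1 : ℝ)) (G q))
    (ha : IsDecreasing a) {A B : Set ℝ}
    (hAB : ∀ y, limForm μ ∅ (fun _ _ => 1) a (fun q => (Iic y).indicator (fun _ => (1 : ℝ)) (G q)) A
      = limForm μ ∅ (fun _ _ => 1) a (fun q => (Iic y).indicator (fun _ => (1 : ℝ)) (G q)) B)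
    {b : ℝ → ℝ} (hb : IsUnitValued b) (hbG : IsDecreasing fun q => b (G q)) :
    limForm μ ∅ (fun _ _ => 1) a (fun q => b (G q)) A =
      limForm μ ∅ (fun _ _ => 1) a (fun q => b (G q)) B := by
  have h1 : ∀ _ : ℝ, IsDecreasing fun _ : ℝ => (1 : ℝ) := fun _ => IsDecreasing.one
  choose w hw hwF using fun F => exists_adjoint_form (μ := μ) h1 ha ∅ F
  have key := tendsto_integral_weight_sub (l := (atTop : Filter (Finset ℝ))) (P := Λ) (P' := Λ)
    hG hG rfl (fun F => (hw (restr A F)).toIsUnitValued)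
    (fun F => (hw (restr B F)).toIsUnitValued) (fun y => by
      have t := (tendsto_form (μ := μ) h1 ha (hGd y) ∅ A).sub (tendsto_form (μ := μ) h1 ha (hGd y) ∅ B)
      rw [hAB y, sub_self] at t
      simpa only [hwF _ _ (hGd y).toIsUnitValued] using t) hb
  have t := (tendsto_form (μ := μ) h1 ha hbG ∅ A).sub (tendsto_form (μ := μ) h1 ha hbG ∅ B)
  simp only [hwF _ _ hbG.toIsUnitValued] at t
  exact sub_eq_zero.1 (tendsto_nhds_unique t key)

/-- Equality of two plans on quadrants implies equality on all pairs of decreasing functions; this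
is how a hypothesis on `level` becomes one on forms with arbitrary test functions. -/
theorem limForm_eq_of_indicator {A B : Set ℝ}
    (hAB : ∀ u v, limForm μ ∅ (fun _ _ => 1) ((Iic u).indicator fun _ => 1)
        ((Iic v).indicator fun _ => 1) A =
      limForm μ ∅ (fun _ _ => 1) ((Iic u).indicator fun _ => 1) ((Iic v).indicator fun _ => 1) B)
    (ha : IsDecreasing a) (hx : IsDecreasing x) :
    limForm μ ∅ (fun _ _ => 1) a x A = limForm μ ∅ (fun _ _ => 1) a x B :=
  limForm_eq_of_indicator_right measurable_id IsDecreasing.indicator_Iic ha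
    (fun v => limForm_eq_of_indicator_left measurable_id IsDecreasing.indicator_Iic
      (IsDecreasing.indicator_Iic v) (fun u => hAB u v) ha.toIsUnitValued ha) hx.toIsUnitValued hx

end

/-! ### Couplings, plans and path laws expressed by forms. -/

section

/-! ### Composition of transport plans through kernels -/

/-- Conditional kernels are unique only almost everywhere; since the second marginal of `P` is the
first one of `Q`, any choice of disintegrations gives the same product. -/
theorem comp_toMeasure {P Q : ProbabilityMeasure (ℝ × ℝ)} {m n : Measure ℝ} [IsFiniteMeasure m]
    [IsFiniteMeasure n] {κ η : Kernel ℝ ℝ} [IsMarkovKernel κ] [IsMarkovKernel η]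
    (hP : (P : Measure (ℝ × ℝ)) = m ⊗ₘ κ) (hQ : (Q : Measure (ℝ × ℝ)) = n ⊗ₘ η)
    (hmn : κ ∘ₘ m = n) : (comp P Q : Measure (ℝ × ℝ)) = m ⊗ₘ (η ∘ₖ κ) := by
  obtain ⟨P, hP'⟩ := P
  obtain ⟨Q, hQ'⟩ := Q
  simp only [ProbabilityMeasure.coe_mk] at hP hQ
  subst hP hQ
  change (m ⊗ₘ κ).fst ⊗ₘ ((n ⊗ₘ η).condKernel ∘ₖ (m ⊗ₘ κ).condKernel) = _
  rw [Measure.fst_compProd]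
  refine Measure.compProd_congr ?_
  have h1 := condKernel_compProd m κ
  have h2 := condKernel_compProd n η
  have h3 : ∀ᵐ y ∂(κ ∘ₘ m), (n ⊗ₘ η).condKernel y = η y := by rw [hmn]; exact h2
  filter_upwards [h1, Measure.ae_ae_of_ae_comp h3] with x hx1 hx2
  rw [Kernel.comp_apply, Kernel.comp_apply, hx1]
  exact Measure.bind_congr_right hx2

theorem fibreKernel_comp_lam (ν : ProbabilityMeasure ℝ) : fibreKernel ν ∘ₘ Λ = Λ := by
  have h1 : levelKernel ν ∘ₘ (ν : Measure ℝ) = Λ := by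
    rw [← Measure.snd_compProd, map_quantile_id, Measure.snd_map_prodMk (measurable_quantile ν)]
    exact Measure.map_id
  conv_rhs => rw [← h1]
  ext s hs
  rw [Measure.bind_apply hs (Kernel.aemeasurable _), Measure.bind_apply hs (Kernel.aemeasurable _),
    ← map_quantile ν, lintegral_map (Kernel.measurable_coe _ hs) (measurable_quantile ν)]
  rfl

variable (μ : ℝ → ProbabilityMeasure ℝ)

/-- The kernel of `levelChain`. -/
def chainKernel : List ℝ → Kernel ℝ ℝ
  | [] => Kernel.id
  | r :: l => chainKernel l ∘ₖ fibreKernel (μ r)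

instance instIsMarkovKernelChainKernel : (l : List ℝ) → IsMarkovKernel (chainKernel μ l)
  | [] => inferInstanceAs (IsMarkovKernel Kernel.id)
  | r :: l => by
    have := instIsMarkovKernelChainKernel l
    exact inferInstanceAs (IsMarkovKernel (chainKernel μ l ∘ₖ fibreKernel (μ r)))

theorem chainKernel_comp_lam (l : List ℝ) : chainKernel μ l ∘ₘ Λ = Λ := by
  induction l with
  | nil => exact Measure.bind_dirac
  | cons r l ih =>
    rw [chainKernel, ← Measure.comp_assoc, fibreKernel_comp_lam, ih]

/-- The recursion of the kernels, read on functions, is that of `run` without observations. -/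
theorem integral_chainKernel (h : ℝ → ℝ → ℝ) {b : ℝ → ℝ} (hb : IsUnitValued b) (l : List ℝ)
    (q : ℝ) : ∫ y, b y ∂(chainKernel μ l q) = run μ h b l ∅ q := by
  induction l generalizing q with
  | nil => simp [chainKernel, run, Kernel.id_apply]
  | cons r l ih =>
    rw [chainKernel, Kernel.integral_comp (hb.integrable _)]
    simp only [ih, run, Finset.filter_empty, Finset.prod_empty, one_mul]
    rfl

theorem quantileCoupling_lam_left (ν : ProbabilityMeasure ℝ) :
    (quantileCoupling lam ν : Measure (ℝ × ℝ)) =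
      Λ ⊗ₘ Kernel.deterministic (quantile ν) (measurable_quantile ν) := by
  rw [Measure.compProd_deterministic, quantileCoupling_toMeasure]
  refine Measure.map_congr ?_
  filter_upwards [ae_quantile_lam] with q hq
  simp [hq]

theorem quantileCoupling_lam_right (ν : ProbabilityMeasure ℝ) :
    (quantileCoupling ν lam : Measure (ℝ × ℝ)) = (ν : Measure ℝ) ⊗ₘ levelKernel ν := by
  rw [map_quantile_id, quantileCoupling_toMeasure]
  refine Measure.map_congr ?_
  filter_upwards [ae_quantile_lam] with q hq
  rw [hq]

theorem levelStep_toMeasure (ν : ProbabilityMeasure ℝ) :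
    (levelStep ν : Measure (ℝ × ℝ)) = Λ ⊗ₘ fibreKernel ν := by
  rw [levelStep, comp_toMeasure (quantileCoupling_lam_left ν) (quantileCoupling_lam_right ν)
    (by rw [Measure.deterministic_comp_eq_map, map_quantile]),
    Kernel.comp_deterministic_eq_comap]
  rfl

theorem levelChain_toMeasure (l : List ℝ) :
    (levelChain μ l : Measure (ℝ × ℝ)) = Λ ⊗ₘ chainKernel μ l := by
  induction l with
  | nil =>
    rw [chainKernel, Measure.compProd_id]
    rfl
  | cons r l ih =>
    rw [levelChain, comp_toMeasure (levelStep_toMeasure _) ih (fibreKernel_comp_lam _)]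
    rfl

theorem quantileCoupling_eq_compProd (ν ν' : ProbabilityMeasure ℝ) :
    (quantileCoupling ν ν' : Measure (ℝ × ℝ)) =
      (ν : Measure ℝ) ⊗ₘ ((levelKernel ν).map (quantile ν')) := by
  rw [Measure.compProd_map (measurable_quantile ν'), map_quantile_id, quantileCoupling_toMeasure,
    Measure.map_map (by have := measurable_quantile ν'; fun_prop) (measurable_quantile_prodMk ν)]
  rfl

/-- A quantile coupling draws a level from a value and reads the next quantile at that level.
Between two couplings, reading the value at `r` and drawing a level again is precisely `fibreKernel
(μ r)`. -/
theorem quantileChain_toMeasure (t s : ℝ) (l : List ℝ) :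
    (quantileChain μ t s l : Measure (ℝ × ℝ)) = (μ s : Measure ℝ) ⊗ₘ
      ((chainKernel μ l ∘ₖ levelKernel (μ s)).map (quantile (μ t))) := by
  induction l generalizing s with
  | nil =>
    rw [quantileChain, quantileCoupling_eq_compProd, chainKernel, Kernel.id_comp]
  | cons r l ih =>
    have m1 : IsMarkovKernel ((levelKernel (μ s)).map (quantile (μ r))) :=
      Kernel.IsMarkovKernel.map _ (measurable_quantile _)
    have m2 : IsMarkovKernel ((chainKernel μ l ∘ₖ levelKernel (μ r)).map (quantile (μ t))) :=
      Kernel.IsMarkovKernel.map _ (measurable_quantile _)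
    rw [quantileChain, comp_toMeasure (quantileCoupling_eq_compProd _ _) (ih r)]
    · congr 1
      rw [chainKernel, ← Kernel.map_comp, Kernel.comp_assoc, Kernel.comp_assoc]
      congr 2
      rw [← Kernel.deterministic_comp_eq_map (measurable_quantile (μ r)), ← Kernel.comp_assoc,
        Kernel.comp_deterministic_eq_comap]
      rfl
    · rw [← Measure.snd_compProd, ← quantileCoupling_eq_compProd, quantileCoupling_toMeasure,
        Measure.snd_map_prodMk (measurable_quantile _), map_quantile]

theorem integral_prod_compProd {m : Measure ℝ} [IsProbabilityMeasure m] {κ : Kernel ℝ ℝ}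
    [IsMarkovKernel κ] {a b : ℝ → ℝ} (ha : IsUnitValued a) (hb : IsUnitValued b) :
    ∫ z, a z.1 * b z.2 ∂(m ⊗ₘ κ) = ∫ x, a x * ∫ y, b y ∂(κ x) ∂m := by
  rw [Measure.integral_compProd
    (((ha.comp measurable_fst).mul (hb.comp measurable_snd)).integrable _)]
  simp only [integral_const_mul]

theorem real_prod_Iic (P : Measure (ℝ × ℝ)) (u v : ℝ) :
    P.real (Iic u ×ˢ Iic v) = ∫ z, (Iic u).indicator (fun _ => (1 : ℝ)) z.1 *
      (Iic v).indicator (fun _ => (1 : ℝ)) z.2 ∂P := by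
  have e : (fun z : ℝ × ℝ => (Iic u).indicator (fun _ => (1 : ℝ)) z.1 *
      (Iic v).indicator (fun _ => (1 : ℝ)) z.2) = (Iic u ×ˢ Iic v).indicator fun _ => 1 := by
    funext z
    simp only [indicator_apply, mem_prod]
    by_cases h1 : z.1 ∈ Iic u <;> by_cases h2 : z.2 ∈ Iic v <;> simp only [h1, h2] <;> norm_num
  rw [e, integral_indicator (measurableSet_Iic.prod measurableSet_Iic)]
  simp

theorem levelChain_real_Iic (F : Finset ℝ) (u v : ℝ) :
    (levelChain μ F.sort : Measure (ℝ × ℝ)).real (Iic u ×ˢ Iic v) =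
      form μ ∅ (fun _ _ => 1) ((Iic u).indicator fun _ => 1) ((Iic v).indicator fun _ => 1) F := by
  have hu : ∀ u : ℝ, IsUnitValued ((Iic u).indicator fun _ => (1 : ℝ)) := fun u =>
    IsUnitValued.indicator measurableSet_Iic
  rw [real_prod_Iic, levelChain_toMeasure, integral_prod_compProd (hu u) (hu v)]
  simp only [integral_chainKernel μ (fun _ _ => 1) (hu v)]
  rfl

theorem quantileChain_real_Iic (s t : ℝ) (F : Finset ℝ) (x y : ℝ) :
    (quantileChain μ t s F.sort : Measure (ℝ × ℝ)).real (Iic x ×ˢ Iic y) =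
      form μ ∅ (fun _ _ => 1) (fun q => (Iic x).indicator (fun _ => 1) (quantile (μ s) q))
        (fun q => (Iic y).indicator (fun _ => 1) (quantile (μ t) q)) F := by
  have hu : ∀ u : ℝ, IsUnitValued ((Iic u).indicator fun _ => (1 : ℝ)) := fun u =>
    IsUnitValued.indicator measurableSet_Iic
  have hy := (hu y).comp (measurable_quantile (μ t))
  have m2 : IsMarkovKernel
      ((chainKernel μ F.sort ∘ₖ levelKernel (μ s)).map (quantile (μ t))) :=
    Kernel.IsMarkovKernel.map _ (measurable_quantile _)
  rw [real_prod_Iic, quantileChain_toMeasure, integral_prod_compProd (hu x) (hu y)]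
  have e : ∀ z, ∫ y', (Iic y).indicator (fun _ => (1 : ℝ)) y'
      ∂((chainKernel μ F.sort ∘ₖ levelKernel (μ s)).map (quantile (μ t)) z) =
      ∫ q, run μ (fun _ _ => 1) (fun q => (Iic y).indicator (fun _ => 1) (quantile (μ t) q))
        F.sort ∅ q ∂(levelKernel (μ s) z) := by
    intro z
    rw [Kernel.map_apply _ (measurable_quantile _),
      integral_map (measurable_quantile _).aemeasurable (hu y).meas.aestronglyMeasurable,
      Kernel.integral_comp (hy.integrable _)]
    simp only [integral_chainKernel μ (fun _ _ => 1) hy]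
  simp only [e]
  have hrun : IsUnitValued (run μ (fun _ _ => 1)
      (fun q => (Iic y).indicator (fun _ => (1 : ℝ)) (quantile (μ t) q)) F.sort ∅) :=
    IsUnitValued.run (fun _ => IsUnitValued.one) hy _ _
  rw [← integral_prod_compProd (hu x) hrun, map_quantile_id,
    integral_map (measurable_quantile_prodMk _).aemeasurable
      (((hu x).comp measurable_fst).mul (hrun.comp measurable_snd)).meas.aestronglyMeasurable]
  rfl

/-! ### Path laws for finite sets of projection times -/

/-- Prepend a value to a sequence. -/
def consPath (p : ℝ × (ℕ → ℝ)) (n : ℕ) : ℝ := Nat.casesOn n p.1 p.2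

theorem measurable_consPath : Measurable consPath := by
  refine measurable_pi_lambda _ fun n => ?_
  cases n with
  | zero => exact measurable_fst
  | succ n => exact (measurable_pi_apply n).comp measurable_snd

/-- The law of the successive levels, when the level is resampled at the times of a list. -/
def pathKernel : List ℝ → Kernel ℝ (ℕ → ℝ)
  | [] => Kernel.deterministic (fun q _ => q) (measurable_pi_lambda _ fun _ => measurable_id)
  | r :: l => (Kernel.id ×ₖ (pathKernel l ∘ₖ fibreKernel (μ r))).map consPath

instance instIsMarkovKernelPathKernel : (l : List ℝ) → IsMarkovKernel (pathKernel μ l)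
  | [] => by unfold pathKernel; infer_instance
  | r :: l => by
    have := instIsMarkovKernelPathKernel l
    exact Kernel.IsMarkovKernel.map _ measurable_consPath

/-- The number of resampling times up to time `t`. -/
def timeIndex : List ℝ → ℝ → ℕ
  | [], _ => 0
  | r :: l, t => if t < r then 0 else timeIndex l t + 1

/-- Time `t` reads the path after all resamplings at times up to and including `t`, in agreement
with the convention of `run`, where an observation at `r` comes after the projection at `r`. -/
theorem integral_pathKernel {h : ℝ → ℝ → ℝ} (hh : ∀ t, IsUnitValued (h t)) (l : List ℝ)
    (S : Finset ℝ) (q : ℝ) :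
    ∫ p, ∏ t ∈ S, h t (p (timeIndex l t)) ∂(pathKernel μ l q) = run μ h (fun _ => 1) l S q := by
  have hm : ∀ (S : Finset ℝ) (n : ℝ → ℕ),
      IsUnitValued fun p : ℕ → ℝ => ∏ t ∈ S, h t (p (n t)) := fun S n =>
    IsUnitValued.prod S (h := fun t (p : ℕ → ℝ) => h t (p (n t)))
      fun t _ => (hh t).comp (measurable_pi_apply _)
  induction l generalizing S q with
  | nil =>
    rw [pathKernel, Kernel.deterministic_apply, integral_dirac' _ _
      (hm S _).meas.stronglyMeasurable]
    simp [run]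
  | cons r l ih =>
    have e : ∀ p : ℕ → ℝ, ∏ t ∈ S, h t (consPath (q, p) (timeIndex (r :: l) t)) =
        (∏ t ∈ S with t < r, h t q) * ∏ t ∈ S with r ≤ t, h t (p (timeIndex l t)) := by
      intro p
      rw [← Finset.prod_filter_mul_prod_filter_not S (· < r)]
      simp only [not_lt]
      congr 1
      · refine Finset.prod_congr rfl fun t ht => ?_
        simp [timeIndex, (Finset.mem_filter.1 ht).2, consPath]
      · refine Finset.prod_congr rfl fun t ht => ?_
        simp [timeIndex, not_lt.2 (Finset.mem_filter.1 ht).2, consPath]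
    rw [pathKernel, Kernel.map_apply _ measurable_consPath,
      integral_map measurable_consPath.aemeasurable (hm S _).meas.aestronglyMeasurable,
      Kernel.prod_apply, Kernel.id_apply, Measure.dirac_prod,
      integral_map measurable_prodMk_left.aemeasurable
        ((hm S _).comp measurable_consPath).meas.aestronglyMeasurable]
    simp only [e, integral_const_mul, run]
    rw [Kernel.integral_comp ((hm _ _).integrable _)]
    simp only [ih]
    rfl

end

/-! ### Limit laws by compactness. -/

section

/-! ### Existence of limit laws -/

/-- Families of points of the unit interval, with the Borel sigma-algebra of the product
topology. -/
def UnitPaths (ι : Type*) := ι → Icc (0 : ℝ) 1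

namespace UnitPaths

variable {ι : Type*}

instance : TopologicalSpace (UnitPaths ι) := inferInstanceAs (TopologicalSpace (ι → Icc (0 : ℝ) 1))
instance : CompactSpace (UnitPaths ι) := inferInstanceAs (CompactSpace (ι → Icc (0 : ℝ) 1))
instance : T2Space (UnitPaths ι) := inferInstanceAs (T2Space (ι → Icc (0 : ℝ) 1))
-- Borel sets are taken, rather than the product sigma-algebra, in order to have weak compactness of
-- probability measures for uncountable `ι` too.
instance : MeasurableSpace (UnitPaths ι) := borel _
instance : BorelSpace (UnitPaths ι) := ⟨rfl⟩

theorem continuous_apply (i : ι) : Continuous fun z : UnitPaths ι => ((z i : Icc (0 : ℝ) 1) : ℝ) :=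
  continuous_subtype_val.comp (_root_.continuous_apply (A := fun _ : ι => Icc (0 : ℝ) 1) i)

/-- The reindexed path, truncated to the unit interval. -/
def reindex (n : ι → ℕ) (p : ℕ → ℝ) : UnitPaths ι := fun i => projIcc 0 1 zero_le_one (p (n i))

theorem continuous_reindex (n : ι → ℕ) : Continuous (reindex n) := by
  refine continuous_pi (A := fun _ : ι => Icc (0 : ℝ) 1) fun i => ?_
  exact continuous_projIcc.comp (_root_.continuous_apply _)

end UnitPaths

theorem frontier_box_subset {ι : Type*} [Finite ι] (u : ι → ℝ) :
    frontier {z : ι → ℝ | ∀ i, z i ≤ u i} ⊆ ⋃ i, {z | z i = u i} := by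
  have hc : IsClosed {z : ι → ℝ | ∀ i, z i ≤ u i} := by
    simp only [ofPred_forall]
    exact isClosed_iInter fun i => isClosed_le (continuous_apply i) continuous_const
  have ho : IsOpen {z : ι → ℝ | ∀ i, z i < u i} := by
    simp only [ofPred_forall]
    exact isOpen_iInter_of_finite fun i => isOpen_lt (continuous_apply i) continuous_const
  intro z hz
  rw [hc.frontier_eq] at hz
  by_contra hne
  simp only [mem_iUnion, mem_ofPred_eq, not_exists] at hne
  exact hz.2 (interior_maximal (fun w hw i => (hw i).le) ho
    fun i => lt_of_le_of_ne (hz.1 i) (hne i))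

/-- Probability measures on a power of `[0, 1]` form a compact space, so a limit exists along an
ultrafilter. All one-dimensional marginals are `Λ`, which has no atoms; boundaries of boxes are
therefore null in the limit, and box probabilities pass to the limit. -/
theorem exists_limit_law {ι : Type*} (P : Finset ℝ → ProbabilityMeasure (ℕ → ℝ))
    (hP : ∀ F n, Measure.map (fun p : ℕ → ℝ => p n) (P F : Measure (ℕ → ℝ)) = Λ)
    (idx : Finset ℝ → ι → ℕ) :
    ∃ Q : ProbabilityMeasure (ι → ℝ), (∀ t, Measure.map (fun z : ι → ℝ => z t) Q = Λ) ∧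
      ∀ (S : Finset ι) (u : ι → ℝ) (c : ℝ), Tendsto (fun F => (P F : Measure (ℕ → ℝ)).real
        {p | ∀ t ∈ S, p (idx F t) ≤ u t}) atTop (𝓝 c) →
      (Q : Measure (ι → ℝ)).real {z | ∀ t ∈ S, z t ≤ u t} = c := by
  set P' : Finset ℝ → ProbabilityMeasure (UnitPaths ι) := fun F =>
    (P F).map (UnitPaths.continuous_reindex (idx F)).measurable.aemeasurable with hP'
  -- The limit may depend on the ultrafilter, but its box probabilities agree with those limits that
  -- exist along `atTop`.
  set 𝒰 : Ultrafilter (Finset ℝ) := Ultrafilter.of atTop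
  have h𝒰 : (𝒰 : Filter (Finset ℝ)) ≤ atTop := Ultrafilter.of_le atTop
  obtain ⟨Q, -, hQ⟩ := isCompact_univ.ultrafilter_le_nhds (𝒰.map P')
    (by simp)
  have hQ' : Tendsto P' 𝒰 (𝓝 Q) := hQ
  have hval : Measurable fun (z : UnitPaths ι) (i : ι) => ((z i : Icc (0 : ℝ) 1) : ℝ) :=
    measurable_pi_lambda _ fun i => (UnitPaths.continuous_apply i).measurable
  -- Paths lie almost surely in the unit interval, so the truncation in `reindex` does not change
  -- them.
  have hae : ∀ F, ∀ᵐ p ∂(P F : Measure (ℕ → ℝ)), ∀ n, p n ∈ Icc (0 : ℝ) 1 := by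
    intro F
    rw [ae_all_iff]
    intro n
    have h0 : ∀ᵐ q ∂Measure.map (fun p : ℕ → ℝ => p n) (P F : Measure (ℕ → ℝ)),
        q ∈ Icc (0 : ℝ) 1 := by
      rw [hP]
      filter_upwards [ae_lam_mem_Ioo] with q hq using Ioo_subset_Icc_self hq
    exact ae_of_ae_map (measurable_pi_apply n).aemeasurable h0
  have hmarg : ∀ F t, Measure.map (fun z : UnitPaths ι => ((z t : Icc (0 : ℝ) 1) : ℝ)) (P' F) =
      Λ := by
    intro F t
    rw [hP', ProbabilityMeasure.toMeasure_map, Measure.map_map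
      (UnitPaths.continuous_apply t).measurable (UnitPaths.continuous_reindex _).measurable,
      ← hP F (idx F t)]
    refine Measure.map_congr ?_
    filter_upwards [hae F] with p hp
    simp only [Function.comp, UnitPaths.reindex, projIcc_of_mem _ (hp _)]
  have hmargQ : ∀ t, Measure.map (fun z : UnitPaths ι => ((z t : Icc (0 : ℝ) 1) : ℝ)) Q = Λ := by
    intro t
    have h1 := ProbabilityMeasure.tendsto_map_of_tendsto_of_continuous P' Q hQ'
      (UnitPaths.continuous_apply t)
    have h2 : ∀ F, (P' F).map (UnitPaths.continuous_apply t).measurable.aemeasurable = lam :=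
      fun F => Subtype.ext (hmarg F t)
    simp only [h2] at h1
    have h3 := tendsto_nhds_unique tendsto_const_nhds h1
    exact (congrArg (fun R : ProbabilityMeasure ℝ => (R : Measure ℝ)) h3).symm
  refine ⟨Q.map hval.aemeasurable, fun t => ?_, fun S u c hc => ?_⟩
  · rw [ProbabilityMeasure.toMeasure_map, Measure.map_map (measurable_pi_apply t) hval]
    exact hmargQ t
  have hg : Continuous fun (z : UnitPaths ι) (i : S) => ((z i : Icc (0 : ℝ) 1) : ℝ) :=
    continuous_pi fun i => UnitPaths.continuous_apply (i : ι)
  have h1 := ProbabilityMeasure.tendsto_map_of_tendsto_of_continuous P' Q hQ' hg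
  have hbox : MeasurableSet {z : S → ℝ | ∀ i, z i ≤ u i} := by
    simp only [ofPred_forall]
    exact MeasurableSet.iInter fun i => measurableSet_le (measurable_pi_apply i) measurable_const
  have h2 := ProbabilityMeasure.tendsto_measure_of_null_frontier_of_tendsto' h1
    (E := {z : S → ℝ | ∀ i, z i ≤ u i}) (by
      refine measure_mono_null (frontier_box_subset fun i : S => u i) (measure_iUnion_null fun i => ?_)
      rw [ProbabilityMeasure.toMeasure_map, Measure.map_apply hg.measurable
        (measurableSet_eq_fun (measurable_pi_apply i) measurable_const)]
      have h3 : Measure.map (fun z : UnitPaths ι => ((z i : Icc (0 : ℝ) 1) : ℝ)) Q {u i} = 0 := by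
        rw [hmargQ]; exact measure_singleton _
      rwa [Measure.map_apply (UnitPaths.continuous_apply _).measurable
        (measurableSet_singleton _)] at h3)
  have h4 : ∀ F, ((P' F).map hg.measurable.aemeasurable : Measure (S → ℝ))
      {z : S → ℝ | ∀ i, z i ≤ u i} = (P F : Measure (ℕ → ℝ)) {p | ∀ t ∈ S, p (idx F t) ≤ u t} := by
    intro F
    rw [ProbabilityMeasure.toMeasure_map, Measure.map_apply hg.measurable hbox, hP',
      ProbabilityMeasure.toMeasure_map, Measure.map_apply
      (UnitPaths.continuous_reindex _).measurable (hg.measurable hbox)]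
    refine measure_congr ?_
    filter_upwards [hae F] with p hp
    refine propext ?_
    change (∀ i : S, ((UnitPaths.reindex (idx F) p (i : ι) : Icc (0 : ℝ) 1) : ℝ) ≤ u i) ↔
      ∀ t ∈ S, p (idx F t) ≤ u t
    simp only [UnitPaths.reindex, projIcc_of_mem _ (hp _), Subtype.forall]
  simp only [h4] at h2
  have h5 := (ENNReal.tendsto_toReal (measure_ne_top _ _)).comp h2
  refine (tendsto_nhds_unique (hc.mono_left h𝒰) h5).symm ▸ ?_
  rw [measureReal_def, ProbabilityMeasure.toMeasure_map, ProbabilityMeasure.toMeasure_map,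
    Measure.map_apply hg.measurable hbox, Measure.map_apply hval]
  · congr 2
    ext z
    simp
  · have : {z : ι → ℝ | ∀ t ∈ S, z t ≤ u t} = ⋂ t ∈ S, {z | z t ≤ u t} := by ext; simp
    rw [this]
    exact Finset.measurableSet_biInter _ fun t _ =>
      measurableSet_le (measurable_pi_apply t) measurable_const

end

/-! ### The plans `level` as infima of distribution functions. -/

section

/-! ### The lower orthant order through distribution functions -/

theorem toMeasure_ext_Iic {P Q : ProbabilityMeasure (ℝ × ℝ)}
    (h : ∀ x y, (P : Measure (ℝ × ℝ)) (Iic x ×ˢ Iic y) = (Q : Measure (ℝ × ℝ)) (Iic x ×ˢ Iic y)) :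
    P = Q := by
  have hg : MeasurableSpace.generateFrom (image2 (· ×ˢ ·) (range (Iic : ℝ → Set ℝ)) (range (Iic : ℝ → Set ℝ))) =
      (inferInstance : MeasurableSpace (ℝ × ℝ)) := by
    refine generateFrom_eq_prod (borel_eq_generateFrom_Iic ℝ).symm
      (borel_eq_generateFrom_Iic ℝ).symm ?_ ?_ <;>
    exact ⟨fun n => Iic (n : ℝ), fun n => mem_range_self _, eq_univ_of_forall fun x => mem_iUnion.2 (exists_nat_ge x)⟩
  refine Subtype.ext (show (P : Measure (ℝ × ℝ)) = Q from ext_of_generate_finite _ hg.symm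
    (isPiSystem_Iic.prod isPiSystem_Iic) ?_ (by simp))
  rintro _ ⟨_, ⟨x, rfl⟩, _, ⟨y, rfl⟩, rfl⟩
  exact h x y

/-- The order reverses distribution functions: if their pointwise infimum is itself the distribution
function of a law, that law is the supremum. -/
theorem isLoSup_of_real {𝒮 : Set (ProbabilityMeasure (ℝ × ℝ))} {P : ProbabilityMeasure (ℝ × ℝ)}
    (h₁ : ∀ A ∈ 𝒮, ∀ x y, (P : Measure (ℝ × ℝ)).real (Iic x ×ˢ Iic y) ≤
      (A : Measure (ℝ × ℝ)).real (Iic x ×ˢ Iic y))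
    (h₂ : ∀ x y c, (∀ A ∈ 𝒮, c ≤ (A : Measure (ℝ × ℝ)).real (Iic x ×ˢ Iic y)) →
      c ≤ (P : Measure (ℝ × ℝ)).real (Iic x ×ˢ Iic y)) : IsLoSup 𝒮 P := by
  refine ⟨fun A hA x y => ?_, fun Q hQ x y => ?_⟩
  · exact (ENNReal.toReal_le_toReal (measure_ne_top _ _) (measure_ne_top _ _)).1 (h₁ A hA x y)
  · exact (ENNReal.toReal_le_toReal (measure_ne_top _ _) (measure_ne_top _ _)).1
      (h₂ x y _ fun A hA => ENNReal.toReal_mono (measure_ne_top _ _) (hQ A hA x y))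

theorem IsLoSup.unique {𝒮 : Set (ProbabilityMeasure (ℝ × ℝ))} {P Q : ProbabilityMeasure (ℝ × ℝ)}
    (hP : IsLoSup 𝒮 P) (hQ : IsLoSup 𝒮 Q) : P = Q :=
  toMeasure_ext_Iic fun x y => le_antisymm (hQ.2 P hP.1 x y) (hP.2 Q hQ.1 x y)

/-! ### The plans `level` -/

variable (μ : ℝ → ProbabilityMeasure ℝ)

/-- A pointwise infimum of distribution functions need not be one. Here it is a limit along a
directed family of plans with marginals `Λ`, so compactness provides the law. -/
theorem exists_real_eq_limForm (R : Set ℝ) : ∃ P : ProbabilityMeasure (ℝ × ℝ), ∀ u v,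
    (P : Measure (ℝ × ℝ)).real (Iic u ×ˢ Iic v) = limForm μ ∅ (fun _ _ => 1)
      ((Iic u).indicator fun _ => 1) ((Iic v).indicator fun _ => 1) R := by
  -- A pair is encoded as a path with the first component at `0` and the second at all other
  -- indices; this puts it in the scope of `exists_limit_law`.
  have hm : Measurable fun (z : ℝ × ℝ) (n : ℕ) => if n = 0 then z.1 else z.2 :=
    measurable_pi_lambda _ fun n => by
      by_cases hn : n = 0
      · simpa [hn] using measurable_fst
      · simpa [hn] using measurable_snd
  obtain ⟨Q, -, hQ⟩ := exists_limit_law (ι := Bool)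
    (fun F => (levelChain μ ((restr R F).sort (· ≤ ·))).map hm.aemeasurable)
    (fun F n => by
      rw [ProbabilityMeasure.toMeasure_map, Measure.map_map (measurable_pi_apply n) hm,
        levelChain_toMeasure]
      by_cases hn : n = 0
      · have : ((fun p : ℕ → ℝ => p n) ∘ fun (z : ℝ × ℝ) (n : ℕ) => if n = 0 then z.1 else z.2) =
            Prod.fst := by funext z; simp [hn]
        rw [this]
        exact Measure.fst_compProd _ _
      · have : ((fun p : ℕ → ℝ => p n) ∘ fun (z : ℝ × ℝ) (n : ℕ) => if n = 0 then z.1 else z.2) =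
            Prod.snd := by funext z; simp [hn]
        rw [this]
        exact (Measure.snd_compProd _ _).trans (chainKernel_comp_lam _ _))
    (fun _ i => if i then 1 else 0)
  have hm' : Measurable fun z : Bool → ℝ => (z false, z true) := by fun_prop
  refine ⟨Q.map hm'.aemeasurable, fun u v => ?_⟩
  have hbox : MeasurableSet (Iic u ×ˢ Iic v) := measurableSet_Iic.prod measurableSet_Iic
  rw [measureReal_def, ProbabilityMeasure.toMeasure_map, Measure.map_apply hm' hbox,
    ← measureReal_def]
  have := hQ Finset.univ (fun i => if i then v else u) (limForm μ ∅ (fun _ _ => 1)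
      ((Iic u).indicator fun _ => 1) ((Iic v).indicator fun _ => 1) R) (by
    refine (tendsto_form (fun _ => IsDecreasing.one) (IsDecreasing.indicator_Iic u)
      (IsDecreasing.indicator_Iic v) ∅ R).congr fun F => ?_
    rw [← levelChain_real_Iic, measureReal_def, measureReal_def,
      ProbabilityMeasure.toMeasure_map, Measure.map_apply hm]
    · congr 2
      ext z
      simp [Prod.le_def]
    · have : {z : ℕ → ℝ | ∀ t ∈ (Finset.univ : Finset Bool), z (if t then 1 else 0) ≤
          if t then v else u} = {z | z 0 ≤ u} ∩ {z | z 1 ≤ v} := by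
        ext z; simp
      rw [this]
      exact (measurableSet_le (measurable_pi_apply 0) measurable_const).inter
        (measurableSet_le (measurable_pi_apply 1) measurable_const))
  rw [← this]
  congr 1
  ext z
  simp

theorem isLoSup_levelFamily {R : Set ℝ} {P : ProbabilityMeasure (ℝ × ℝ)}
    (hP : ∀ u v, (P : Measure (ℝ × ℝ)).real (Iic u ×ˢ Iic v) = limForm μ ∅ (fun _ _ => 1)
      ((Iic u).indicator fun _ => 1) ((Iic v).indicator fun _ => 1) R) :
    IsLoSup (levelFamily μ R) P := by
  have hu : ∀ u : ℝ, IsUnitValued ((Iic u).indicator fun _ => (1 : ℝ)) := fun u =>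
    IsUnitValued.indicator measurableSet_Iic
  refine isLoSup_of_real ?_ fun u v c hc => ?_
  · rintro _ ⟨F, hF, rfl⟩ u v
    rw [hP, levelChain_real_Iic]
    exact limForm_le (fun _ => IsUnitValued.one) (hu u) (hu v) ∅ hF
  · rw [hP]
    refine le_limForm fun F hF => ?_
    rw [← levelChain_real_Iic]
    exact hc _ ⟨F, hF, rfl⟩

theorem existsUnique_isLoSup_levelFamily (R : Set ℝ) : ∃! P, IsLoSup (levelFamily μ R) P := by
  obtain ⟨P, hP⟩ := exists_real_eq_limForm μ R
  exact ⟨P, isLoSup_levelFamily μ hP, fun Q hQ => hQ.unique (isLoSup_levelFamily μ hP)⟩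

theorem level_real (R : Set ℝ) (u v : ℝ) :
    (level μ R : Measure (ℝ × ℝ)).real (Iic u ×ˢ Iic v) = limForm μ ∅ (fun _ _ => 1)
      ((Iic u).indicator fun _ => 1) ((Iic v).indicator fun _ => 1) R := by
  obtain ⟨P, hP⟩ := exists_real_eq_limForm μ R
  have h : IsLoSup (levelFamily μ R) P := isLoSup_levelFamily μ hP
  have h' : IsLoSup (levelFamily μ R) (level μ R) := Classical.epsilon_spec ⟨P, h⟩
  rw [h'.unique h, hP]

variable {μ}

/-- Equality of plans concerns indicators only; its extension to all decreasing functions is what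
makes it equivalent to two comparisons of forms. -/
theorem LevelLE.antisymm_iff {A B : Set ℝ} :
    level μ A = level μ B ↔ LevelLE μ A B ∧ LevelLE μ B A := by
  constructor
  · intro h
    have key : ∀ a x, IsDecreasing a → IsDecreasing x →
        limForm μ ∅ (fun _ _ => 1) a x A = limForm μ ∅ (fun _ _ => 1) a x B := fun a x ha hx =>
      limForm_eq_of_indicator (fun u v => by rw [← level_real, ← level_real, h]) ha hx
    exact ⟨fun a x ha hx => (key a x ha hx).le, fun a x ha hx => (key a x ha hx).ge⟩
  · rintro ⟨h₁, h₂⟩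
    refine toMeasure_ext_Iic fun u v => ?_
    rw [← ENNReal.toReal_eq_toReal_iff' (measure_ne_top _ _) (measure_ne_top _ _)]
    refine (level_real μ A u v).trans (Eq.trans ?_ (level_real μ B u v).symm)
    exact le_antisymm (h₁ _ _ (IsDecreasing.indicator_Iic u) (IsDecreasing.indicator_Iic v))
      (h₂ _ _ (IsDecreasing.indicator_Iic u) (IsDecreasing.indicator_Iic v))

theorem level_eq_iff_of_subset {A B : Set ℝ} (hAB : A ⊆ B) :
    level μ A = level μ B ↔ LevelLE μ A B :=
  LevelLE.antisymm_iff.trans ⟨fun h => h.1, fun h => ⟨h, LevelLE.of_superset hAB⟩⟩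

end

/-! ### Limit laws of processes on the whole time axis. -/

section

/-! ### Laws of processes through their distribution functions -/

theorem measurableSet_forall_le {Ω ι : Type*} [MeasurableSpace Ω] {f : ι → Ω → ℝ}
    (hf : ∀ i, Measurable (f i)) (S : Finset ι) (u : ι → ℝ) :
    MeasurableSet {ω | ∀ t ∈ S, f t ω ≤ u t} := by
  have : {ω | ∀ t ∈ S, f t ω ≤ u t} = ⋂ t ∈ S, {ω | f t ω ≤ u t} := by ext; simp
  rw [this]
  exact Finset.measurableSet_biInter _ fun t _ => measurableSet_le (hf t) measurable_const

theorem prod_indicator_Iic {Ω ι : Type*} (f : ι → Ω → ℝ) (S : Finset ι) (u : ι → ℝ) (ω : Ω) :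
    ∏ t ∈ S, (Iic (u t)).indicator (fun _ => (1 : ℝ)) (f t ω) =
      {ω | ∀ t ∈ S, f t ω ≤ u t}.indicator (fun _ => 1) ω := by
  by_cases h : ∀ t ∈ S, f t ω ≤ u t
  · rw [indicator_of_mem (s := {ω | ∀ t ∈ S, f t ω ≤ u t}) h]
    exact Finset.prod_eq_one fun t ht => indicator_of_mem (mem_Iic.2 (h t ht)) _
  · rw [indicator_of_notMem (s := {ω | ∀ t ∈ S, f t ω ≤ u t}) h]
    push Not at h
    obtain ⟨t, ht, h⟩ := h
    exact Finset.prod_eq_zero ht (indicator_of_notMem (by simpa using h) _)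

theorem real_forall_le {Ω ι : Type*} [MeasurableSpace Ω] {P : Measure Ω} {f : ι → Ω → ℝ}
    (hf : ∀ i, Measurable (f i)) (S : Finset ι) (u : ι → ℝ) :
    P.real {ω | ∀ t ∈ S, f t ω ≤ u t} =
      ∫ ω, ∏ t ∈ S, (Iic (u t)).indicator (fun _ => (1 : ℝ)) (f t ω) ∂P := by
  simp only [prod_indicator_Iic]
  rw [integral_indicator (measurableSet_forall_le hf S u)]
  simp

/-- The sets `{z | ∀ i, z i ≤ x i}`. -/
def boxes (ι : Type*) : Set (Set (ι → ℝ)) := pi univ '' pi univ fun _ => range Iic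

theorem isCountablySpanning_range_Iic : IsCountablySpanning (range (Iic : ℝ → Set ℝ)) :=
  ⟨fun n => Iic (n : ℝ), fun _ => mem_range_self _,
    eq_univ_of_forall fun x => mem_iUnion.2 (exists_nat_ge x)⟩

theorem isPiSystem_boxes {ι : Type*} : IsPiSystem (boxes ι) := IsPiSystem.pi fun _ => isPiSystem_Iic

section Boxes

variable {ι : Type*} [Finite ι]

theorem generateFrom_boxes : MeasurableSpace.generateFrom (boxes ι) = MeasurableSpace.pi :=
  generateFrom_eq_pi (fun _ => (borel_eq_generateFrom_Iic ℝ).symm)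
    fun _ => isCountablySpanning_range_Iic

theorem isCountablySpanning_boxes : IsCountablySpanning (boxes ι) :=
  IsCountablySpanning.pi fun _ => isCountablySpanning_range_Iic

end Boxes

theorem exists_eq_of_mem_boxes {ι : Type*} {s : Set (ι → ℝ)} (hs : s ∈ boxes ι) :
    ∃ u : ι → ℝ, s = {z | ∀ i, z i ≤ u i} := by
  obtain ⟨f, hf, rfl⟩ := hs
  choose u hu using fun i => hf i (mem_univ i)
  exact ⟨u, by ext z; simp [← hu]⟩

theorem ext_of_boxes {ι : Type*} [Finite ι] {P Q : ProbabilityMeasure (ι → ℝ)}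
    (h : ∀ u : ι → ℝ, (P : Measure (ι → ℝ)) {z | ∀ i, z i ≤ u i} =
      (Q : Measure (ι → ℝ)) {z | ∀ i, z i ≤ u i}) : P = Q := by
  refine Subtype.ext (show (P : Measure (ι → ℝ)) = Q from
    ext_of_generate_finite _ generateFrom_boxes.symm isPiSystem_boxes (fun s hs => ?_) (by simp))
  obtain ⟨u, rfl⟩ := exists_eq_of_mem_boxes hs
  exact h u

theorem ext_of_boxes_prod {ι κ : Type*} [Finite ι] [Finite κ]
    {P Q : ProbabilityMeasure ((ι → ℝ) × ℝ × (κ → ℝ))}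
    (h : ∀ (u : ι → ℝ) (y : ℝ) (v : κ → ℝ),
      (P : Measure ((ι → ℝ) × ℝ × (κ → ℝ)))
        ({z | ∀ i, z i ≤ u i} ×ˢ Iic y ×ˢ {z | ∀ i, z i ≤ v i}) =
      (Q : Measure ((ι → ℝ) × ℝ × (κ → ℝ)))
        ({z | ∀ i, z i ≤ u i} ×ˢ Iic y ×ˢ {z | ∀ i, z i ≤ v i})) : P = Q := by
  have g₁ := generateFrom_eq_prod (borel_eq_generateFrom_Iic ℝ).symm (generateFrom_boxes (ι := κ))
    isCountablySpanning_range_Iic isCountablySpanning_boxes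
  have g₂ := generateFrom_eq_prod (generateFrom_boxes (ι := ι)) g₁ isCountablySpanning_boxes
    (isCountablySpanning_range_Iic.prod isCountablySpanning_boxes)
  refine Subtype.ext (show (P : Measure ((ι → ℝ) × ℝ × (κ → ℝ))) = Q from
    ext_of_generate_finite _ g₂.symm
      (isPiSystem_boxes.prod (isPiSystem_Iic.prod isPiSystem_boxes)) ?_ (by simp))
  rintro _ ⟨s, hs, _, ⟨_, ⟨y, rfl⟩, t, ht, rfl⟩, rfl⟩
  obtain ⟨u, rfl⟩ := exists_eq_of_mem_boxes hs
  obtain ⟨v, rfl⟩ := exists_eq_of_mem_boxes ht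
  exact h u y v

theorem margFin_toMeasure (P : ProbabilityMeasure (ℝ → ℝ)) (S : Finset ℝ) :
    (margFin P S : Measure (S → ℝ)) = Measure.map S.restrict (P : Measure (ℝ → ℝ)) := rfl

theorem margFin_box (P : ProbabilityMeasure (ℝ → ℝ)) (S : Finset ℝ) (u : S → ℝ) (x : ℝ → ℝ)
    (hx : ∀ t : S, x t = u t) : (margFin P S : Measure (S → ℝ)) {z | ∀ i, z i ≤ u i} =
      (P : Measure (ℝ → ℝ)) {z | ∀ t ∈ S, z t ≤ x t} := by
  have hm : Measurable (S.restrict : (ℝ → ℝ) → S → ℝ) := by fun_prop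
  have hb : MeasurableSet {z : S → ℝ | ∀ i, z i ≤ u i} := by
    simpa using measurableSet_forall_le (fun i : S => measurable_pi_apply i) Finset.univ u
  rw [margFin_toMeasure, Measure.map_apply hm hb]
  congr 1
  ext z
  change (∀ i : S, z i ≤ u i) ↔ ∀ t ∈ S, z t ≤ x t
  simp only [← hx, Subtype.forall]

theorem margFin_ext {P Q : ProbabilityMeasure (ℝ → ℝ)} {S : Finset ℝ}
    (h : ∀ x : ℝ → ℝ, (P : Measure (ℝ → ℝ)).real {z | ∀ t ∈ S, z t ≤ x t} =
      (Q : Measure (ℝ → ℝ)).real {z | ∀ t ∈ S, z t ≤ x t}) : margFin P S = margFin Q S := by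
  refine ext_of_boxes fun u => ?_
  have hx : ∀ t : S, (fun t : ℝ => if ht : t ∈ S then u ⟨t, ht⟩ else 0) t = u t := fun t => by
    simp
  rw [margFin_box P S u (fun t : ℝ => if ht : t ∈ S then u ⟨t, ht⟩ else 0) hx,
    margFin_box Q S u (fun t : ℝ => if ht : t ∈ S then u ⟨t, ht⟩ else 0) hx]
  exact (ENNReal.toReal_eq_toReal_iff' (measure_ne_top _ _) (measure_ne_top _ _)).1 (h _)

theorem ext_of_margFin {P Q : ProbabilityMeasure (ℝ → ℝ)} (h : ∀ S, margFin P S = margFin Q S) :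
    P = Q :=
  Subtype.ext (IsProjectiveLimit.unique (P := fun S => Measure.map S.restrict (Q : Measure (ℝ → ℝ)))
    (fun S => congrArg (fun P : ProbabilityMeasure (S → ℝ) => (P : Measure (S → ℝ))) (h S))
    fun _ => rfl)

/-! ### Limits of the laws of processes projected at finitely many times -/

variable (μ : ℝ → ProbabilityMeasure ℝ)

/-- The observation that the value at time `t` is at most `x t`. -/
def boxObs (x : ℝ → ℝ) (t q : ℝ) : ℝ := (Iic (x t)).indicator (fun _ => 1) (quantile (μ t) q)

theorem isDecreasing_indicator_quantile (ν : ProbabilityMeasure ℝ) (y : ℝ) :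
    IsDecreasing fun q => (Iic y).indicator (fun _ => 1) (quantile ν q) :=
  IsDecreasing.comp_quantile (fun a b hab => by
    by_cases hb : b ∈ Iic y
    · rw [indicator_of_mem hb, indicator_of_mem (mem_Iic.2 (hab.trans hb))]
    · rw [indicator_of_notMem hb]; exact indicator_nonneg (fun _ _ => zero_le_one) _)
    (IsUnitValued.indicator measurableSet_Iic).nonneg
    (IsUnitValued.indicator measurableSet_Iic).le_one ν

theorem isDecreasing_boxObs (x : ℝ → ℝ) (t : ℝ) : IsDecreasing (boxObs μ x t) :=
  isDecreasing_indicator_quantile (μ t) (x t)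

theorem IsUnitValued.integral_comp {α β : Type*} [MeasurableSpace α] [MeasurableSpace β]
    {b : β → ℝ} (hb : IsUnitValued b) (m : Measure α) [IsFiniteMeasure m] (κ : Kernel α β)
    [IsMarkovKernel κ] : ∫ y, b y ∂(κ ∘ₘ m) = ∫ x, ∫ y, b y ∂(κ x) ∂m := by
  rw [← Measure.snd_compProd, Measure.snd,
    integral_map measurable_snd.aemeasurable hb.meas.aestronglyMeasurable,
    Measure.integral_compProd ((hb.comp measurable_snd).integrable _)]

/-- The law on paths in discrete time of the successive levels. -/
def pathLaw (l : List ℝ) : ProbabilityMeasure (ℕ → ℝ) :=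
  ⟨pathKernel μ l ∘ₘ Λ, inferInstance⟩

theorem pathLaw_toMeasure (l : List ℝ) :
    (pathLaw μ l : Measure (ℕ → ℝ)) = pathKernel μ l ∘ₘ Λ := rfl

theorem map_pathLaw (l : List ℝ) (n : ℕ) :
    Measure.map (fun p : ℕ → ℝ => p n) (pathLaw μ l : Measure (ℕ → ℝ)) = Λ := by
  rw [pathLaw_toMeasure]
  induction l generalizing n with
  | nil =>
    rw [pathKernel, Measure.deterministic_comp_eq_map, Measure.map_map (measurable_pi_apply n)
      (measurable_pi_lambda (fun (q : ℝ) (_ : ℕ) => q) fun _ => measurable_id)]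
    exact Measure.map_id
  | cons r l ih =>
    rw [Measure.map_comp _ _ (measurable_pi_apply n), pathKernel,
      ← Kernel.map_comp_right _ measurable_consPath (measurable_pi_apply n)]
    cases n with
    | zero =>
      have : (fun p : ℕ → ℝ => p 0) ∘ consPath = Prod.fst := rfl
      rw [this, ← Kernel.fst_eq, Kernel.fst_prod, Measure.id_comp]
    | succ n =>
      have : (fun p : ℕ → ℝ => p (n + 1)) ∘ consPath = (fun p => p n) ∘ Prod.snd := rfl
      rw [this, Kernel.map_comp_right _ measurable_snd (measurable_pi_apply n), ← Kernel.snd_eq,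
        Kernel.snd_prod, ← Measure.map_comp _ _ (measurable_pi_apply n), ← Measure.comp_assoc,
        fibreKernel_comp_lam, ih]

theorem pathLaw_real (F S : Finset ℝ) (u : ℝ → ℝ) :
    (pathLaw μ F.sort : Measure (ℕ → ℝ)).real {p | ∀ t ∈ S, p (timeIndex F.sort t) ≤ u t} =
      form μ S (fun t => (Iic (u t)).indicator fun _ => 1) (fun _ => 1) (fun _ => 1) F := by
  have hi : ∀ t, IsUnitValued ((Iic (u t)).indicator fun _ => (1 : ℝ)) := fun t =>
    IsUnitValued.indicator measurableSet_Iic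
  have h0 := real_forall_le (P := (pathLaw μ F.sort : Measure (ℕ → ℝ)))
    (f := fun t (p : ℕ → ℝ) => p (timeIndex F.sort t)) (fun t => measurable_pi_apply _) S u
  rw [h0, pathLaw_toMeasure]
  rw [(IsUnitValued.prod S (h := fun t (p : ℕ → ℝ) => (Iic (u t)).indicator (fun _ => (1 : ℝ))
      (p (timeIndex (F.sort (· ≤ ·)) t))) fun t _ => (hi t).comp (measurable_pi_apply _)).integral_comp]
  simp only [integral_pathKernel μ hi, form, one_mul]

/-- `P` is the law of the process made Markov at the points of `R`, in the sense of a limit along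
the finite subsets of `R`. -/
structure IsLimitLaw (R : Set ℝ) (P : ProbabilityMeasure (ℝ → ℝ)) : Prop where
  marg : ∀ t, Measure.map (fun z : ℝ → ℝ => z t) (P : Measure (ℝ → ℝ)) = μ t
  box : ∀ (S : Finset ℝ) (x : ℝ → ℝ), (P : Measure (ℝ → ℝ)).real {z | ∀ t ∈ S, z t ≤ x t} =
    limForm μ S (boxObs μ x) (fun _ => 1) (fun _ => 1) R

/-- A limit of the processes of levels is pushed forward by the quantile functions. Convergence of
boxes is obtained on levels, where marginals have no atoms; the laws `μ t` themselves may have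
atoms. -/
theorem exists_isLimitLaw (R : Set ℝ) : ∃ P, IsLimitLaw μ R P := by
  obtain ⟨Q, hQ, hQ'⟩ := exists_limit_law (ι := ℝ)
    (fun F => pathLaw μ ((restr R F).sort (· ≤ ·))) (fun F n => map_pathLaw μ _ n)
    (fun F t => timeIndex ((restr R F).sort (· ≤ ·)) t)
  have hm : Measurable fun (z : ℝ → ℝ) (t : ℝ) => quantile (μ t) (z t) :=
    measurable_pi_lambda _ fun t => (measurable_quantile (μ t)).comp (measurable_pi_apply t)
  refine ⟨Q.map hm.aemeasurable, fun t => ?_, fun S x => ?_⟩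
  · rw [ProbabilityMeasure.toMeasure_map, Measure.map_map (measurable_pi_apply t) hm,
      ← map_quantile (μ t), ← hQ t, Measure.map_map (measurable_quantile (μ t))
        (measurable_pi_apply t)]
    rfl
  · have h1 := hQ' S (fun t => cdf (μ t : Measure ℝ) (x t)) _ (by
      simp only [pathLaw_real]
      exact tendsto_form (μ := μ) (fun t => IsDecreasing.indicator_Iic _) IsDecreasing.one
        IsDecreasing.one S R)
    -- By the Galois connection a threshold `x t` for the value is the threshold `cdf (μ t) (x t)`
    -- for the level.
    have h2 : limForm μ S (boxObs μ x) (fun _ => 1) (fun _ => 1) R =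
        limForm μ S (fun t => (Iic (cdf (μ t : Measure ℝ) (x t))).indicator fun _ => 1)
          (fun _ => 1) (fun _ => 1) R := by
      refine limForm_congr_ae (fun t _ => ?_) (Eventually.of_forall fun _ => rfl)
        (Eventually.of_forall fun _ => rfl) R
      filter_upwards [ae_quantile_le_iff (μ t) (x t)] with q hq
      simp only [boxObs, indicator, mem_Iic, hq]
    rw [h2, ← h1, measureReal_def, measureReal_def, ProbabilityMeasure.toMeasure_map,
      Measure.map_apply hm (measurableSet_forall_le measurable_pi_apply S x)]
    congr 1
    refine measure_congr ?_
    have h3 : ∀ᵐ z ∂(Q : Measure (ℝ → ℝ)), ∀ t ∈ S, quantile (μ t) (z t) ≤ x t ↔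
        z t ≤ cdf (μ t : Measure ℝ) (x t) := by
      refine (ae_ball_iff S.countable_toSet).2 fun t _ => ?_
      have := ae_quantile_le_iff (μ t) (x t)
      rw [← hQ t] at this
      filter_upwards [ae_of_ae_map (measurable_pi_apply t).aemeasurable this] with z hz using hz
    filter_upwards [h3] with z hz
    exact propext (forall₂_congr fun t ht => hz t ht)

end

/-! ### Separating the past and the future at a projection time. -/

section

/-! ### Splitting at a time of projection -/

variable {μ : ℝ → ProbabilityMeasure ℝ} {h : ℝ → ℝ → ℝ} {a x : ℝ → ℝ} {S T : Finset ℝ} {r : ℝ}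

theorem run_congr {h' : ℝ → ℝ → ℝ} (l : List ℝ) (S : Finset ℝ) (hh : ∀ t ∈ S, h t = h' t) :
    run μ h x l S = run μ h' x l S := by
  induction l generalizing S with
  | nil =>
    funext q
    simp only [run, Finset.prod_congr rfl fun t ht => congrFun (hh t ht) q]
  | cons r l ih =>
    funext q
    simp only [run, ih _ fun t ht => hh t (Finset.mem_filter.1 ht).1]
    rw [Finset.prod_congr rfl fun t ht => congrFun (hh t (Finset.mem_filter.1 ht).1) q]

theorem run_empty_one (l : List ℝ) : run μ h (fun _ => 1) l ∅ = fun _ => 1 := by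
  induction l with
  | nil => simp [run]
  | cons r l ih => simp [run, ih, proj_one]

theorem form_empty_one_left (hx : IsUnitValued x) (F : Finset ℝ) :
    form μ ∅ h (fun _ => 1) x F = ∫ q, x q ∂Λ := by
  simp only [form, one_mul]
  rw [run_empty_congr fun _ _ => 1]
  generalize F.sort (· ≤ ·) = l
  induction l with
  | nil => simp [run]
  | cons r l ih =>
    simp only [run, Finset.filter_empty, Finset.prod_empty, one_mul]
    rw [integral_proj _ (IsUnitValued.run (fun _ => IsUnitValued.one) hx _ _), ih]

theorem boxObs_update_of_ne (x : ℝ → ℝ) (y : ℝ) {t : ℝ} (ht : t ≠ r) :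
    boxObs μ (Function.update x r y) t = boxObs μ x t := by
  funext q; simp [boxObs, Function.update_of_ne ht]

/-- The past enters through the adjoint `w`, the future through its projection at `r`; the
observation at `r` is constant on fibres and leaves the projection. -/
theorem form_boxObs_split {v : ℝ → ℝ} {F₁ F₂ : Finset ℝ} (hS : ∀ s ∈ S, s < r)
    (hT : ∀ t ∈ T, r < t) (h₁ : ∀ s ∈ F₁, s < r) (h₂ : ∀ t ∈ F₂, r < t) (hx : IsUnitValued x)
    {w : ℝ → ℝ} (hw : ∀ b, IsUnitValued b →
      form μ S (boxObs μ v) a b F₁ = ∫ q, w q * b q ∂Λ) :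
    form μ (S ∪ ({r} ∪ T)) (boxObs μ v) a x (F₁ ∪ ({r} ∪ F₂)) =
      ∫ q, w q * (boxObs μ v r q * proj (μ r) (run μ (boxObs μ v) x F₂.sort T) q) ∂Λ := by
  have hh : ∀ t, IsUnitValued (boxObs μ v t) := fun t => (isDecreasing_boxObs μ v t).toIsUnitValued
  have hr : ∀ {F : Finset ℝ}, (∀ t ∈ F, r < t) → ∀ t ∈ ({r} ∪ F : Finset ℝ), r ≤ t := by
    intro F hF t ht
    rcases Finset.mem_union.1 ht with h | h
    · exact (Finset.mem_singleton.1 h).ge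
    · exact (hF t h).le
  rw [form_union (fun s hs t ht => (h₁ s hs).trans_le (hr h₂ t ht))
    (Finset.disjoint_left.2 fun t ht ht' => (hS t ht).not_ge (hr hT t ht'))
    (fun s hs t ht => (hS t ht).trans_le (hr h₂ s hs)) (fun s hs t ht => (h₁ s hs).le.trans (hr hT t ht)),
    hw _ (IsUnitValued.run hh hx _ _)]
  have hsort : ({r} ∪ F₂ : Finset ℝ).sort = r :: F₂.sort := by
    rw [sort_union_of_lt (fun s hs t ht => by
      rw [Finset.mem_singleton.1 hs]; exact h₂ t ht), Finset.sort_singleton]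
    rfl
  have e1 : ({r} ∪ T : Finset ℝ).filter (· < r) = ∅ :=
    Finset.filter_false_of_mem fun t ht => not_lt.2 (hr hT t ht)
  have e2 : ({r} ∪ T : Finset ℝ).filter (r ≤ ·) = {r} ∪ T :=
    Finset.filter_true_of_mem (hr hT)
  refine integral_congr_ae ?_
  filter_upwards [proj_comp_quantile_mul (μ r) ((Iic (v r)).indicator fun _ => (1 : ℝ))
    (run μ (boxObs μ v) x F₂.sort T)] with q hq
  rw [hsort]
  simp only [run, e1, e2, Finset.prod_empty, one_mul]
  congr 1
  refine Eq.trans ?_ hq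
  congr 1
  funext q'
  rw [run_union_of_lt _ _ _ (Finset.disjoint_singleton_left.2 fun h => lt_irrefl r (hT r h))
    (fun s hs t ht => by rw [Finset.mem_singleton.1 ht]; exact h₂ s (by simpa using hs)),
    Finset.prod_singleton]
  rfl

/-- The points of `F` in `R`, split at `r`, together with `r`. -/
theorem tendsto_form_split (hh : ∀ t, IsDecreasing (h t)) (ha : IsDecreasing a)
    (hx : IsDecreasing x) (S : Finset ℝ) {R : Set ℝ} (hr : r ∈ R) :
    Tendsto (fun F => form μ S h a x (restr (R ∩ Iio r) F ∪ ({r} ∪ restr (R ∩ Ioi r) F))) atTop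
      (𝓝 (limForm μ S h a x R)) := by
  refine (tendsto_form hh ha hx S R).congr' ?_
  filter_upwards [eventually_ge_atTop ({r} : Finset ℝ)] with F hF
  congr 1
  have hrF : r ∈ F := hF (by simp)
  ext t
  simp only [mem_restr, Finset.mem_union, Finset.mem_singleton, mem_inter_iff, mem_Iio, mem_Ioi]
  constructor
  · rintro ⟨h1, h2⟩
    rcases lt_trichotomy t r with h | h | h
    · exact Or.inl ⟨h1, h2, h⟩
    · exact Or.inr (Or.inl h)
    · exact Or.inr (Or.inr ⟨h1, h2, h⟩)
  · rintro (h | rfl | h)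
    · exact ⟨h.1, h.2.1⟩
    · exact ⟨hrF, hr⟩
    · exact ⟨h.1, h.2.1⟩

/-- Since forms decrease in the past and in the future set separately, the infimum can be computed
by refining the future with a fixed past, and the past afterwards. -/
theorem limForm_eq_of_iterated (hh : ∀ t, IsDecreasing (h t)) (ha : IsDecreasing a)
    (hx : IsDecreasing x) (S : Finset ℝ) {R : Set ℝ} (hr : r ∈ R) {A : Finset ℝ → ℝ} {B : ℝ}
    (hA : ∀ F₁, Tendsto (fun F₂ => form μ S h a x
      (restr (R ∩ Iio r) F₁ ∪ ({r} ∪ restr (R ∩ Ioi r) F₂))) atTop (𝓝 (A F₁)))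
    (hB : Tendsto A atTop (𝓝 B)) : limForm μ S h a x R = B := by
  have hsub : ∀ F₁ F₂ : Finset ℝ,
      ((restr (R ∩ Iio r) F₁ ∪ ({r} ∪ restr (R ∩ Ioi r) F₂) : Finset ℝ) : Set ℝ) ⊆ R := by
    intro F₁ F₂ t ht
    simp only [Finset.coe_union, Finset.coe_singleton, mem_union, Finset.mem_coe, mem_restr,
      mem_singleton_iff] at ht
    rcases ht with h | rfl | h
    · exact h.2.1
    · exact hr
    · exact h.2.1
  have hmono : ∀ {F₁ F₁' F₂ F₂' : Finset ℝ}, F₁ ≤ F₁' → F₂ ≤ F₂' →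
      restr (R ∩ Iio r) F₁ ∪ ({r} ∪ restr (R ∩ Ioi r) F₂) ≤
        restr (R ∩ Iio r) F₁' ∪ ({r} ∪ restr (R ∩ Ioi r) F₂') := fun h1 h2 =>
    Finset.union_subset_union (restr_mono _ h1)
      (Finset.union_subset_union_right (restr_mono _ h2))
  have hAanti : Antitone A := fun F₁ F₁' h1 => le_of_tendsto_of_tendsto' (hA F₁') (hA F₁)
    fun F₂ => form_anti hh ha hx S (hmono h1 le_rfl)
  refine le_antisymm ?_ ?_
  · refine ge_of_tendsto' hB fun F₁ => ge_of_tendsto' (hA F₁) fun F₂ => ?_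
    exact limForm_le (fun t => (hh t).toIsUnitValued) ha.toIsUnitValued hx.toIsUnitValued S
      (hsub _ _)
  · refine ge_of_tendsto' (tendsto_form_split (μ := μ) hh ha hx S hr) fun F => ?_
    refine (hAanti.le_of_tendsto hB F).trans ?_
    exact Antitone.le_of_tendsto (fun F₂ F₂' h2 => form_anti hh ha hx S (hmono le_rfl h2)) (hA F) F

/-! ### The Markov property at the points of `R` -/

theorem catenate_toMeasure {α β γ : Type*} [MeasurableSpace α] [MeasurableSpace β]
    [MeasurableSpace γ] [StandardBorelSpace γ] [Nonempty γ] (P : ProbabilityMeasure (α × β))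
    (Q : ProbabilityMeasure (β × γ)) : (catenate P Q : Measure (α × β × γ)) =
      Measure.map MeasurableEquiv.prodAssoc ((P : Measure (α × β)) ⊗ₘ
        ((Q : Measure (β × γ)).condKernel.comap Prod.snd measurable_snd)) := rfl

theorem catenate_real_prod {α β γ : Type*} [MeasurableSpace α] [MeasurableSpace β]
    [MeasurableSpace γ] [StandardBorelSpace γ] [Nonempty γ] (P : ProbabilityMeasure (α × β))
    (Q : ProbabilityMeasure (β × γ)) {A : Set α} {B : Set β} {C : Set γ} (hA : MeasurableSet A)
    (hB : MeasurableSet B) (hC : MeasurableSet C) :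
    (catenate P Q : Measure (α × β × γ)).real (A ×ˢ B ×ˢ C) =
      ∫ p, A.indicator (fun _ => 1) p.1 * (B.indicator (fun _ => 1) p.2 *
        ((Q : Measure (β × γ)).condKernel p.2).real C) ∂(P : Measure (α × β)) := by
  rw [catenate_toMeasure, measureReal_def,
    Measure.map_apply MeasurableEquiv.prodAssoc.measurable (hA.prod (hB.prod hC))]
  have e : MeasurableEquiv.prodAssoc ⁻¹' (A ×ˢ B ×ˢ C) = ((A ×ˢ B) ×ˢ C : Set ((α × β) × γ)) := by
    ext z; simp [MeasurableEquiv.prodAssoc, and_assoc]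
  rw [e, Measure.compProd_apply_prod (hA.prod hB) hC, ← lintegral_indicator (hA.prod hB),
    integral_eq_lintegral_of_nonneg_ae]
  · congr 1
    refine lintegral_congr fun p => ?_
    by_cases h1 : p.1 ∈ A <;> by_cases h2 : p.2 ∈ B <;>
      simp [indicator, h1, h2, Kernel.comap_apply]
  · exact Eventually.of_forall fun p => mul_nonneg (indicator_nonneg (fun _ _ => zero_le_one) _)
      (mul_nonneg (indicator_nonneg (fun _ _ => zero_le_one) _) measureReal_nonneg)
  · refine Measurable.aestronglyMeasurable ?_
    refine ((measurable_const.indicator hA).comp measurable_fst).mul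
      (((measurable_const.indicator hB).comp measurable_snd).mul ?_)
    exact ((Kernel.measurable_coe _ hC).comp measurable_snd).ennreal_toReal

theorem isUnitValued_kernel_real {α β : Type*} [MeasurableSpace α] [MeasurableSpace β]
    (κ : Kernel α β) [IsMarkovKernel κ] {C : Set β} (hC : MeasurableSet C) :
    IsUnitValued fun y => (κ y).real C where
  meas := (Kernel.measurable_coe _ hC).ennreal_toReal
  nonneg _ := measureReal_nonneg
  le_one _ := measureReal_le_one

theorem integral_mul_indicator_eq_condKernel {β γ : Type*} [MeasurableSpace β]
    [MeasurableSpace γ] [StandardBorelSpace γ] [Nonempty γ] (Q : Measure (β × γ))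
    [IsProbabilityMeasure Q] {b : β → ℝ} (hb : IsUnitValued b) {C : Set γ} (hC : MeasurableSet C) :
    ∫ p, b p.1 * C.indicator (fun _ => 1) p.2 ∂Q = ∫ p, b p.1 * (Q.condKernel p.1).real C ∂Q := by
  have h1 := (hb.comp measurable_fst).mul ((IsUnitValued.indicator hC).comp
    (measurable_snd : Measurable (Prod.snd : β × γ → γ)))
  have h2 := hb.mul (isUnitValued_kernel_real Q.condKernel hC)
  have h3 : ∫ p, b p.1 * (Q.condKernel p.1).real C ∂Q =
      ∫ y, b y * (Q.condKernel y).real C ∂Q.fst := by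
    rw [Measure.fst, integral_map measurable_fst.aemeasurable h2.meas.aestronglyMeasurable]
  rw [h3]
  conv_lhs => rw [← Q.disintegrate Q.condKernel]
  rw [Measure.integral_compProd (h1.integrable _)]
  refine integral_congr_ae (Eventually.of_forall fun y => ?_)
  simp only [integral_const_mul]
  rw [integral_indicator hC]
  simp

end

/-! ### Conditional independence of past and future. -/

section

variable {μ : ℝ → ProbabilityMeasure ℝ} {S T : Finset ℝ} {r : ℝ} {R : Set ℝ}
  {P : ProbabilityMeasure (ℝ → ℝ)}

/-- The event that the path is below `v` at the times of `S`. -/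
def below (S : Finset ℝ) (v : ℝ → ℝ) : Set (ℝ → ℝ) := {z | ∀ t ∈ S, z t ≤ v t}

theorem measurableSet_below (S : Finset ℝ) (v : ℝ → ℝ) : MeasurableSet (below S v) :=
  measurableSet_forall_le measurable_pi_apply S v

theorem isUnitValued_below (S : Finset ℝ) (v : ℝ → ℝ) :
    IsUnitValued ((below S v).indicator fun _ => (1 : ℝ)) :=
  IsUnitValued.indicator (measurableSet_below S v)

theorem below_empty (v : ℝ → ℝ) : below ∅ v = univ := eq_univ_of_forall fun z t ht => by simp at ht

theorem below_congr {v v' : ℝ → ℝ} (h : ∀ t ∈ S, v t = v' t) : below S v = below S v' := by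
  ext z; exact forall₂_congr fun t ht => by rw [h t ht]

theorem real_below_union (m : Measure (ℝ → ℝ)) (S T : Finset ℝ) (r : ℝ) (v : ℝ → ℝ) :
    m.real (below (S ∪ ({r} ∪ T)) v) = ∫ z, (below S v).indicator (fun _ => (1 : ℝ)) z *
      ((Iic (v r)).indicator (fun _ => 1) (z r) * (below T v).indicator (fun _ => 1) z) ∂m := by
  have e : (fun z : ℝ → ℝ => (below S v).indicator (fun _ => (1 : ℝ)) z *
      ((Iic (v r)).indicator (fun _ => 1) (z r) * (below T v).indicator (fun _ => 1) z)) =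
      (below (S ∪ ({r} ∪ T)) v).indicator fun _ => 1 := by
    classical
    funext z
    have hz : z ∈ below (S ∪ ({r} ∪ T)) v ↔ z ∈ below S v ∧ z r ∈ Iic (v r) ∧ z ∈ below T v := by
      simp only [below, mem_ofPred_eq, Finset.mem_union, Finset.mem_singleton, mem_Iic]
      constructor
      · intro h
        exact ⟨fun t ht => h t (Or.inl ht), h r (Or.inr (Or.inl rfl)),
          fun t ht => h t (Or.inr (Or.inr ht))⟩
      · rintro ⟨h1, h2, h3⟩ t (ht | rfl | ht)
        exacts [h1 t ht, h2, h3 t ht]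
    simp only [indicator_apply, hz]
    by_cases h1 : z ∈ below S v <;> by_cases h2 : z r ∈ Iic (v r) <;>
      by_cases h3 : z ∈ below T v <;> simp only [h1, h2, h3] <;> norm_num
  rw [e, integral_indicator (measurableSet_below _ v)]
  simp

theorem IsLimitLaw.integral_apply (hP : IsLimitLaw μ R P) {b : ℝ → ℝ} (hb : IsUnitValued b)
    (r : ℝ) : ∫ z : ℝ → ℝ, b (z r) ∂(P : Measure (ℝ → ℝ)) = ∫ q, b (quantile (μ r) q) ∂Λ := by
  rw [← integral_map (μ := (P : Measure (ℝ → ℝ))) (φ := fun z : ℝ → ℝ => z r)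
    (measurable_pi_apply r).aemeasurable hb.meas.aestronglyMeasurable,
    hP.marg, ← map_quantile (μ r), integral_map (measurable_quantile _).aemeasurable
    hb.meas.aestronglyMeasurable]

theorem IsLimitLaw.real_below (hP : IsLimitLaw μ R P) (S : Finset ℝ) (v : ℝ → ℝ) :
    (P : Measure (ℝ → ℝ)).real (below S v) =
      limForm μ S (boxObs μ v) (fun _ => 1) (fun _ => 1) R := hP.box S v

theorem boxObs_update_self (v : ℝ → ℝ) (y q : ℝ) : boxObs μ (Function.update v r y) r q =
    (Iic y).indicator (fun _ => 1) (quantile (μ r) q) := by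
  simp [boxObs]

/-- Limits of expectations that involve the future of a time of projection. -/
theorem IsLimitLaw.tendsto_future (hP : IsLimitLaw μ R P) (hr : r ∈ R) (hT : ∀ t ∈ T, r < t)
    (v : ℝ → ℝ) {b : ℝ → ℝ} (hb : IsUnitValued b) :
    Tendsto (fun F => ∫ q, proj (μ r)
        (run μ (boxObs μ v) (fun _ => 1) (restr (R ∩ Ioi r) F).sort T) q *
          b (quantile (μ r) q) ∂Λ) atTop
      (𝓝 (∫ z, (below T v).indicator (fun _ => 1) z * b (z r) ∂(P : Measure (ℝ → ℝ)))) := by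
  have hh : ∀ v t, IsDecreasing (boxObs μ v t) := isDecreasing_boxObs μ
  have h1 : IsDecreasing fun _ : ℝ => (1 : ℝ) := IsDecreasing.one
  have hrun : ∀ F : Finset ℝ, IsUnitValued (proj (μ r)
      (run μ (boxObs μ v) (fun _ => 1) (restr (R ∩ Ioi r) F).sort T)) := fun F =>
    (IsUnitValued.run (fun t => (hh v t).toIsUnitValued) h1.toIsUnitValued _ _).proj _
  have key := tendsto_integral_weight_sub (l := (atTop : Filter (Finset ℝ))) (P := Λ)
    (P' := (P : Measure (ℝ → ℝ))) (G := quantile (μ r)) (G' := fun z => z r)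
    (measurable_quantile _) (measurable_pi_apply r) (by rw [map_quantile, hP.marg])
    (w' := fun _ => (below T v).indicator fun _ => (1 : ℝ)) hrun
    (fun _ => isUnitValued_below T v) (fun y => ?_) hb
  · have := key.add_const (∫ z, (below T v).indicator (fun _ => 1) z * b (z r) ∂(P : Measure (ℝ → ℝ)))
    simpa using this
  · have t1 := tendsto_form_split (μ := μ) (h := boxObs μ (Function.update v r y)) (hh _) h1 h1
      ({r} ∪ T) hr
    rw [← hP.real_below] at t1
    have e1 := real_below_union (P : Measure (ℝ → ℝ)) ∅ T r (Function.update v r y)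
    rw [Finset.empty_union, below_empty] at e1
    rw [e1] at t1
    have hTne : ∀ t ∈ T, t ≠ r := fun t ht => (hT t ht).ne'
    rw [below_congr (v' := v) fun t ht => Function.update_of_ne (hTne t ht) _ _] at t1
    simp only [indicator_univ, one_mul, Function.update_self] at t1
    have e2 : ∀ F : Finset ℝ, form μ ({r} ∪ T) (boxObs μ (Function.update v r y)) (fun _ => 1)
        (fun _ => 1) (restr (R ∩ Iio r) F ∪ ({r} ∪ restr (R ∩ Ioi r) F)) =
        ∫ q, proj (μ r) (run μ (boxObs μ v) (fun _ => 1) (restr (R ∩ Ioi r) F).sort T) q *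
          (Iic y).indicator (fun _ => (1 : ℝ)) (quantile (μ r) q) ∂Λ := by
      intro F
      have := form_boxObs_split (μ := μ) (S := ∅) (T := T) (v := Function.update v r y) (r := r)
        (a := fun _ => 1) (x := fun _ => 1)
        (F₁ := restr (R ∩ Iio r) F) (F₂ := restr (R ∩ Ioi r) F) (by simp) hT
        (fun s hs => (mem_restr.1 hs).2.2) (fun s hs => (mem_restr.1 hs).2.2)
        IsUnitValued.one (w := fun _ => 1) (fun b hb => by
          rw [form_empty_one_left hb]; simp only [one_mul])
      rw [Finset.empty_union] at this
      rw [this]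
      refine integral_congr_ae (Eventually.of_forall fun q => ?_)
      simp only [one_mul, boxObs_update_self]
      rw [run_congr _ T fun t ht => boxObs_update_of_ne v y (hTne t ht), mul_comm]
    simp only [e2] at t1
    have t2 := t1.sub_const (∫ z, (Iic y).indicator (fun _ => (1 : ℝ)) (z r) *
      (below T v).indicator (fun _ => 1) z ∂(P : Measure (ℝ → ℝ)))
    rw [sub_self] at t2
    refine t2.congr fun F => ?_
    simp only [mul_comm]

/-- Limits of expectations that involve the past of a time of projection. -/
theorem IsLimitLaw.tendsto_past (hP : IsLimitLaw μ R P) (hr : r ∈ R) (hS : ∀ s ∈ S, s < r)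
    (v : ℝ → ℝ) {w : Finset ℝ → ℝ → ℝ} (hw : ∀ F, IsUnitValued (w F))
    (hwF : ∀ F b, IsUnitValued b → form μ S (boxObs μ v) (fun _ => 1) b (restr (R ∩ Iio r) F) =
      ∫ q, w F q * b q ∂Λ) {b : ℝ → ℝ} (hb : IsUnitValued b) :
    Tendsto (fun F => ∫ q, w F q * b (quantile (μ r) q) ∂Λ) atTop
      (𝓝 (∫ z, (below S v).indicator (fun _ => 1) z * b (z r) ∂(P : Measure (ℝ → ℝ)))) := by
  have hh : ∀ v t, IsDecreasing (boxObs μ v t) := isDecreasing_boxObs μ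
  have h1 : IsDecreasing fun _ : ℝ => (1 : ℝ) := IsDecreasing.one
  have key := tendsto_integral_weight_sub (l := (atTop : Filter (Finset ℝ))) (P := Λ)
    (P' := (P : Measure (ℝ → ℝ))) (G := quantile (μ r)) (G' := fun z => z r)
    (measurable_quantile _) (measurable_pi_apply r) (by rw [map_quantile, hP.marg])
    (w' := fun _ => (below S v).indicator fun _ => (1 : ℝ)) hw
    (fun _ => isUnitValued_below S v) (fun y => ?_) hb
  · have := key.add_const (∫ z, (below S v).indicator (fun _ => 1) z * b (z r) ∂(P : Measure (ℝ → ℝ)))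
    simpa using this
  · have t1 := tendsto_form_split (μ := μ) (h := boxObs μ (Function.update v r y)) (hh _) h1 h1
      (S ∪ ({r} ∪ ∅)) hr
    rw [← hP.real_below, real_below_union, below_empty] at t1
    have hSne : ∀ t ∈ S, t ≠ r := fun t ht => (hS t ht).ne
    rw [below_congr (v' := v) fun t ht => Function.update_of_ne (hSne t ht) _ _] at t1
    simp only [indicator_univ, mul_one, Function.update_self] at t1
    have e2 : ∀ F : Finset ℝ, form μ (S ∪ ({r} ∪ ∅)) (boxObs μ (Function.update v r y)) (fun _ => 1)
        (fun _ => 1) (restr (R ∩ Iio r) F ∪ ({r} ∪ restr (R ∩ Ioi r) F)) =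
        ∫ q, w F q * (Iic y).indicator (fun _ => (1 : ℝ)) (quantile (μ r) q) ∂Λ := by
      intro F
      rw [form_boxObs_split (μ := μ) (S := S) (T := ∅) (v := Function.update v r y) (r := r)
        (a := fun _ => 1) (x := fun _ => 1)
        (F₁ := restr (R ∩ Iio r) F) (F₂ := restr (R ∩ Ioi r) F) hS (by simp)
        (fun s hs => (mem_restr.1 hs).2.2) (fun s hs => (mem_restr.1 hs).2.2)
        IsUnitValued.one (w := w F) (fun b hb => by
          rw [← hwF F b hb]
          refine form_congr_ae (fun t ht => ?_) (Eventually.of_forall fun _ => rfl)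
            (Eventually.of_forall fun _ => rfl) _
          rw [boxObs_update_of_ne v y (hSne t ht)]
          exact Eventually.of_forall fun _ => rfl)]
      refine integral_congr_ae (Eventually.of_forall fun q => ?_)
      simp only [run_empty_one, proj_one, mul_one, boxObs_update_self]
    simp only [e2] at t1
    have t2 := t1.sub_const (∫ z, (below S v).indicator (fun _ => 1) z *
      (Iic y).indicator (fun _ => (1 : ℝ)) (z r) ∂(P : Measure (ℝ → ℝ)))
    rwa [sub_self] at t2

/-- For each fixed finite past, refining the future gives the conditional law of the future given
the value at `r`. Refining the past then gives the expectation of the past indicator times this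
conditional law, which is the catenation. -/
theorem IsLimitLaw.markovAt (hP : IsLimitLaw μ R P) (hr : r ∈ R) : MarkovAt P r := by
  intro S T hS hT
  refine ext_of_boxes_prod fun u y u' => ?_
  have hh : ∀ v t, IsDecreasing (boxObs μ v t) := isDecreasing_boxObs μ
  have h1 : IsDecreasing fun _ : ℝ => (1 : ℝ) := IsDecreasing.one
  -- The three blocks of thresholds are glued into one function of time; they do not interfere
  -- because `S`, `r` and `T` are disjoint.
  set v : ℝ → ℝ := fun t => if ht : t ∈ S then u ⟨t, ht⟩ else if ht' : t ∈ T then u' ⟨t, ht'⟩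
    else y with hv
  have hvS : ∀ t : S, v t = u t := fun t => by simp [hv]
  have hvT : ∀ t : T, v t = u' t := fun t => by
    have : (t : ℝ) ∉ S := fun h => lt_asymm (hS t h) (hT t t.2)
    simp [hv, this]
  have hvr : v r = y := by
    have a1 : r ∉ S := fun h => lt_irrefl r (hS r h)
    have a2 : r ∉ T := fun h => lt_irrefl r (hT r h)
    simp [hv, a1, a2]
  have mS : MeasurableSet {z : S → ℝ | ∀ i, z i ≤ u i} := by
    simpa using measurableSet_forall_le (fun i : S => measurable_pi_apply i) Finset.univ u
  have mT : MeasurableSet {z : T → ℝ | ∀ i, z i ≤ u' i} := by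
    simpa using measurableSet_forall_le (fun i : T => measurable_pi_apply i) Finset.univ u'
  have bS : ∀ z : ℝ → ℝ, S.restrict z ∈ {z : S → ℝ | ∀ i, z i ≤ u i} ↔ z ∈ below S v := fun z => by
    change (∀ i : S, z i ≤ u i) ↔ ∀ t ∈ S, z t ≤ v t
    simp only [← hvS, Subtype.forall]
  have bT : ∀ z : ℝ → ℝ, T.restrict z ∈ {z : T → ℝ | ∀ i, z i ≤ u' i} ↔ z ∈ below T v := fun z => by
    change (∀ i : T, z i ≤ u' i) ↔ ∀ t ∈ T, z t ≤ v t
    simp only [← hvT, Subtype.forall]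
  set m : Measure (ℝ → ℝ) := (P : Measure (ℝ → ℝ)) with hm
  have hmeas3 : Measurable fun z : ℝ → ℝ => (S.restrict z, z r, T.restrict z) := by fun_prop
  have hmeas1 : Measurable fun z : ℝ → ℝ => (S.restrict z, z r) := by fun_prop
  have hmeas2 : Measurable fun z : ℝ → ℝ => (z r, T.restrict z) := by fun_prop
  set P₂ : ProbabilityMeasure (ℝ × (T → ℝ)) := P.map hmeas2.aemeasurable with hP₂
  set k : ℝ → ℝ := fun y' =>
    ((P₂ : Measure (ℝ × (T → ℝ))).condKernel y').real {z : T → ℝ | ∀ i, z i ≤ u' i} with hk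
  have hkU : IsUnitValued k := isUnitValued_kernel_real _ mT
  -- the kernel represents the conditional probability of the future
  have hK : ∀ b : ℝ → ℝ, IsUnitValued b →
      ∫ z, (below T v).indicator (fun _ => 1) z * b (z r) ∂m = ∫ z : ℝ → ℝ, k (z r) * b (z r) ∂m := by
    intro b hb
    have h2 := integral_mul_indicator_eq_condKernel (P₂ : Measure (ℝ × (T → ℝ))) hb mT
    have mb : Measurable fun p : ℝ × (T → ℝ) => b p.1 := hb.meas.comp measurable_fst
    have i1 : ∀ f : ℝ × (T → ℝ) → ℝ, Measurable f →
        ∫ p, f p ∂(P₂ : Measure (ℝ × (T → ℝ))) = ∫ z, f (z r, T.restrict z) ∂m := fun f hf => by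
      rw [hP₂, ProbabilityMeasure.toMeasure_map, integral_map hmeas2.aemeasurable
        hf.aestronglyMeasurable]
    rw [i1 (fun p => b p.1 * {z : T → ℝ | ∀ i, z i ≤ u' i}.indicator (fun _ => 1) p.2)
        (mb.mul ((measurable_const.indicator mT).comp measurable_snd)),
      i1 (fun p => b p.1 * k p.1) (mb.mul (hkU.meas.comp measurable_fst))] at h2
    classical
    simp only [indicator_apply, bT] at h2 ⊢
    simp only [mul_comm (b _)] at h2
    exact h2
  have hy : IsUnitValued ((Iic y).indicator fun _ => (1 : ℝ)) :=
    IsUnitValued.indicator measurableSet_Iic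
  have hlim : m.real (below (S ∪ ({r} ∪ T)) v) =
      ∫ z, (below S v).indicator (fun _ => 1) z * ((Iic y).indicator (fun _ => 1) (z r) * k (z r)) ∂m := by
    rw [hm, hP.real_below]
    choose w hw hwF using fun F => exists_adjoint_form (μ := μ) (hh v) h1 S (restr (R ∩ Iio r) F)
    refine limForm_eq_of_iterated (hh v) h1 h1 _ hr
      (A := fun F => ∫ q, w F q * ((Iic y).indicator (fun _ => 1) (quantile (μ r) q) *
        k (quantile (μ r) q)) ∂Λ) (fun F₁ => ?_)
      (hP.tendsto_past hr hS v (fun F => (hw F).toIsUnitValued) hwF (hy.mul hkU))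
    -- The projected future depends on the value at `r` only, so the past weight may be replaced by
    -- its conditional expectation given that value.
    set b₁ : ℝ → ℝ := fun y' => ∫ q, w F₁ q ∂(levelKernel (μ r) y') with hb₁
    have hb₁U : IsUnitValued b₁ := (hw F₁).toIsUnitValued.kernel_integral _
    have hb₁p : ∀ q, proj (μ r) (w F₁) q = b₁ (quantile (μ r) q) := fun q => rfl
    have t := hP.tendsto_future hr hT v (hy.mul hb₁U)
    have e : ∫ q, w F₁ q * ((Iic y).indicator (fun _ => 1) (quantile (μ r) q) *
        k (quantile (μ r) q)) ∂Λ = ∫ z, (below T v).indicator (fun _ => 1) z *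
          ((Iic y).indicator (fun _ => 1) (z r) * b₁ (z r)) ∂(P : Measure (ℝ → ℝ)) := by
      rw [← hm, hK _ (hy.mul hb₁U), hm, hP.integral_apply (hkU.mul (hy.mul hb₁U)) r]
      have := integral_comp_quantile_mul_proj (μ r) (hy.mul hkU) (hw F₁).toIsUnitValued
      simp only [hb₁p] at this
      calc _ = ∫ q, (Iic y).indicator (fun _ => 1) (quantile (μ r) q) *
            k (quantile (μ r) q) * w F₁ q ∂Λ := by simp only [mul_comm (w F₁ _)]
        _ = _ := by
          rw [← this]
          refine integral_congr_ae (Eventually.of_forall fun q => ?_)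
          simp only []
          ring
    rw [e]
    refine t.congr fun F₂ => ?_
    rw [form_boxObs_split (μ := μ) hS hT (fun s hs => (mem_restr.1 hs).2.2)
      (fun s hs => (mem_restr.1 hs).2.2) IsUnitValued.one (hwF F₁)]
    have hrunU := IsUnitValued.run (μ := μ) (fun t => (hh v t).toIsUnitValued) h1.toIsUnitValued
      (restr (R ∩ Ioi r) F₂).sort T
    have := integral_comp_quantile_mul_proj (μ r) (hy.mul (hrunU.kernel_integral (levelKernel (μ r))))
      (hw F₁).toIsUnitValued
    simp only [hb₁p] at this
    have hφ : ∀ q, proj (μ r) (run μ (boxObs μ v) (fun _ => 1) (restr (R ∩ Ioi r) F₂).sort T) q =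
      ∫ q', run μ (boxObs μ v) (fun _ => 1) (restr (R ∩ Ioi r) F₂).sort T q'
        ∂(levelKernel (μ r) (quantile (μ r) q)) := fun q => rfl
    simp only [boxObs, hvr]
    simp only [← hφ] at this
    calc _ = ∫ q, (Iic y).indicator (fun _ => 1) (quantile (μ r) q) * proj (μ r)
          (run μ (boxObs μ v) (fun _ => 1) (restr (R ∩ Ioi r) F₂).sort T) q *
            b₁ (quantile (μ r) q) ∂Λ := by
          refine integral_congr_ae (Eventually.of_forall fun q => ?_)
          simp only []
          ring
      _ = _ := by
          rw [this]
          refine integral_congr_ae (Eventually.of_forall fun q => ?_)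
          simp only []
          ring
  refine (ENNReal.toReal_eq_toReal_iff' (measure_ne_top _ _) (measure_ne_top _ _)).1 ?_
  have hcat := catenate_real_prod (P.map hmeas1.aemeasurable) P₂ mS (measurableSet_Iic (a := y)) mT
  rw [measureReal_def] at hcat
  refine Eq.trans ?_ hcat.symm
  rw [ProbabilityMeasure.toMeasure_map, ProbabilityMeasure.toMeasure_map,
    Measure.map_apply hmeas3 (mS.prod (measurableSet_Iic.prod mT)),
    integral_map hmeas1.aemeasurable]
  · have hpre : (fun z : ℝ → ℝ => (S.restrict z, z r, T.restrict z)) ⁻¹'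
        ({z | ∀ i, z i ≤ u i} ×ˢ Iic y ×ˢ {z | ∀ i, z i ≤ u' i}) = below (S ∪ ({r} ∪ T)) v := by
      ext z
      simp only [mem_preimage, mem_prod, bS, bT, mem_Iic]
      simp only [below, mem_ofPred_eq, Finset.mem_union, Finset.mem_singleton]
      constructor
      · rintro ⟨h1, h2, h3⟩ t (ht | rfl | ht)
        exacts [h1 t ht, hvr ▸ h2, h3 t ht]
      · intro h
        exact ⟨fun t ht => h t (Or.inl ht), hvr ▸ h r (Or.inr (Or.inl rfl)),
          fun t ht => h t (Or.inr (Or.inr ht))⟩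
    rw [hpre]
    refine hlim.trans ?_
    classical
    simp only [indicator_apply, bS]
    rfl
  · exact (((measurable_const.indicator mS).comp measurable_fst).mul
      (((measurable_const.indicator measurableSet_Iic).comp measurable_snd).mul
        (hkU.meas.comp measurable_snd))).aestronglyMeasurable

end

/-! ### Identification and uniqueness of the made-Markov and Markov-quantile laws. -/

section

/-! ### Observations without a time of projection in between -/

variable {μ : ℝ → ProbabilityMeasure ℝ} {S : Finset ℝ} {P Q : ProbabilityMeasure (ℝ → ℝ)}

/-- Projections after the last observation act on a constant. An observation exactly at the first
projection time is a function of the quantile there and is fixed by the projection. -/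
theorem run_boxObs_of_le (v : ℝ → ℝ) {l : List ℝ} (hl : l.Pairwise (· < ·))
    (hS : ∀ r ∈ l, ∀ t ∈ S, t ≤ r) :
    ∀ᵐ q ∂Λ, run μ (boxObs μ v) (fun _ => 1) l S q = ∏ t ∈ S, boxObs μ v t q := by
  cases l with
  | nil => simp [run]
  | cons r l =>
    obtain ⟨hrl, -⟩ := List.pairwise_cons.1 hl
    have hsub : S.filter (r ≤ ·) ⊆ {r} := fun t ht => by
      rw [Finset.mem_filter] at ht
      exact Finset.mem_singleton.2 (le_antisymm (hS r (by simp) t ht.1) ht.2)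
    obtain ⟨g, hg⟩ : ∃ g : ℝ → ℝ, ∀ q, ∏ t ∈ S with r ≤ t, boxObs μ v t q = g (quantile (μ r) q) := by
      rcases Finset.subset_singleton_iff.1 hsub with h | h
      · exact ⟨fun _ => 1, fun q => by rw [h, Finset.prod_empty]⟩
      · exact ⟨(Iic (v r)).indicator fun _ => 1, fun q => by rw [h, Finset.prod_singleton]; rfl⟩
    have hrun : run μ (boxObs μ v) (fun _ => 1) l (S.filter (r ≤ ·)) =
        fun q => g (quantile (μ r) q) := by
      funext q
      have := run_union_of_lt (μ := μ) (h := boxObs μ v) (x := fun _ => 1) (S.filter (r ≤ ·)) ∅ l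
        (by simp) (fun s hs t ht => by rw [Finset.mem_singleton.1 (hsub ht)]; exact hrl s hs) q
      rw [Finset.union_empty] at this
      rw [this, hg, run_empty_one, mul_one]
    filter_upwards [proj_comp_quantile (μ r) g] with q hq
    simp only [run, hrun, hq]
    rw [← hg, ← Finset.prod_filter_mul_prod_filter_not S (· < r)]
    simp only [not_lt]

/-- Projections before all observations preserve the integral and those after them act trivially.
Without a projection strictly between observations, the process is thus still the quantile process.
-/
theorem integral_run_boxObs_of_gap (v : ℝ → ℝ) {l : List ℝ} (hl : l.Pairwise (· < ·))
    (hS : ∀ r ∈ l, (∀ t ∈ S, t ≤ r) ∨ ∀ t ∈ S, r ≤ t) :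
    ∫ q, run μ (boxObs μ v) (fun _ => 1) l S q ∂Λ = ∫ q, ∏ t ∈ S, boxObs μ v t q ∂Λ := by
  induction l with
  | nil => simp [run]
  | cons r l ih =>
    obtain ⟨hrl, hl'⟩ := List.pairwise_cons.1 hl
    rcases hS r (by simp) with h | h
    · refine integral_congr_ae (run_boxObs_of_le v hl fun s hs t ht => ?_)
      rcases List.mem_cons.1 hs with rfl | hs
      · exact h t ht
      · exact (h t ht).trans (hrl s hs).le
    · rw [← ih hl' fun s hs => hS s (List.mem_cons_of_mem _ hs)]
      simp only [run, Finset.filter_false_of_mem fun t ht => not_lt.2 (h t ht),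
        Finset.filter_true_of_mem h, Finset.prod_empty, one_mul]
      exact integral_proj _ (IsUnitValued.run (fun t => (isDecreasing_boxObs μ v t).toIsUnitValued)
        IsUnitValued.one _ _)

theorem quantileProcess_real_below (S : Finset ℝ) (v : ℝ → ℝ) :
    (quantileProcess μ : Measure (ℝ → ℝ)).real (below S v) = ∫ q, ∏ t ∈ S, boxObs μ v t q ∂Λ := by
  have hm : Measurable fun (q : ℝ) (t : ℝ) => quantile (μ t) q :=
    measurable_pi_lambda _ fun t => measurable_quantile (μ t)
  rw [quantileProcess, measureReal_def, ProbabilityMeasure.toMeasure_map,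
    Measure.map_apply hm (measurableSet_below S v), ← measureReal_def]
  exact real_forall_le (P := Λ) (f := fun t q => quantile (μ t) q)
    (fun t => measurable_quantile (μ t)) S v

theorem IsLimitLaw.isMadeMarkov {F : Finset ℝ} (hP : IsLimitLaw μ F P) :
    IsMadeMarkov (quantileProcess μ) F P := by
  refine ⟨fun S hS => margFin_ext fun v => ?_, fun r hr => hP.markovAt hr⟩
  refine (hP.real_below S v).trans (Eq.trans ?_ (quantileProcess_real_below S v).symm)
  rw [limForm_coe (isDecreasing_boxObs μ v) IsDecreasing.one IsDecreasing.one, form]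
  simp only [one_mul]
  exact integral_run_boxObs_of_gap v (Finset.sortedLT_sort F).pairwise
    fun r hr => hS r (by simpa using hr)

/-- Only projections strictly between the two observations matter; one exactly at `s` or `t` fixes
the observation made there. -/
theorem form_pair {s t : ℝ} (hst : s < t) (v : ℝ → ℝ) (F : Finset ℝ) :
    form μ {s, t} (boxObs μ v) (fun _ => 1) (fun _ => 1) F =
      form μ ∅ (fun _ _ => 1) (boxObs μ v s) (boxObs μ v t) (restr (Ioo s t) F) := by
  have hh : ∀ t, IsUnitValued (boxObs μ v t) := fun t => (isDecreasing_boxObs μ v t).toIsUnitValued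
  have h1 : IsUnitValued fun _ : ℝ => (1 : ℝ) := IsUnitValued.one
  have hu : F = restr (Iic s) F ∪ (restr (Ioo s t) F ∪ restr (Ici t) F) := by
    ext r
    simp only [Finset.mem_union, mem_restr, mem_Iic, mem_Ioo, mem_Ici, ← and_or_left]
    refine ⟨fun h => ⟨h, ?_⟩, fun h => h.1⟩
    rcases le_or_gt r s with h1 | h1
    · exact Or.inl h1
    · exact Or.inr ((lt_or_ge r t).imp (fun h2 => ⟨h1, h2⟩) id)
  have l1 : ∀ r ∈ restr (Iic s) F, r ≤ s := fun r hr => (mem_restr.1 hr).2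
  have l2 : ∀ r ∈ restr (Ioo s t) F, s < r ∧ r < t := fun r hr => (mem_restr.1 hr).2
  have l3 : ∀ r ∈ restr (Ici t) F, t ≤ r := fun r hr => (mem_restr.1 hr).2
  have l4 : ∀ r ∈ restr (Ioo s t) F ∪ restr (Ici t) F, s < r := fun r hr =>
    (Finset.mem_union.1 hr).elim (fun h => (l2 r h).1) fun h => hst.trans_le (l3 r h)
  conv_lhs => rw [hu]
  have e1 := form_union (μ := μ) (h := boxObs μ v) (a := fun _ => 1) (x := fun _ => 1) (S₁ := ∅)
    (S₂ := {s, t}) (F₁ := restr (Iic s) F) (F₂ := restr (Ioo s t) F ∪ restr (Ici t) F)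
    (fun r hr u hu => (l1 r hr).trans_lt (l4 u hu)) (by simp) (by simp)
    (fun r hr u hu => by
      rcases Finset.mem_insert.1 hu with rfl | hu
      · exact l1 r hr
      · rw [Finset.mem_singleton.1 hu]; exact (l1 r hr).trans hst.le)
  rw [Finset.empty_union] at e1
  rw [e1, form_empty_one_left (IsUnitValued.run hh h1 _ _), form]
  have e2 : ∀ q, run μ (boxObs μ v) (fun _ => 1) (restr (Ioo s t) F ∪ restr (Ici t) F).sort {s, t} q =
      boxObs μ v s q * run μ (fun _ _ => 1)
        (run μ (boxObs μ v) (fun _ => 1) (restr (Ici t) F).sort {t}) (restr (Ioo s t) F).sort ∅ q := by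
    intro q
    have a1 := run_union_of_lt (μ := μ) (h := boxObs μ v) (x := fun _ => 1) {s} {t}
      (restr (Ioo s t) F ∪ restr (Ici t) F).sort (by simpa using hst.ne)
      (fun r hr u hu => by rw [Finset.mem_singleton.1 hu]; exact l4 r (by simpa using hr)) q
    have a2 := run_append (μ := μ) (h := boxObs μ v) (x := fun _ => 1) ∅ {t}
      (restr (Ioo s t) F).sort (restr (Ici t) F).sort (by simp) (by simp)
      (fun r hr u hu => by
        rw [Finset.mem_singleton.1 hu]; exact (l2 r (by simpa using hr)).2.le)
    rw [Finset.empty_union] at a2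
    rw [← Finset.insert_eq] at a1
    rw [a1, Finset.prod_singleton, sort_union_of_lt fun r hr u hu => (l2 r hr).2.trans_le (l3 u hu),
      a2, run_empty_congr fun _ _ => 1]
  simp only [e2]
  refine integral_congr_ae ?_
  have e3 := run_boxObs_of_le (μ := μ) (S := {t}) v
    (Finset.sortedLT_sort (restr (Ici t) F)).pairwise (fun r hr u hu => by
      rw [Finset.mem_singleton.1 hu]; exact l3 r (by simpa using hr))
  simp only [Finset.prod_singleton] at e3
  filter_upwards [run_congr_ae (μ := μ) (h := fun _ _ => 1) (h' := fun _ _ => 1)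
    (restr (Ioo s t) F).sort ∅ (by simp) e3] with q hq
  rw [hq]

theorem restr_inter (A B : Set ℝ) (F : Finset ℝ) : restr A (restr B F) = restr (B ∩ A) F := by
  ext t; simp [and_assoc]

theorem limForm_pair {s t : ℝ} (hst : s < t) (v : ℝ → ℝ) (R : Set ℝ) :
    limForm μ {s, t} (boxObs μ v) (fun _ => 1) (fun _ => 1) R =
      limForm μ ∅ (fun _ _ => 1) (boxObs μ v s) (boxObs μ v t) (R ∩ Ioo s t) := by
  simp only [limForm, form_pair hst, restr_inter]

/-- The two-time distribution functions are infima over projection times in the open interval, that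
is, over the chains of quantile couplings of the definition. -/
theorem IsLimitLaw.isMarkovQuantile (hP : IsLimitLaw μ univ P) : IsMarkovQuantile μ P := by
  refine ⟨fun r => hP.markovAt (mem_univ r), fun s t hst => ?_⟩
  have hm : Measurable fun z : ℝ → ℝ => (z s, z t) := by fun_prop
  have hh : ∀ v t, IsUnitValued (boxObs μ v t) := fun v t =>
    (isDecreasing_boxObs μ v t).toIsUnitValued
  have key : ∀ x y, (marg₂ P s t : Measure (ℝ × ℝ)).real (Iic x ×ˢ Iic y) =
      limForm μ ∅ (fun _ _ => 1) (fun q => (Iic x).indicator (fun _ => 1) (quantile (μ s) q))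
        (fun q => (Iic y).indicator (fun _ => 1) (quantile (μ t) q)) (Ioo s t) := by
    intro x y
    set v : ℝ → ℝ := fun u => if u = s then x else y with hv
    have h := hP.real_below {s, t} v
    rw [limForm_pair hst, univ_inter] at h
    have e1 : v s = x := by simp [hv]
    have e2 : v t = y := by simp [hv, hst.ne']
    have e3 : boxObs μ v s = fun q => (Iic x).indicator (fun _ => 1) (quantile (μ s) q) := by
      funext q; rw [boxObs, e1]
    have e4 : boxObs μ v t = fun q => (Iic y).indicator (fun _ => 1) (quantile (μ t) q) := by
      funext q; rw [boxObs, e2]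
    rw [e3, e4] at h
    refine Eq.trans ?_ h
    rw [marg₂, measureReal_def, ProbabilityMeasure.toMeasure_map,
      Measure.map_apply hm (measurableSet_Iic.prod measurableSet_Iic), ← measureReal_def]
    congr 1
    ext z
    simp [below, e1, e2]
  have ha : ∀ (ν : ProbabilityMeasure ℝ) (x : ℝ),
      IsUnitValued fun q => (Iic x).indicator (fun _ => (1 : ℝ)) (quantile ν q) := fun ν x =>
    (isDecreasing_indicator_quantile ν x).toIsUnitValued
  refine isLoSup_of_real ?_ fun x y c hc => ?_
  · rintro _ ⟨F, hF, rfl⟩ x y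
    rw [key, quantileChain_real_Iic]
    exact limForm_le (fun _ => IsUnitValued.one) (ha _ x) (ha _ y) ∅ hF
  · rw [key]
    refine le_limForm fun F hF => ?_
    rw [← quantileChain_real_Iic]
    exact hc _ ⟨F, hF, rfl⟩

/-! ### Uniqueness -/

theorem map_eq_of_factor {β γ : Type*} [MeasurableSpace β] [MeasurableSpace γ]
    {f : (ℝ → ℝ) → β} {f' : (ℝ → ℝ) → γ} {g : β → γ} (hf : Measurable f) (hg : Measurable g)
    (hf' : Measurable f') (hfg : ∀ z, f' z = g (f z))
    (h : P.map hf.aemeasurable = Q.map hf.aemeasurable) :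
    P.map hf'.aemeasurable = Q.map hf'.aemeasurable := by
  have e : f' = g ∘ f := funext hfg
  subst e
  have h' : Measure.map f (P : Measure (ℝ → ℝ)) = Measure.map f (Q : Measure (ℝ → ℝ)) :=
    congrArg (fun m : ProbabilityMeasure β => (m : Measure β)) h
  refine Subtype.ext ?_
  change Measure.map (g ∘ f) (P : Measure (ℝ → ℝ)) = Measure.map (g ∘ f) (Q : Measure (ℝ → ℝ))
  rw [← Measure.map_map hg hf, ← Measure.map_map hg hf, h']

/-- Induction on the number of points of `R` strictly between points of `S`. Cutting at such an `r`
leaves two sets, past with `r` and future with `r`, that have fewer of them, and the catenation of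
their marginals determines the joint marginal. -/
theorem margFin_eq_of_markovAt {R S₀ : Finset ℝ} (hP : ∀ r ∈ R, MarkovAt P r)
    (hQ : ∀ r ∈ R, MarkovAt Q r)
    (h : ∀ S ⊆ S₀ ∪ R, (∀ r ∈ R, (∀ s ∈ S, s ≤ r) ∨ ∀ s ∈ S, r ≤ s) → margFin P S = margFin Q S) :
    ∀ S ⊆ S₀ ∪ R, margFin P S = margFin Q S := by
  classical
  set N : Finset ℝ → Finset ℝ := fun S => R.filter fun r => (∃ s ∈ S, s < r) ∧ ∃ t ∈ S, r < t
    with hN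
  intro S
  induction hn : (N S).card using Nat.strong_induction_on generalizing S with
  | _ n ih =>
  intro hS
  by_cases hsep : ∀ r ∈ R, (∀ s ∈ S, s ≤ r) ∨ ∀ s ∈ S, r ≤ s
  · exact h S hS hsep
  push Not at hsep
  obtain ⟨r, hr, ⟨t, ht, hrt⟩, ⟨s, hs, hsr⟩⟩ := hsep
  set A := S.filter (· < r) with hA
  set B := S.filter (r < ·) with hB
  have hrN : r ∈ N S := Finset.mem_filter.2 ⟨hr, ⟨s, hs, hsr⟩, t, ht, hrt⟩
  have sub : ∀ C ⊆ S, insert r C ⊆ S₀ ∪ R := fun C hC u hu => by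
    rcases Finset.mem_insert.1 hu with rfl | hu
    · exact Finset.mem_union_right _ hr
    · exact hS (hC hu)
  have card_lt : ∀ C ⊆ S, (C ⊆ A ∨ C ⊆ B) → (N (insert r C)).card < n := by
    intro C hC hCAB
    rw [← hn]
    refine Finset.card_lt_card (Finset.ssubset_iff_of_subset ?_ |>.2 ⟨r, hrN, ?_⟩)
    · intro u hu
      obtain ⟨huR, ⟨s', hs', hsu⟩, t', ht', hut⟩ := Finset.mem_filter.1 hu
      refine Finset.mem_filter.2 ⟨huR, ?_, ?_⟩
      · rcases Finset.mem_insert.1 hs' with rfl | hs'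
        · exact ⟨s, hs, hsr.trans hsu⟩
        · exact ⟨s', hC hs', hsu⟩
      · rcases Finset.mem_insert.1 ht' with rfl | ht'
        · exact ⟨t, ht, hut.trans hrt⟩
        · exact ⟨t', hC ht', hut⟩
    · intro hu
      obtain ⟨-, ⟨s', hs', hsu⟩, t', ht', hut⟩ := Finset.mem_filter.1 hu
      have hs'C := Finset.mem_of_mem_insert_of_ne hs' hsu.ne
      have ht'C := Finset.mem_of_mem_insert_of_ne ht' hut.ne'
      rcases hCAB with hc | hc
      · exact lt_asymm hut (Finset.mem_filter.1 (hc ht'C)).2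
      · exact lt_asymm hsu (Finset.mem_filter.1 (hc hs'C)).2
  have hAS : A ⊆ S := Finset.filter_subset _ _
  have hBS : B ⊆ S := Finset.filter_subset _ _
  have eA := ih _ (card_lt A hAS (Or.inl subset_rfl)) _ rfl (sub A hAS)
  have eB := ih _ (card_lt B hBS (Or.inr subset_rfl)) _ rfl (sub B hBS)
  have mP := hP r hr A B (fun u hu => (Finset.mem_filter.1 hu).2)
    fun u hu => (Finset.mem_filter.1 hu).2
  have mQ := hQ r hr A B (fun u hu => (Finset.mem_filter.1 hu).2)
    fun u hu => (Finset.mem_filter.1 hu).2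
  have eA' := map_eq_of_factor (f' := fun z => (A.restrict z, z r))
    (g := fun y : ↥(insert r A) → ℝ =>
      ((fun u : A => y ⟨u, Finset.mem_insert_of_mem u.2⟩ : A → ℝ),
        y ⟨r, Finset.mem_insert_self r A⟩)) (by fun_prop) (by fun_prop) (by fun_prop)
    (fun z => rfl) eA
  have eB' := map_eq_of_factor (f' := fun z => (z r, B.restrict z))
    (g := fun y : ↥(insert r B) → ℝ => (y ⟨r, Finset.mem_insert_self r B⟩,
      (fun u : B => y ⟨u, Finset.mem_insert_of_mem u.2⟩ : B → ℝ)))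
    (by fun_prop) (by fun_prop) (by fun_prop) (fun z => rfl) eB
  rw [eA', eB', ← mQ] at mP
  refine map_eq_of_factor (f' := S.restrict)
    (g := fun (y : (A → ℝ) × ℝ × (B → ℝ)) (u : S) => if hu : (u : ℝ) ∈ A then y.1 ⟨u, hu⟩ else
      if hu : (u : ℝ) ∈ B then y.2.2 ⟨u, hu⟩ else y.2.1) (by fun_prop)
    (measurable_pi_lambda _ fun u => ?_) (by fun_prop) (fun z => ?_) mP
  · by_cases hA' : (u : ℝ) ∈ A
    · simp only [hA', dite_true]; fun_prop
    · by_cases hB' : (u : ℝ) ∈ B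
      · simp only [hA', hB', dite_true, dite_false]; fun_prop
      · simp only [hA', hB', dite_false]; fun_prop
  · funext u
    by_cases hA' : (u : ℝ) ∈ A
    · simp [hA']
    · by_cases hB' : (u : ℝ) ∈ B
      · simp [hA', hB']
      · have : (u : ℝ) = r := by
          rcases lt_trichotomy (u : ℝ) r with h1 | h1 | h1
          · exact absurd (Finset.mem_filter.2 ⟨u.2, h1⟩) hA'
          · exact h1
          · exact absurd (Finset.mem_filter.2 ⟨u.2, h1⟩) hB'
        simp [this]

theorem IsMadeMarkov.unique {M : ProbabilityMeasure (ℝ → ℝ)} {R : Finset ℝ}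
    (hP : IsMadeMarkov M R P) (hQ : IsMadeMarkov M R Q) : P = Q :=
  ext_of_margFin fun S => margFin_eq_of_markovAt (S₀ := S) hP.2 hQ.2
    (fun T _ hT => (hP.1 T hT).trans (hQ.1 T hT).symm) S Finset.subset_union_left

theorem margFin_eq_of_marg₂ {s t : ℝ} (hst : s < t) (h : marg₂ P s t = marg₂ Q s t)
    (hS : S ⊆ {s, t}) : margFin P S = margFin Q S := by
  refine map_eq_of_factor (f' := S.restrict)
    (g := fun (y : ℝ × ℝ) (u : S) => if (u : ℝ) = s then y.1 else y.2) (by fun_prop)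
    (measurable_pi_lambda _ fun u => ?_) (by fun_prop) (fun z => ?_) h
  · by_cases hu : (u : ℝ) = s
    · simp only [hu, if_true]; fun_prop
    · simp only [hu, if_false]; fun_prop
  · funext u
    by_cases hu : (u : ℝ) = s
    · simp [hu]
    · have : (u : ℝ) = t := by
        rcases Finset.mem_insert.1 (hS u.2) with h1 | h1
        · exact absurd h1 hu
        · exact Finset.mem_singleton.1 h1
      simp [this, hst.ne']

theorem IsMarkovQuantile.unique (hP : IsMarkovQuantile μ P) (hQ : IsMarkovQuantile μ Q) :
    P = Q := by
  refine ext_of_margFin fun S => margFin_eq_of_markovAt (S₀ := S) (R := S) (fun r _ => hP.1 r)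
    (fun r _ => hQ.1 r) (fun T hTS hT => ?_) S Finset.subset_union_left
  rw [Finset.union_self] at hTS
  have h₂ : ∀ s t, s < t → marg₂ P s t = marg₂ Q s t := fun s t hst =>
    (hP.2 s t hst).unique (hQ.2 s t hst)
  rcases T.eq_empty_or_nonempty with rfl | hne
  -- For the empty set of times any pair of times will do.
  · exact margFin_eq_of_marg₂ zero_lt_one (h₂ 0 1 zero_lt_one) (by simp)
  -- No point of `T` lies strictly between two others, so `T` has at most its two extreme points and
  -- the two-time marginals suffice.
  have hsub : ∀ u ∈ T, u = T.min' hne ∨ u = T.max' hne := fun u hu => by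
    rcases hT u (hTS hu) with h | h
    · exact Or.inr (le_antisymm (T.le_max' u hu) (h _ (T.max'_mem hne)))
    · exact Or.inl (le_antisymm (h _ (T.min'_mem hne)) (T.min'_le u hu))
  rcases (T.min'_le_max' hne).lt_or_eq with hlt | heq
  · exact margFin_eq_of_marg₂ hlt (h₂ _ _ hlt) fun u hu => by
      rcases hsub u hu with h | h <;> simp [h]
  · have hlt : T.min' hne < T.min' hne + 1 := lt_add_one _
    exact margFin_eq_of_marg₂ hlt (h₂ _ _ hlt) fun u hu => by
      rcases hsub u hu with h | h <;> simp [h, heq]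

theorem existsUnique_isMadeMarkov (F : Finset ℝ) :
    ∃! P, IsMadeMarkov (quantileProcess μ) F P := by
  obtain ⟨P, hP⟩ := exists_isLimitLaw μ (F : Set ℝ)
  exact ⟨P, hP.isMadeMarkov, fun Q hQ => hQ.unique hP.isMadeMarkov⟩

theorem existsUnique_isMarkovQuantile : ∃! P, IsMarkovQuantile μ P := by
  obtain ⟨P, hP⟩ := exists_isLimitLaw μ univ
  exact ⟨P, hP.isMarkovQuantile, fun Q hQ => hQ.unique hP.isMarkovQuantile⟩

theorem isLimitLaw_madeMarkov (F : Finset ℝ) :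
    IsLimitLaw μ F (madeMarkov (quantileProcess μ) F) := by
  obtain ⟨P, hP⟩ := exists_isLimitLaw μ (F : Set ℝ)
  have : IsMadeMarkov (quantileProcess μ) F (madeMarkov (quantileProcess μ) F) :=
    Classical.epsilon_spec ⟨P, hP.isMadeMarkov⟩
  rwa [this.unique hP.isMadeMarkov]

theorem isLimitLaw_markovQuantile : IsLimitLaw μ univ (markovQuantile μ) := by
  obtain ⟨P, hP⟩ := exists_isLimitLaw μ univ
  have : IsMarkovQuantile μ (markovQuantile μ) := Classical.epsilon_spec ⟨P, hP.isMarkovQuantile⟩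
  rwa [this.unique hP.isMarkovQuantile]

end

/-! ### Weak convergence as an equality of limit forms. -/

section

/-! ### Weak convergence and distribution functions -/

/-- Lower bounds are imposed one coordinate at a time, each as a difference of two sets of the
previous kind. -/
theorem tendsto_measure_Ioc_of_tendsto_box {ι : Type*} [Finite ι]
    {P : ℕ → ProbabilityMeasure (ι → ℝ)} {Q : ProbabilityMeasure (ι → ℝ)}
    (h : ∀ v : ι → ℝ, Tendsto (fun n => (P n : Measure (ι → ℝ)).real {z | ∀ i, z i ≤ v i}) atTop
      (𝓝 ((Q : Measure (ι → ℝ)).real {z | ∀ i, z i ≤ v i}))) (u : ι → ℝ) (A : Finset ι)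
    (v : ι → ℝ) :
    Tendsto (fun n => (P n : Measure (ι → ℝ)).real {z | (∀ i, z i ≤ v i) ∧ ∀ i ∈ A, u i < z i})
      atTop (𝓝 ((Q : Measure (ι → ℝ)).real {z | (∀ i, z i ≤ v i) ∧ ∀ i ∈ A, u i < z i})) := by
  classical
  have hms : ∀ (A : Finset ι) (v : ι → ℝ),
      MeasurableSet {z : ι → ℝ | (∀ i, z i ≤ v i) ∧ ∀ i ∈ A, u i < z i} := by
    intro A v
    have : {z : ι → ℝ | (∀ i, z i ≤ v i) ∧ ∀ i ∈ A, u i < z i} =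
        (⋂ i, {z | z i ≤ v i}) ∩ ⋂ i ∈ A, {z | u i < z i} := by ext; simp
    rw [this]
    exact (MeasurableSet.iInter fun i => measurableSet_le (measurable_pi_apply i)
      measurable_const).inter (Finset.measurableSet_biInter _ fun i _ =>
        measurableSet_lt measurable_const (measurable_pi_apply i))
  induction A using Finset.induction_on generalizing v with
  | empty => simpa using h v
  | insert j A hj ih =>
    -- The minimum with `v j` keeps the removed set inside the original one when `v j < u j`.
    set v' : ι → ℝ := Function.update v j (min (u j) (v j)) with hv'
    have hv'v : ∀ i, v' i ≤ v i := fun i => by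
      by_cases hi : i = j
      · subst hi; simp [hv']
      · simp [hv', hi]
    have hsub : {z : ι → ℝ | (∀ i, z i ≤ v' i) ∧ ∀ i ∈ A, u i < z i} ⊆
        {z | (∀ i, z i ≤ v i) ∧ ∀ i ∈ A, u i < z i} := fun z hz =>
      ⟨fun i => (hz.1 i).trans (hv'v i), hz.2⟩
    have e : {z : ι → ℝ | (∀ i, z i ≤ v i) ∧ ∀ i ∈ insert j A, u i < z i} =
        {z | (∀ i, z i ≤ v i) ∧ ∀ i ∈ A, u i < z i} \
          {z | (∀ i, z i ≤ v' i) ∧ ∀ i ∈ A, u i < z i} := by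
      ext z
      simp only [Set.mem_sdiff, mem_ofPred_eq, Finset.mem_insert, forall_eq_or_imp, not_and]
      constructor
      · rintro ⟨h1, h2, h3⟩
        refine ⟨⟨h1, h3⟩, fun h4 _ => ?_⟩
        have := h4 j
        simp only [hv', Function.update_self, le_min_iff] at this
        exact not_lt.2 this.1 h2
      · rintro ⟨⟨h1, h3⟩, h4⟩
        refine ⟨h1, ?_, h3⟩
        by_contra hc
        refine h4 (fun i => ?_) h3
        by_cases hi : i = j
        · subst hi
          simp only [hv', Function.update_self, le_min_iff]
          exact ⟨not_lt.1 hc, h1 i⟩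
        · simpa [hv', hi] using h1 i
    rw [e]
    have hd : ∀ m : ProbabilityMeasure (ι → ℝ), (m : Measure (ι → ℝ)).real
        ({z | (∀ i, z i ≤ v i) ∧ ∀ i ∈ A, u i < z i} \
          {z | (∀ i, z i ≤ v' i) ∧ ∀ i ∈ A, u i < z i}) =
        (m : Measure (ι → ℝ)).real {z | (∀ i, z i ≤ v i) ∧ ∀ i ∈ A, u i < z i} -
          (m : Measure (ι → ℝ)).real {z | (∀ i, z i ≤ v' i) ∧ ∀ i ∈ A, u i < z i} := fun m =>
      measureReal_sdiff hsub (hms A v')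
    simp only [hd]
    exact (ih v).sub (ih v')

theorem tendsto_of_tendsto_box {ι : Type*} [Fintype ι]
    {P : ℕ → ProbabilityMeasure (ι → ℝ)} {Q : ProbabilityMeasure (ι → ℝ)}
    (h : ∀ v : ι → ℝ, Tendsto (fun n => (P n : Measure (ι → ℝ)).real {z | ∀ i, z i ≤ v i}) atTop
      (𝓝 ((Q : Measure (ι → ℝ)).real {z | ∀ i, z i ≤ v i}))) : Tendsto P atTop (𝓝 Q) := by
  have hpi : IsPiSystem {s : Set (ι → ℝ) | ∃ u v : ι → ℝ, s = pi univ fun i => Ioc (u i) (v i)} := by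
    rintro _ ⟨u, v, rfl⟩ _ ⟨u', v', rfl⟩ -
    exact ⟨fun i => max (u i) (u' i), fun i => min (v i) (v' i), by
      rw [← pi_inter_distrib]; simp only [Ioc_inter_Ioc]⟩
  refine hpi.tendsto_probabilityMeasure_of_tendsto_of_mem ?_ ?_ ?_
  · rintro _ ⟨u, v, rfl⟩
    exact MeasurableSet.univ_pi fun i => measurableSet_Ioc
  · intro G hG x hx
    obtain ⟨ε, hε, hsub⟩ := Metric.isOpen_iff.1 hG x hx
    refine ⟨_, ⟨fun i => x i - ε / 2, fun i => x i + ε / 2, rfl⟩,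
      set_pi_mem_nhds finite_univ fun i _ => Ioc_mem_nhds (by linarith) (by linarith), ?_⟩
    intro z hz
    refine hsub (lt_of_le_of_lt ((dist_pi_le_iff (by positivity)).2 fun i => ?_)
      (half_lt_self hε))
    have := hz i (mem_univ i)
    rw [Real.dist_eq, abs_le]
    constructor <;> linarith [this.1, this.2]
  · rintro _ ⟨u, v, rfl⟩
    have e : (pi univ fun i => Ioc (u i) (v i)) =
        {z : ι → ℝ | (∀ i, z i ≤ v i) ∧ ∀ i ∈ (Finset.univ : Finset ι), u i < z i} := by
      ext z
      simp only [Set.mem_pi, mem_univ, true_imp_iff, mem_Ioc, mem_ofPred_eq, Finset.mem_univ]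
      exact ⟨fun h => ⟨fun i => (h i).2, fun i => (h i).1⟩, fun h i => ⟨h.2 i, h.1 i⟩⟩
    have t := tendsto_measure_Ioc_of_tendsto_box h u Finset.univ v
    rw [← e] at t
    rw [← NNReal.tendsto_coe]
    exact t

/-! ### Convergence to the Markov-quantile measure -/

variable {μ : ℝ → ProbabilityMeasure ℝ}

/-- The limit of the laws made Markov at the finite subsets of `R` is the Markov-quantile law. -/
def IsMarkovDense (μ : ℝ → ProbabilityMeasure ℝ) (R : Set ℝ) : Prop :=
  ∀ (S : Finset ℝ) (v : ℝ → ℝ), limForm μ S (boxObs μ v) (fun _ => 1) (fun _ => 1) R =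
    limForm μ S (boxObs μ v) (fun _ => 1) (fun _ => 1) univ

theorem IsMarkovDense.mono {R R' : Set ℝ} (hR : IsMarkovDense μ R) (h : R ⊆ R') :
    IsMarkovDense μ R' := by
  intro S v
  have hh : ∀ t, IsUnitValued (boxObs μ v t) := fun t => (isDecreasing_boxObs μ v t).toIsUnitValued
  refine le_antisymm ?_ (limForm_anti hh IsUnitValued.one IsUnitValued.one S (subset_univ _))
  exact (limForm_anti hh IsUnitValued.one IsUnitValued.one S h).trans (hR S v).le

theorem tendsto_form_of_monotone {Rn : ℕ → Finset ℝ} (hRn : Monotone Rn) (S : Finset ℝ)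
    (v : ℝ → ℝ) :
    Tendsto (fun n => form μ S (boxObs μ v) (fun _ => 1) (fun _ => 1) (Rn n)) atTop
      (𝓝 (limForm μ S (boxObs μ v) (fun _ => 1) (fun _ => 1) (⋃ n, (Rn n : Set ℝ)))) := by
  have hd := isDecreasing_boxObs μ v
  have hh : ∀ t, IsUnitValued (boxObs μ v t) := fun t => (hd t).toIsUnitValued
  have h1 : IsUnitValued fun _ : ℝ => (1 : ℝ) := IsUnitValued.one
  have t := tendsto_atTop_ciInf
    ((form_anti (μ := μ) hd IsDecreasing.one IsDecreasing.one S).comp_monotone hRn)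
    ⟨0, by rintro _ ⟨n, rfl⟩; exact form_nonneg hh h1 h1 _ _⟩
  convert! t using 2
  refine le_antisymm (le_ciInf fun n => limForm_le hh h1 h1 S (subset_iUnion (fun n => (Rn n : Set ℝ)) n))
    (le_limForm fun F hF => ?_)
  obtain ⟨n, hn⟩ : ∃ n, F ⊆ Rn n := by
    have hdir : Directed (· ⊆ ·) fun n => (Rn n : Set ℝ) :=
      (monotone_iff_forall_lt.2 fun a b hab => Finset.coe_subset.2 (hRn hab.le)).directed_le
    obtain ⟨n, hn⟩ := hdir.exists_mem_subset_of_finset_subset_biUnion hF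
    exact ⟨n, Finset.coe_subset.1 hn⟩
  exact (ciInf_le ⟨0, by rintro _ ⟨n, rfl⟩; exact form_nonneg hh h1 h1 _ _⟩ n).trans
    (form_anti (μ := μ) hd IsDecreasing.one IsDecreasing.one S hn)

theorem margFin_real_box (P : ProbabilityMeasure (ℝ → ℝ)) (S : Finset ℝ) (v : ℝ → ℝ) :
    (margFin P S : Measure (S → ℝ)).real {z | ∀ i : S, z i ≤ v i} =
      (P : Measure (ℝ → ℝ)).real (below S v) := by
  rw [measureReal_def, margFin_box P S (fun i : S => v i) v fun _ => rfl]
  rfl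

/-- Weak convergence alone bounds only the limsup on closed boxes, but that is the nontrivial
inequality: the other one holds since `R` is contained in `univ`. Thus atoms on the boundary of a
box do no harm. -/
theorem converges_iff {Rn : ℕ → Finset ℝ} (hRn : Monotone Rn) :
    Converges μ Rn ↔ IsMarkovDense μ (⋃ n, (Rn n : Set ℝ)) := by
  have hP : ∀ n S v, (margFin (madeMarkov (quantileProcess μ) (Rn n)) S : Measure (S → ℝ)).real
      {z | ∀ i : S, z i ≤ v i} = form μ S (boxObs μ v) (fun _ => 1) (fun _ => 1) (Rn n) := by
    intro n S v
    rw [margFin_real_box, (isLimitLaw_madeMarkov (Rn n)).real_below,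
      limForm_coe (isDecreasing_boxObs μ v) IsDecreasing.one IsDecreasing.one]
  have hQ : ∀ S v, (margFin (markovQuantile μ) S : Measure (S → ℝ)).real
      {z | ∀ i : S, z i ≤ v i} = limForm μ S (boxObs μ v) (fun _ => 1) (fun _ => 1) univ := by
    intro S v
    rw [margFin_real_box, isLimitLaw_markovQuantile.real_below]
  constructor
  · intro h S v
    have hclosed : IsClosed {z : S → ℝ | ∀ i : S, z i ≤ v i} := by
      simp only [ofPred_forall]
      exact isClosed_iInter fun i => isClosed_le (continuous_apply i) continuous_const
    have h1 := ProbabilityMeasure.limsup_measure_closed_le_of_tendsto (h S) hclosed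
    have h2 : Tendsto (fun n => (margFin (madeMarkov (quantileProcess μ) (Rn n)) S :
        Measure (S → ℝ)) {z | ∀ i : S, z i ≤ v i}) atTop (𝓝 (ENNReal.ofReal
          (limForm μ S (boxObs μ v) (fun _ => 1) (fun _ => 1) (⋃ n, (Rn n : Set ℝ))))) := by
      have := ENNReal.tendsto_ofReal (tendsto_form_of_monotone (μ := μ) hRn S v)
      refine this.congr fun n => ?_
      rw [← hP, ofReal_measureReal (measure_ne_top _ _)]
    rw [h2.limsup_eq, ← ofReal_measureReal (measure_ne_top _ _), hQ] at h1
    have hh : ∀ t, IsUnitValued (boxObs μ v t) := fun t =>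
      (isDecreasing_boxObs μ v t).toIsUnitValued
    refine le_antisymm ((ENNReal.ofReal_le_ofReal_iff ?_).1 h1)
      (limForm_anti hh IsUnitValued.one IsUnitValued.one S (subset_univ _))
    exact le_limForm fun F _ => form_nonneg hh IsUnitValued.one IsUnitValued.one _ _
  · intro h S
    refine tendsto_of_tendsto_box fun u => ?_
    obtain ⟨v, hv⟩ : ∃ v : ℝ → ℝ, ∀ i : S, u i = v i :=
      ⟨fun t : ℝ => if ht : t ∈ S then u ⟨t, ht⟩ else 0, fun i => by simp⟩
    simp only [hv, hP, hQ, ← h S v]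
    exact tendsto_form_of_monotone hRn S v

theorem IsMarkovDense.admissible {R : Set ℝ} (hR : IsMarkovDense μ R) (hc : R.Countable) :
    Admissible μ R :=
  ⟨hc, fun _ hRn h => (converges_iff hRn).2 (h ▸ hR)⟩

theorem exists_monotone_iUnion_eq {R : Set ℝ} (hR : R.Countable) :
    ∃ Rn : ℕ → Finset ℝ, Monotone Rn ∧ (⋃ n, (Rn n : Set ℝ)) = R := by
  classical
  rcases R.eq_empty_or_nonempty with rfl | hne
  · exact ⟨fun _ => ∅, monotone_const, by simp⟩
  obtain ⟨f, rfl⟩ := hR.exists_eq_range hne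
  refine ⟨fun n => (Finset.range n).image f, fun m n hmn =>
    Finset.image_subset_image (Finset.range_mono hmn), ?_⟩
  ext t
  simp only [Finset.coe_image, mem_iUnion, mem_image, Finset.mem_coe, Finset.mem_range, mem_range]
  exact ⟨fun ⟨_, k, _, hk⟩ => ⟨k, hk⟩, fun ⟨k, hk⟩ => ⟨k + 1, k, Nat.lt_succ_self k, hk⟩⟩

end

/-! ### Countable dense sets of times and essential intervals. -/

section

/-! ### Countable sets with the same plans -/

variable {μ : ℝ → ProbabilityMeasure ℝ}

theorem toMeasure_ext_Iic_rat {P Q : ProbabilityMeasure (ℝ × ℝ)}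
    (h : ∀ x y : ℚ, (P : Measure (ℝ × ℝ)) (Iic (x : ℝ) ×ˢ Iic (y : ℝ)) =
      (Q : Measure (ℝ × ℝ)) (Iic (x : ℝ) ×ˢ Iic (y : ℝ))) : P = Q := by
  have hs : IsCountablySpanning (⋃ a : ℚ, {Iic (a : ℝ)}) :=
    ⟨fun n => Iic (n : ℝ), fun n => mem_iUnion.2 ⟨n, by simp⟩,
      eq_univ_of_forall fun x => mem_iUnion.2 (exists_nat_ge x)⟩
  have hb := Real.borel_eq_generateFrom_Iic_rat
  have hg := generateFrom_eq_prod (α := ℝ) (β := ℝ) hb.symm hb.symm hs hs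
  refine Subtype.ext (show (P : Measure (ℝ × ℝ)) = Q from ext_of_generate_finite _ hg.symm
    (Real.isPiSystem_Iic_rat.prod Real.isPiSystem_Iic_rat) ?_ (by simp))
  rintro _ ⟨_, hx, _, hy, rfl⟩
  obtain ⟨x, rfl⟩ := mem_iUnion.1 hx
  obtain ⟨y, rfl⟩ := mem_iUnion.1 hy
  exact h x y

theorem LevelLE.of_rat {A B : Set ℝ} (hAB : A ⊆ B)
    (h : ∀ u v : ℚ, limForm μ ∅ (fun _ _ => 1) ((Iic (u : ℝ)).indicator fun _ => 1)
        ((Iic (v : ℝ)).indicator fun _ => 1) A ≤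
      limForm μ ∅ (fun _ _ => 1) ((Iic (u : ℝ)).indicator fun _ => 1)
        ((Iic (v : ℝ)).indicator fun _ => 1) B) : LevelLE μ A B := by
  rw [← level_eq_iff_of_subset hAB]
  refine toMeasure_ext_Iic_rat fun u v => ?_
  refine (ENNReal.toReal_eq_toReal_iff' (measure_ne_top _ _) (measure_ne_top _ _)).1 ?_
  refine (level_real μ A u v).trans (Eq.trans ?_ (level_real μ B u v).symm)
  exact le_antisymm (h u v) (LevelLE.of_superset hAB _ _ (IsDecreasing.indicator_Iic _)
    (IsDecreasing.indicator_Iic _))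

/-- A plan is determined by its quadrants with rational corners, and each of the corresponding
infima is approached by a sequence of finite sets. -/
theorem exists_countable_levelLE (μ : ℝ → ProbabilityMeasure ℝ) (A : Set ℝ) :
    ∃ C ⊆ A, C.Countable ∧ LevelLE μ C A := by
  have h1 : ∀ _ : ℝ, IsUnitValued fun _ : ℝ => (1 : ℝ) := fun _ => IsUnitValued.one
  have hi : ∀ u : ℝ, IsUnitValued ((Iic u).indicator fun _ => (1 : ℝ)) := fun u =>
    (IsDecreasing.indicator_Iic u).toIsUnitValued
  have hF : ∀ (u v : ℚ) (n : ℕ), ∃ F : Finset ℝ, (F : Set ℝ) ⊆ A ∧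
      form μ ∅ (fun _ _ => 1) ((Iic (u : ℝ)).indicator fun _ => 1)
        ((Iic (v : ℝ)).indicator fun _ => 1) F <
      limForm μ ∅ (fun _ _ => 1) ((Iic (u : ℝ)).indicator fun _ => 1)
        ((Iic (v : ℝ)).indicator fun _ => 1) A + 1 / ((n : ℝ) + 1) := fun u v n =>
    exists_form_lt ∅ A (lt_add_of_pos_right _ (by positivity))
  choose F hFA hF using hF
  have hsub : (⋃ (u : ℚ) (v : ℚ) (n : ℕ), (F u v n : Set ℝ)) ⊆ A := by
    simp only [iUnion_subset_iff]; exact hFA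
  refine ⟨_, hsub, countable_iUnion fun u => countable_iUnion fun v => countable_iUnion fun n =>
    (F u v n).countable_toSet, LevelLE.of_rat hsub fun u v => ?_⟩
  refine le_of_forall_pos_lt_add fun ε hε => ?_
  obtain ⟨n, hn⟩ := exists_nat_one_div_lt hε
  calc _ ≤ _ := limForm_le h1 (hi u) (hi v) ∅ (F := F u v n) fun t ht =>
        mem_iUnion.2 ⟨u, mem_iUnion.2 ⟨v, mem_iUnion.2 ⟨n, ht⟩⟩⟩
    _ < _ := hF u v n
    _ < _ := by gcongr

theorem exists_rat_subset_Ioo {s t : ℝ} (hst : s < t) {F : Finset ℝ} (hF : (F : Set ℝ) ⊆ Ioo s t) :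
    ∃ p q : ℚ, s < p ∧ p < q ∧ (q : ℝ) < t ∧ (F : Set ℝ) ⊆ Ioo (p : ℝ) q := by
  obtain ⟨m, hm⟩ := exists_between hst
  have hne : (insert m F).Nonempty := Finset.insert_nonempty m F
  have hF' : ∀ u ∈ insert m F, u ∈ Ioo s t := fun u hu => by
    rcases Finset.mem_insert.1 hu with rfl | hu
    · exact hm
    · exact hF hu
  obtain ⟨p, hp1, hp2⟩ := exists_rat_btwn (hF' _ ((insert m F).min'_mem hne)).1
  obtain ⟨q, hq1, hq2⟩ := exists_rat_btwn (hF' _ ((insert m F).max'_mem hne)).2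
  have hle := (insert m F).min'_le_max' hne
  refine ⟨p, q, hp1, by exact_mod_cast (hp2.trans_le (hle.trans hq1.le)), hq2, fun u hu => ?_⟩
  have hu' : u ∈ insert m F := Finset.mem_insert_of_mem hu
  exact ⟨hp2.trans_le ((insert m F).min'_le u hu'), ((insert m F).le_max' u hu').trans_lt hq1⟩

/-- A finite subset of an open interval lies in a smaller interval with rational endpoints, so it
does not matter whether the rational intervals are taken open, closed or half-open. -/
theorem isOpenDense_of_forall_rat {R : Set ℝ}
    (h : ∀ p q : ℚ, p < q → ∃ B : Set ℝ, Ioo (p : ℝ) q ⊆ B ∧ B ⊆ Icc (p : ℝ) q ∧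
      LevelLE μ (R ∩ B) B) : IsOpenDense μ R := by
  intro s t hst a x ha hx
  have h1 : ∀ _ : ℝ, IsUnitValued fun _ : ℝ => (1 : ℝ) := fun _ => IsUnitValued.one
  refine le_limForm fun F hF => ?_
  obtain ⟨p, q, hsp, hpq, hqt, hFpq⟩ := exists_rat_subset_Ioo hst hF
  obtain ⟨B, hB1, hB2, hB⟩ := h p q hpq
  have hBs : B ⊆ Ioo s t := fun u hu => ⟨hsp.trans_le (hB2 hu).1, (hB2 hu).2.trans_lt hqt⟩
  exact (limForm_anti h1 ha.toIsUnitValued hx.toIsUnitValued ∅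
    (inter_subset_inter_right R hBs)).trans ((hB a x ha hx).trans
      (limForm_le h1 ha.toIsUnitValued hx.toIsUnitValued ∅ (hFpq.trans hB1)))

theorem exists_isOpenDense (μ : ℝ → ProbabilityMeasure ℝ) :
    ∃ R : Set ℝ, R.Countable ∧ IsOpenDense μ R := by
  choose C hC hCc hCL using fun p : ℚ × ℚ => exists_countable_levelLE μ (Ioo (p.1 : ℝ) p.2)
  refine ⟨⋃ p, C p, countable_iUnion hCc, isOpenDense_of_forall_rat fun p q _ =>
    ⟨Ioo (p : ℝ) q, Subset.rfl, Ioo_subset_Icc_self, ?_⟩⟩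
  have hsub : C (p, q) ⊆ (⋃ p, C p) ∩ Ioo (p : ℝ) q :=
    subset_inter (subset_iUnion C (p, q)) (hC (p, q))
  exact (LevelLE.of_superset hsub).trans (hCL (p, q))

/-! ### Endpoints of intervals -/

/-- The hypothesis is a jump from the left, and a monotone function has countably many
discontinuities. -/
theorem countable_of_antitone_gap {f : ℝ → ℝ} (hf : Antitone f) {E : Set ℝ}
    (hE : ∀ t ∈ E, ∃ c, f t < c ∧ ∀ t' < t, c ≤ f t') : E.Countable := by
  suffices hsub : E ⊆ {x | ¬ ContinuousAt f x} from hf.countable_not_continuousAt.mono hsub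
  intro t ht
  rw [mem_ofPred_eq]
  intro hcont
  obtain ⟨c, hc, hc'⟩ := hE t ht
  obtain ⟨t', ht', hlt⟩ := ((hcont.mono_left nhdsWithin_le_nhds).eventually_lt_const hc).and
    (self_mem_nhdsWithin (a := t) (s := Iio t)) |>.exists
  exact absurd (hc' t' hlt) (not_le.2 ht')

theorem countable_of_monotone_gap {f : ℝ → ℝ} (hf : Monotone f) {E : Set ℝ}
    (hE : ∀ t ∈ E, ∃ c, f t < c ∧ ∀ t' > t, c ≤ f t') : E.Countable := by
  suffices hsub : E ⊆ {x | ¬ ContinuousAt f x} from hf.countable_not_continuousAt.mono hsub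
  intro t ht
  rw [mem_ofPred_eq]
  intro hcont
  obtain ⟨c, hc, hc'⟩ := hE t ht
  obtain ⟨t', ht', hlt⟩ := ((hcont.mono_left nhdsWithin_le_nhds).eventually_lt_const hc).and
    (self_mem_nhdsWithin (a := t) (s := Ioi t)) |>.exists
  exact absurd (hc' t' hlt) (not_le.2 ht')

/-- If the endpoint `t` matters, then for some rational thresholds the antitone function given by
the half-closed intervals jumps at `t`: earlier half-closed intervals are contained in the open
interval ending at `t`. -/
theorem countable_right_endpoints (μ : ℝ → ProbabilityMeasure ℝ) (p : ℝ) :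
    {t | ¬ LevelLE μ (Ioo p t) (Ioc p t)}.Countable := by
  set f : ℚ → ℚ → Set ℝ → ℝ := fun u v A => limForm μ ∅ (fun _ _ => 1)
    ((Iic (u : ℝ)).indicator fun _ => 1) ((Iic (v : ℝ)).indicator fun _ => 1) A with hf
  have hanti : ∀ u v, Antitone (f u v) := fun u v => limForm_anti (fun _ => IsUnitValued.one)
    (IsDecreasing.indicator_Iic _).toIsUnitValued (IsDecreasing.indicator_Iic _).toIsUnitValued ∅
  have : {t | ¬ LevelLE μ (Ioo p t) (Ioc p t)} ⊆
      ⋃ (u : ℚ) (v : ℚ), {t | f u v (Ioc p t) < f u v (Ioo p t)} := by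
    intro t ht
    by_contra hc
    simp only [mem_iUnion, mem_ofPred_eq, not_exists, not_lt] at hc
    exact ht (LevelLE.of_rat Ioo_subset_Ioc_self hc)
  refine Countable.mono this (countable_iUnion fun u => countable_iUnion fun v => ?_)
  refine countable_of_antitone_gap (f := fun t => f u v (Ioc p t))
    (fun t t' htt => hanti u v (Ioc_subset_Ioc_right htt)) fun t ht => ⟨_, ht, fun t' ht' => ?_⟩
  exact hanti u v fun z hz => ⟨hz.1, hz.2.trans_lt ht'⟩

theorem countable_left_endpoints (μ : ℝ → ProbabilityMeasure ℝ) (p : ℝ) :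
    {t | ¬ LevelLE μ (Ioo t p) (Ico t p)}.Countable := by
  set f : ℚ → ℚ → Set ℝ → ℝ := fun u v A => limForm μ ∅ (fun _ _ => 1)
    ((Iic (u : ℝ)).indicator fun _ => 1) ((Iic (v : ℝ)).indicator fun _ => 1) A with hf
  have hanti : ∀ u v, Antitone (f u v) := fun u v => limForm_anti (fun _ => IsUnitValued.one)
    (IsDecreasing.indicator_Iic _).toIsUnitValued (IsDecreasing.indicator_Iic _).toIsUnitValued ∅
  have : {t | ¬ LevelLE μ (Ioo t p) (Ico t p)} ⊆
      ⋃ (u : ℚ) (v : ℚ), {t | f u v (Ico t p) < f u v (Ioo t p)} := by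
    intro t ht
    by_contra hc
    simp only [mem_iUnion, mem_ofPred_eq, not_exists, not_lt] at hc
    exact ht (LevelLE.of_rat Ioo_subset_Ico_self hc)
  refine Countable.mono this (countable_iUnion fun u => countable_iUnion fun v => ?_)
  refine countable_of_monotone_gap (f := fun t => f u v (Ico t p))
    (fun t t' htt => hanti u v (Ico_subset_Ico_left htt)) fun t ht => ⟨_, ht, fun t' ht' => ?_⟩
  exact hanti u v fun z hz => ⟨ht'.trans_le hz.1, hz.2⟩

theorem LevelLE.refl (A : Set ℝ) : LevelLE μ A A := LevelLE.of_superset Subset.rfl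

/-- There is a countable set whose plans on closed and on open intervals are those of the
intervals. -/
theorem exists_countable_forall_levelLE (μ : ℝ → ProbabilityMeasure ℝ) :
    ∃ R : Set ℝ, R.Countable ∧ IsOpenDense μ R ∧
      ∀ s t : ℝ, s < t → LevelLE μ (R ∩ Icc s t) (Icc s t) := by
  obtain ⟨R₀, hR₀, hd₀⟩ := exists_isOpenDense μ
  set E₁ : Set ℝ := ⋃ p : ℚ, {t | ¬ LevelLE μ (Ioo t p) (Ico t p)} with hE₁
  set E₂ : Set ℝ := ⋃ p : ℚ, {t | ¬ LevelLE μ (Ioo p t) (Ioc p t)} with hE₂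
  set R : Set ℝ := R₀ ∪ range ((↑) : ℚ → ℝ) ∪ E₁ ∪ E₂ with hR
  have hd : IsOpenDense μ R := hd₀.mono fun t ht => Or.inl (Or.inl (Or.inl ht))
  refine ⟨R, ((hR₀.union (countable_range _)).union (countable_iUnion fun p : ℚ =>
    countable_left_endpoints μ p)).union
      (countable_iUnion fun p : ℚ => countable_right_endpoints μ p),
    hd, fun s t hst => ?_⟩
  -- Cutting at a rational `p` in `R` treats the endpoints separately. An endpoint outside of `R` is
  -- superfluous next to `p`, since the exceptional endpoints for all rational `p` were put into
  -- `R`.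
  obtain ⟨p, hsp, hpt⟩ := exists_rat_btwn hst
  have hpR : (p : ℝ) ∈ R := Or.inl (Or.inl (Or.inr ⟨p, rfl⟩))
  have left : LevelLE μ (R ∩ Ico s p) (Ico s p) := by
    by_cases hs : s ∈ R
    · have e1 : R ∩ Ico s p = {s} ∪ (R ∩ Ioo s p) := by
        rw [← Ioo_insert_left hsp, inter_insert_of_mem hs, insert_eq]
      have e2 : Ico s (p : ℝ) = {s} ∪ Ioo s p := by rw [← Ioo_insert_left hsp, insert_eq]
      rw [e1, e2]
      refine (LevelLE.refl _).union (hd s p hsp) ?_ ?_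
      · rintro _ rfl z hz; exact hz.2.1
      · rintro _ rfl z hz; exact hz.1
    · have : LevelLE μ (Ioo s p) (Ico s p) := by
        by_contra hc
        exact hs (Or.inl (Or.inr (mem_iUnion.2 ⟨p, hc⟩)))
      exact (LevelLE.of_superset (inter_subset_inter_right R Ioo_subset_Ico_self)).trans
        ((hd s p hsp).trans this)
  have right : LevelLE μ (R ∩ Ioc p t) (Ioc p t) := by
    by_cases ht : t ∈ R
    · have e1 : R ∩ Ioc p t = (R ∩ Ioo p t) ∪ {t} := by
        rw [← Ioo_insert_right hpt, inter_insert_of_mem ht, union_comm, insert_eq]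
      have e2 : Ioc (p : ℝ) t = Ioo (p : ℝ) t ∪ {t} := by
        rw [← Ioo_insert_right hpt, union_comm, insert_eq]
      rw [e1, e2]
      refine (hd p t hpt).union (LevelLE.refl _) ?_ ?_
      · rintro z hz _ rfl; exact hz.2.2
      · rintro z hz _ rfl; exact hz.2
    · have : LevelLE μ (Ioo p t) (Ioc p t) := by
        by_contra hc
        exact ht (Or.inr (mem_iUnion.2 ⟨p, hc⟩))
      exact (LevelLE.of_superset (inter_subset_inter_right R Ioo_subset_Ioc_self)).trans
        ((hd p t hpt).trans this)
  have e : Icc s t = Ico s p ∪ ({(p : ℝ)} ∪ Ioc p t) := by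
    rw [← insert_eq, Ioc_insert_left hpt.le, Ico_union_Icc_eq_Icc hsp.le hpt.le]
  have e' : R ∩ Icc s t = (R ∩ Ico s p) ∪ ({(p : ℝ)} ∪ (R ∩ Ioc p t)) := by
    rw [e, inter_union_distrib_left, inter_union_distrib_left,
      inter_eq_self_of_subset_right (singleton_subset_iff.2 hpR)]
  rw [e', e]
  refine left.union ((LevelLE.refl _).union right ?_ ?_) ?_ ?_
  · rintro _ rfl z hz; exact hz.2.1
  · rintro _ rfl z hz; exact hz.1
  · rintro z hz w (rfl | hw)
    · exact hz.2.2
    · exact hz.2.2.trans hw.2.1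
  · rintro z hz w (rfl | hw)
    · exact hz.2
    · exact hz.2.trans hw.1

theorem IsOpenDense.isMarkovDense {R : Set ℝ} (hR : IsOpenDense μ R) : IsMarkovDense μ R :=
  fun S v => hR.limForm_eq (g := fun t => (Iic (v t)).indicator fun _ => (1 : ℝ))
    (fun _ => IsUnitValued.indicator measurableSet_Iic) (isDecreasing_boxObs μ v)
    IsDecreasing.one IsDecreasing.one S

/-! ### Essential atomic intervals -/

/-- When `t` is not essential, the plan of an open interval around `t` is the product of the plans
of its two halves, and `R` without `t` is still dense in each half. -/
theorem IsOpenDense.diff_singleton {R : Set ℝ} (hR : IsOpenDense μ R) {t : ℝ}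
    (ht : ¬ IsEssentialTime μ t) : IsOpenDense μ (R \ {t}) := by
  intro s u hsu
  by_cases htsu : t ∈ Ioo s u
  · have hlevel : level μ (Ioo s u) = level μ (Ioo s u \ {t}) := by
      by_contra hne
      refine ht ⟨ordConnected_singleton, Ioo s u, ordConnected_Ioo, singleton_subset_iff.2 htsu,
        fun hc => ?_, hne⟩
      obtain ⟨a, ha⟩ := exists_between htsu.1
      obtain ⟨b, hb⟩ := exists_between htsu.2
      have : t ∈ Ioo s u \ {t} := hc.ordConnected.out
        (x := a) ⟨⟨ha.1, ha.2.trans htsu.2⟩, ha.2.ne⟩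
        (y := b) ⟨⟨htsu.1.trans hb.1, hb.2⟩, hb.1.ne'⟩ ⟨ha.2.le, hb.1.le⟩
      exact this.2 rfl
    have h1 : LevelLE μ (Ioo s u \ {t}) (Ioo s u) :=
      (level_eq_iff_of_subset sdiff_subset).1 hlevel.symm
    have e : Ioo s u \ {t} = Ioo s t ∪ Ioo t u := by
      ext z
      simp only [Set.mem_sdiff, mem_Ioo, mem_singleton_iff, mem_union]
      constructor
      · rintro ⟨hz, hne⟩
        rcases lt_or_gt_of_ne hne with h | h
        · exact Or.inl ⟨hz.1, h⟩
        · exact Or.inr ⟨h, hz.2⟩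
      · rintro (h | h)
        · exact ⟨⟨h.1, h.2.trans htsu.2⟩, h.2.ne⟩
        · exact ⟨⟨htsu.1.trans h.1, h.2⟩, h.1.ne'⟩
    have e' : (R \ {t}) ∩ Ioo s u = (R ∩ Ioo s t) ∪ (R ∩ Ioo t u) := by
      rw [← inter_union_distrib_left, ← e]
      ext z; simp only [Set.mem_sdiff, mem_inter_iff]; tauto
    rw [e']
    refine LevelLE.trans ?_ h1
    rw [e]
    refine (hR s t htsu.1).union (hR t u htsu.2) ?_ ?_
    · exact fun r hr z hz => hr.2.2.trans hz.2.1
    · exact fun r hr z hz => hr.2.trans hz.1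
  · have : (R \ {t}) ∩ Ioo s u = R ∩ Ioo s u := by
      ext z
      simp only [Set.mem_sdiff, mem_inter_iff, mem_singleton_iff]
      exact ⟨fun h => ⟨h.1.1, h.2⟩, fun h => ⟨⟨h.1, fun hz => htsu (hz ▸ h.2)⟩, h.2⟩⟩
    rw [this]
    exact hR s u hsu

theorem IsOpenDense.diff_finset {R : Set ℝ} (hR : IsOpenDense μ R) {E : Finset ℝ}
    (hE : ∀ t ∈ E, ¬ IsEssentialTime μ t) : IsOpenDense μ (R \ E) := by
  induction E using Finset.induction_on with
  | empty => simpa using hR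
  | insert t E _ ih =>
    have e : R \ ((insert t E : Finset ℝ) : Set ℝ) = (R \ E) \ {t} := by
      ext z
      simp only [Set.mem_sdiff, Finset.coe_insert, mem_insert_iff, mem_singleton_iff]
      tauto
    rw [e]
    exact (ih fun u hu => hE u (Finset.mem_insert_of_mem hu)).diff_singleton
      (hE t (Finset.mem_insert_self t E))

/-- Projections at the two ends of an interval act only on the test functions. -/
theorem form_insert_endpoints {a x : ℝ → ℝ} (ha : IsUnitValued a) (hx : IsUnitValued x) {s t : ℝ}
    (hst : s < t) {F : Finset ℝ} (hF : (F : Set ℝ) ⊆ Ioo s t) :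
    form μ ∅ (fun _ _ => 1) a x ({s} ∪ (F ∪ {t})) =
      form μ ∅ (fun _ _ => 1) (proj (μ s) a) (proj (μ t) x) F := by
  have h1 : ∀ _ : ℝ, IsUnitValued fun _ : ℝ => (1 : ℝ) := fun _ => IsUnitValued.one
  have hFt : ∀ r ∈ F, ∀ u ∈ ({t} : Finset ℝ), r < u := fun r hr u hu => by
    rw [Finset.mem_singleton.1 hu]; exact (hF hr).2
  have e1 := form_union (μ := μ) (h := fun _ _ => 1) (a := a) (x := x) (S₁ := ∅) (S₂ := ∅)
    (F₁ := {s}) (F₂ := F ∪ {t}) (fun r hr u hu => by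
      rw [Finset.mem_singleton.1 hr]
      rcases Finset.mem_union.1 hu with hu | hu
      · exact (hF hu).1
      · rwa [Finset.mem_singleton.1 hu]) (by simp) (by simp) (by simp)
  rw [Finset.empty_union] at e1
  have e2 := run_append (μ := μ) (h := fun _ _ => 1) (x := x) ∅ ∅ F.sort [t] (by simp) (by simp)
    (by simp)
  rw [Finset.empty_union] at e2
  rw [e1, form_singleton_empty, integral_mul_proj _ ha (IsUnitValued.run h1 hx _ _),
    sort_union_of_lt hFt, Finset.sort_singleton, e2, form]
  simp [run]

/-- Marginals at `s` and `t` test the plan only with functions of the values at `s` and `t`.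
Adjoining the times `s` and `t` projects arbitrary test functions to such functions, so nothing is
lost. -/
theorem levelLE_of_limForm_pair_eq {R : Set ℝ} {s t : ℝ} (hst : s < t)
    (h : ∀ v : ℝ → ℝ, limForm μ {s, t} (boxObs μ v) (fun _ => 1) (fun _ => 1) R =
      limForm μ {s, t} (boxObs μ v) (fun _ => 1) (fun _ => 1) univ) :
    LevelLE μ ({s} ∪ ((R ∩ Ioo s t) ∪ {t})) (Icc s t) := by
  have h1 : ∀ _ : ℝ, IsUnitValued fun _ : ℝ => (1 : ℝ) := fun _ => IsUnitValued.one
  have hxy : ∀ x y : ℝ, limForm μ ∅ (fun _ _ => 1)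
        (fun q => (Iic x).indicator (fun _ => (1 : ℝ)) (quantile (μ s) q))
        (fun q => (Iic y).indicator (fun _ => (1 : ℝ)) (quantile (μ t) q)) (R ∩ Ioo s t) =
      limForm μ ∅ (fun _ _ => 1)
        (fun q => (Iic x).indicator (fun _ => (1 : ℝ)) (quantile (μ s) q))
        (fun q => (Iic y).indicator (fun _ => (1 : ℝ)) (quantile (μ t) q)) (Ioo s t) := by
    intro x y
    have hv := h fun u => if u = s then x else y
    rw [limForm_pair hst, limForm_pair hst, univ_inter] at hv
    have e3 : boxObs μ (fun u => if u = s then x else y) s =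
        fun q => (Iic x).indicator (fun _ => 1) (quantile (μ s) q) := by
      funext q; simp [boxObs]
    have e4 : boxObs μ (fun u => if u = s then x else y) t =
        fun q => (Iic y).indicator (fun _ => 1) (quantile (μ t) q) := by
      funext q; simp [boxObs, hst.ne']
    rwa [e3, e4] at hv
  intro a x ha hx
  have ha' := ha.proj (μ s)
  have hx' := hx.proj (μ t)
  have key : limForm μ ∅ (fun _ _ => 1) (proj (μ s) a) (proj (μ t) x) (R ∩ Ioo s t) =
      limForm μ ∅ (fun _ _ => 1) (proj (μ s) a) (proj (μ t) x) (Ioo s t) := by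
    refine limForm_eq_of_indicator_right (measurable_quantile (μ t))
      (isDecreasing_indicator_quantile (μ t)) ha'
      (fun y => ?_) (b := fun y => ∫ q, x q ∂(levelKernel (μ t) y))
      (hx.toIsUnitValued.kernel_integral _) hx'
    exact limForm_eq_of_indicator_left (measurable_quantile (μ s))
      (isDecreasing_indicator_quantile (μ s)) (isDecreasing_indicator_quantile (μ t) y)
      (fun z => hxy z y) (b := fun y => ∫ q, a q ∂(levelKernel (μ s) y))
      (ha.toIsUnitValued.kernel_integral _) ha'
  refine le_limForm fun G hG => ?_
  have hGsub : G ⊆ {s} ∪ (restr (Ioo s t) G ∪ {t}) := fun u hu => by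
    simp only [Finset.mem_union, Finset.mem_singleton, mem_restr]
    have := hG hu
    rcases this.1.lt_or_eq with h2 | h2
    · rcases this.2.lt_or_eq with h3 | h3
      · exact Or.inr (Or.inl ⟨hu, h2, h3⟩)
      · exact Or.inr (Or.inr h3)
    · exact Or.inl h2.symm
  refine le_trans ?_ (form_anti (μ := μ) (fun _ => IsDecreasing.one) ha hx ∅ hGsub)
  rw [form_insert_endpoints ha.toIsUnitValued hx.toIsUnitValued hst (restr_subset _ _)]
  refine le_trans ?_ (limForm_le h1 ha'.toIsUnitValued hx'.toIsUnitValued ∅ (restr_subset _ G))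
  rw [← key]
  refine le_limForm fun F hF => ?_
  rw [← form_insert_endpoints ha.toIsUnitValued hx.toIsUnitValued hst
    (hF.trans inter_subset_right)]
  refine limForm_le h1 ha.toIsUnitValued hx.toIsUnitValued ∅ ?_
  simp only [Finset.coe_union, Finset.coe_singleton]
  exact union_subset_union_right _ (union_subset_union_left _ hF)

/-- Disconnectedness of `J \ I` provides `s` and `t` in `J \ I` on the two sides of `I`. If `R`
missed `I`, the plan of `[s, t]` would be attained without `I`; multiplying by the plans of the rest
of `J` would contradict essentiality. -/
theorem IsMarkovDense.inter_nonempty {R : Set ℝ} (hR : IsMarkovDense μ R) {I : Set ℝ}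
    (hI : IsEssentialInterval μ I) : (R ∩ I).Nonempty := by
  by_contra hne
  rw [not_nonempty_iff_eq_empty] at hne
  obtain ⟨hIc, J, hJc, hIJ, hJI, hlevel⟩ := hI
  rw [isPreconnected_iff_ordConnected, ordConnected_def] at hJI
  push Not at hJI
  obtain ⟨s, hs, t, ht, hst⟩ := hJI
  obtain ⟨z, hz, hzJI⟩ := not_subset.1 hst
  have hzJ : z ∈ J := hJc.out hs.1 ht.1 hz
  have hzI : z ∈ I := by_contra fun h => hzJI ⟨hzJ, h⟩
  have hsI : ∀ i ∈ I, s < i := fun i hi => by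
    by_contra hc
    exact hs.2 (hIc.out hi hzI ⟨not_lt.1 hc, hz.1⟩)
  have htI : ∀ i ∈ I, i < t := fun i hi => by
    by_contra hc
    exact ht.2 (hIc.out hzI hi ⟨hz.2, not_lt.1 hc⟩)
  have hlt : s < t := (hsI z hzI).trans (htI z hzI)
  have h1 := levelLE_of_limForm_pair_eq (μ := μ) hlt fun v => hR {s, t} v
  have h2 : LevelLE μ (Icc s t \ I) (Icc s t) := by
    refine (LevelLE.of_superset ?_).trans h1
    rintro u (rfl | ⟨hu1, hu2⟩ | rfl)
    · exact ⟨⟨le_rfl, hlt.le⟩, hs.2⟩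
    · exact ⟨Ioo_subset_Icc_self hu2, fun hu => by
        have : u ∈ R ∩ I := ⟨hu1, hu⟩
        rw [hne] at this; exact this⟩
    · exact ⟨⟨hlt.le, le_rfl⟩, ht.2⟩
  have hstJ : Icc s t ⊆ J := hJc.out hs.1 ht.1
  have e : J = (J ∩ Iio s) ∪ (Icc s t ∪ (J ∩ Ioi t)) := by
    ext u
    simp only [mem_union, mem_inter_iff, mem_Iio, mem_Icc, mem_Ioi]
    constructor
    · intro hu
      rcases lt_or_ge u s with h | h
      · exact Or.inl ⟨hu, h⟩
      · rcases le_or_gt u t with h' | h'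
        · exact Or.inr (Or.inl ⟨h, h'⟩)
        · exact Or.inr (Or.inr ⟨hu, h'⟩)
    · rintro (h | h | h)
      exacts [h.1, hstJ h, h.1]
  have e' : J \ I = (J ∩ Iio s) ∪ ((Icc s t \ I) ∪ (J ∩ Ioi t)) := by
    have d1 : (J ∩ Iio s) \ I = J ∩ Iio s :=
      Disjoint.sdiff_eq_left (disjoint_left.2 fun u hu hi => lt_asymm hu.2 (hsI u hi))
    have d2 : (J ∩ Ioi t) \ I = J ∩ Ioi t :=
      Disjoint.sdiff_eq_left (disjoint_left.2 fun u hu hi => lt_asymm hu.2 (htI u hi))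
    conv_lhs => rw [e]
    rw [union_sdiff_distrib, union_sdiff_distrib, d1, d2]
  have h3 : LevelLE μ (J \ I) J := by
    rw [e']
    conv => arg 3; rw [e]
    refine (LevelLE.refl _).union (h2.union (LevelLE.refl _) ?_ ?_) ?_ ?_
    · exact fun r hr u hu => hr.1.2.trans_lt hu.2
    · exact fun r hr u hu => hr.2.trans_lt hu.2
    · rintro r hr u (hu | hu)
      · exact hr.2.trans_le hu.1.1
      · exact (hr.2.trans hlt).trans hu.2
    · rintro r hr u (hu | hu)
      · exact hr.2.trans_le hu.1
      · exact (hr.2.trans hlt).trans hu.2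
  exact hlevel ((level_eq_iff_of_subset sdiff_subset).2 h3).symm

end

end

end MarkovQuantile

/-! ### Assembly of the theorem. -/

theorem theoremB (μ : ℝ → ProbabilityMeasure ℝ) :
    -- the objects of the statement are well defined
    ((∀ R : Set ℝ, ∃! P, MarkovQuantile.IsLoSup (MarkovQuantile.levelFamily μ R) P) ∧
      (∀ R : Finset ℝ, ∃! P,
        MarkovQuantile.IsMadeMarkov (MarkovQuantile.quantileProcess μ) R P) ∧
      (∃! P, MarkovQuantile.IsMarkovQuantile μ P)) ∧
    -- some nested sequence of finite sets works
    (∃ Rn : ℕ → Finset ℝ, Monotone Rn ∧ MarkovQuantile.Converges μ Rn) ∧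
    -- (a), with closed and with open intervals
    (∃ R : Set ℝ, R.Countable ∧
      (∀ s t : ℝ, s < t →
        MarkovQuantile.level μ (R ∩ Icc s t) = MarkovQuantile.level μ (Icc s t)) ∧
      (∀ s t : ℝ, s < t →
        MarkovQuantile.level μ (R ∩ Ioo s t) = MarkovQuantile.level μ (Ioo s t))) ∧
    -- (b), with closed or with open intervals
    (∀ R : Set ℝ, R.Countable →
      ((∀ s t : ℝ, s < t →
          MarkovQuantile.level μ (R ∩ Icc s t) = MarkovQuantile.level μ (Icc s t)) ∨
        (∀ s t : ℝ, s < t →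
          MarkovQuantile.level μ (R ∩ Ioo s t) = MarkovQuantile.level μ (Ioo s t))) →
      MarkovQuantile.Admissible μ R) ∧
    -- (c)
    (∀ (Rn : ℕ → Finset ℝ) (R : Set ℝ), Monotone Rn → R = (⋃ n, (Rn n : Set ℝ)) →
      MarkovQuantile.Converges μ Rn →
      -- (i)
      (MarkovQuantile.Admissible μ R ∧
        (∀ R'' : Set ℝ, R''.Countable → R ⊆ R'' → MarkovQuantile.Admissible μ R'')) ∧
      -- (ii)
      (MarkovQuantile.Admissible μ (R \ {t | t ∈ R ∧ ¬ MarkovQuantile.IsAtomicTime μ t}) ∧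
        (∀ E' : Finset ℝ,
          (∀ t ∈ E', MarkovQuantile.IsAtomicTime μ t ∧ ¬ MarkovQuantile.IsEssentialTime μ t) →
          ∃ R' : Set ℝ, MarkovQuantile.Admissible μ R' ∧ R' ∩ E' = ∅)) ∧
      -- (iii)
      ((∀ I : Set ℝ, MarkovQuantile.IsEssentialInterval μ I → (R ∩ I).Nonempty) ∧
        (∀ t : ℝ, MarkovQuantile.IsEssentialTime μ t → t ∈ R))) ∧
    -- there are at most countably many essential atomic times
    {t : ℝ | MarkovQuantile.IsEssentialTime μ t}.Countable := by
  open MarkovQuantile in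
  obtain ⟨R₀, hR₀c, hR₀o, hR₀i⟩ := exists_countable_forall_levelLE μ
  have hR₀ : IsMarkovDense μ R₀ := hR₀o.isMarkovDense
  refine ⟨⟨existsUnique_isLoSup_levelFamily μ, fun _ => existsUnique_isMadeMarkov _,
    existsUnique_isMarkovQuantile⟩, ?_, ?_, ?_, ?_, ?_⟩
  · obtain ⟨Rn, hRn, hU⟩ := exists_monotone_iUnion_eq hR₀c
    exact ⟨Rn, hRn, (hR₀.admissible hR₀c).2 Rn hRn hU⟩
  · exact ⟨R₀, hR₀c, fun s t hst => (level_eq_iff_of_subset inter_subset_right).2 (hR₀i s t hst),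
      fun s t hst => (level_eq_iff_of_subset inter_subset_right).2 (hR₀o s t hst)⟩
  · intro R hRc hR
    refine IsMarkovDense.admissible (IsOpenDense.isMarkovDense ?_) hRc
    rcases hR with hR | hR
    -- Closed intervals with rational endpoints already yield density in all open intervals.
    · exact isOpenDense_of_forall_rat fun p q hpq => ⟨Icc (p : ℝ) q, Ioo_subset_Icc_self,
        Subset.rfl, (level_eq_iff_of_subset inter_subset_right).1
          (hR p q (by exact_mod_cast hpq))⟩
    · exact fun s t hst => (level_eq_iff_of_subset inter_subset_right).1 (hR s t hst)
  · intro Rn R hRn hRU hconv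
    have hR : IsMarkovDense μ R := hRU ▸ (converges_iff hRn).1 hconv
    have hRc : R.Countable := hRU ▸ countable_iUnion fun n => (Rn n).countable_toSet
    refine ⟨⟨hR.admissible hRc, fun R'' hc hsub => (hR.mono hsub).admissible hc⟩,
      ⟨IsMarkovDense.admissible (fun S v => ?_) (hRc.mono sdiff_subset), fun E' hE' => ?_⟩,
      fun I hI => hR.inter_nonempty hI, fun t ht => ?_⟩
    · rw [limForm_diff_of_not_isAtomicTime (isDecreasing_boxObs μ v) IsDecreasing.one
        IsDecreasing.one S R _ fun t ht => ht.2]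
      exact hR S v
    -- The finite set is removed from `R₀`, whose plans on open intervals are known; for `R` only
    -- the equality of limit forms is available here.
    · exact ⟨R₀ \ E', ((hR₀o.diff_finset fun t ht => (hE' t ht).2).isMarkovDense).admissible
        (hR₀c.mono sdiff_subset), sdiff_inter_self⟩
    · obtain ⟨u, huR, rfl⟩ := hR.inter_nonempty ht
      exact huR
  · refine hR₀c.mono fun t ht => ?_
    obtain ⟨u, huR, rfl⟩ := hR₀.inter_nonempty ht
    exact huR
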